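/- **Theorem (delamination expansion).** Let $B_1(0)\subset\mathbb R^2$ be the open unit disc, $S^1=\partial B_1(0)$, and let closed curves be parametrised over $S^1\cong\mathbb R/2\pi\mathbb Z$. For $L>0$ let $$\mathcal M_L=\Big\{\gamma\in C^\infty(S^1;B_1(0)) : |\gamma'|\equiv \tfrac{L}{2\pi},\ \gamma \text{ is embedded}\Big\},$$ and let $\overline{\mathcal M}_L$ be its closure under weak convergence in $W^{2,2}(S^1;\mathbb R^2)$, i.e. the set of all $\gamma\in W^{2,2}(S^1;\mathbb R^2)$ that are weak $W^{2,2}$-limits of sequences in $\mathcal M_L$. For $\alpha\ge 0$ and $\gamma\in\overline{\mathcal M}_L$ put $$\mathcal W(\gamma)=\int_\gamma\kappa^2\,d\mathcal H^1=\int_{S^1}\frac{|\gamma''|^2-\langle\gamma'',\gamma'/|\gamma'|\rangle^2}{|\gamma'|^3}\,d\theta,\qquad \mathcal W_\alpha(\gamma)=\mathcal W(\gamma)+\alpha\,\mathcal H^1\big(S^1\setminus\gamma(S^1)\big).$$ Let $$M=\Big\{\varphi\in C_c^\infty(\mathbb R): \varphi\ge 0,\ \int_{\mathbb R}\tfrac{(\varphi')^2}{2}-\varphi\,dx=1\Big\},\qquad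 \Theta_\alpha=\inf_{\varphi\in M}\Big(\int_{\mathbb R}|\varphi''|^2\,dx+\alpha\,\mathcal H^1(\{\varphi>0\})\Big).$$ Then, for every fixed $\alpha\ge0$, the infimum $\Theta_\alpha$ is a (finite) infimum over a non-empty set, the same holds for the infimum of $\mathcal W_\alpha$ over $\overline{\mathcal M}_{2\pi+\delta}$ for all sufficiently small $\delta>0$, and $$\inf_{\gamma\in\overline{\mathcal M}_{2\pi+\delta}}\mathcal W_\alpha(\gamma)=2\pi+\Theta_\alpha\,\delta^{1/3}+o(\delta^{1/3})\qquad\text{as }\delta\searrow 0 .$$ -/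

import Mathlib

open Set Filter Topology MeasureTheory
open scoped ContDiff

noncomputable section

namespace Delamination

/-! The Euclidean plane is `ℂ`. A closed curve `S¹ → ℝ²` is a map `ℝ → ℂ` of period `2π`. -/

/-- Lebesgue measure on one period. -/
def periodMeasure : Measure ℝ := volume.restrict (Ioc 0 (2 * Real.pi))

/-- `𝓜_L`: smooth embedded closed curves in the open unit disc, of constant speed `L / 2π`
(a periodic map of positive speed is an embedding of the circle as soon as it is injective on one
period). -/
def curveClass (L : ℝ) : Set (ℝ → ℂ) :=
  {γ | Function.Periodic γ (2 * Real.pi) ∧ ContDiff ℝ ∞ γ ∧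
    (∀ θ, γ θ ∈ Metric.ball (0 : ℂ) 1) ∧
    (∀ θ, ‖deriv γ θ‖ = L / (2 * Real.pi)) ∧
    InjOn γ (Ico 0 (2 * Real.pi))}

/-- `γ ∈ W^{2,2}(S¹; ℝ²)`, for the continuously differentiable representative: `γ'` is a
primitive of its almost everywhere derivative, and the latter is square integrable. -/
def IsW22 (γ : ℝ → ℂ) : Prop :=
  Function.Periodic γ (2 * Real.pi) ∧ ContDiff ℝ 1 γ ∧
    MemLp (deriv (deriv γ)) 2 periodMeasure ∧
    ∀ a b : ℝ, deriv γ b - deriv γ a = ∫ θ in a..b, deriv (deriv γ) θ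

/-- Weak convergence in `L²(S¹; ℝ²)`. -/
def WeakL2Tendsto (u : ℕ → ℝ → ℂ) (v : ℝ → ℂ) : Prop :=
  ∀ g : ℝ → ℂ, MemLp g 2 periodMeasure →
    Tendsto (fun n => ∫ θ, inner ℝ (u n θ) (g θ) ∂periodMeasure) atTop
      (𝓝 (∫ θ, inner ℝ (v θ) (g θ) ∂periodMeasure))

/-- Weak convergence in `W^{2,2}(S¹; ℝ²)`: the functions and their derivatives up to order two
converge weakly in `L²`. -/
def WeakW22Tendsto (u : ℕ → ℝ → ℂ) (v : ℝ → ℂ) : Prop :=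
  WeakL2Tendsto u v ∧ WeakL2Tendsto (fun n => deriv (u n)) (deriv v) ∧
    WeakL2Tendsto (fun n => deriv (deriv (u n))) (deriv (deriv v))

/-- The closure of `𝓜_L`: all `W^{2,2}` curves that are weak `W^{2,2}` limits of sequences of
curves in `𝓜_L`. -/
def curveClassClosure (L : ℝ) : Set (ℝ → ℂ) :=
  {γ | IsW22 γ ∧ ∃ u : ℕ → ℝ → ℂ, (∀ n, u n ∈ curveClass L) ∧ WeakW22Tendsto u γ}

/-- The elastic energy `𝓦(γ) = ∫_γ κ² dH¹`, written in an arbitrary regular parametrisation: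
`κ² |γ'| = (|γ''|² - ⟨γ'', γ'/|γ'|⟩²) / |γ'|³`. -/
def elasticEnergy (γ : ℝ → ℂ) : ℝ :=
  ∫ θ, (‖deriv (deriv γ) θ‖ ^ 2
      - (inner ℝ (deriv (deriv γ) θ) (deriv γ θ) / ‖deriv γ θ‖) ^ 2) / ‖deriv γ θ‖ ^ 3
    ∂periodMeasure

/-- `𝓦_α(γ) = 𝓦(γ) + α H¹(S¹ ∖ γ)`. -/
def penalisedEnergy (α : ℝ) (γ : ℝ → ℂ) : ℝ :=
  elasticEnergy γ + α * (μH[1] (Metric.sphere (0 : ℂ) 1 \ range γ)).toReal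

/-- The constraint set `M` of non-negative `φ ∈ C_c^∞(ℝ)` with `∫ (φ')²/2 - φ = 1`. -/
def profileClass : Set (ℝ → ℝ) :=
  {φ | ContDiff ℝ ∞ φ ∧ HasCompactSupport φ ∧ (∀ x, 0 ≤ φ x) ∧
    ∫ x, ((deriv φ x) ^ 2 / 2 - φ x) = 1}

/-- `𝓔_α(φ) = ∫ |φ''|² + α H¹({φ > 0})`. -/
def profileEnergy (α : ℝ) (φ : ℝ → ℝ) : ℝ :=
  (∫ x, (deriv (deriv φ) x) ^ 2) + α * (μH[1] {x : ℝ | 0 < φ x}).toReal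

/-- `Θ_α`. -/
def delaminationConstant (α : ℝ) : ℝ := sInf (profileEnergy α '' profileClass)

/-- The infimum of `𝓦_α` over the closure of `𝓜_L`. -/
def minimalEnergy (α L : ℝ) : ℝ := sInf (penalisedEnergy α '' curveClassClosure L)

end Delamination

end

/-!
For a closed curve `γ` of constant speed `c` in the closed unit disc let `u = (1 - |γ|²) / 2` be its
*radial defect*, a non-negative function that vanishes exactly where the curve touches the unit
circle. The whole argument is carried out in terms of `u`.

* Energy. `u'' = -(c² + ⟨γ, γ''⟩)` and `|γ| ≤ 1` give `|γ''|² ≥ (c² + u'')²`; since `u''` has mean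
  zero, the elastic energy is at least `2 π c + c⁻³ ∫ |u''|²` (`IsConfinedCurve.le_elasticEnergy`).
* Length. The squared angular speed `r²` of `γ` around the origin satisfies
  `r² (1 - 2 u)² = c² (1 - 2 u) - u'²`, and a curve close to the circle winds once around the
  origin. Integrating, the excess length `δ` is to leading order `∫ (u'² / 2 - u)`
  (`le_abs_angularSpeed`, `angularSpeed_le`).
* Contact. The uncovered part of the circle is at least as long as `{u > 0}`, up to a term of order
  `δ` (`IsConfinedCurve.le_hausdorffMeasure_diff`), and hardly longer for the competitors below
  (`IsRadialDefect.hausdorffMeasure_diff_polarCurve_le`).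

So `u` competes in the profile problem with the constraint `1` replaced by `δ`. By the scaling
`φ ↦ λ² φ(· / λ)` that problem has the infimum `Θ_α δ^{1/3}`.

For the lower bound, a curve in the closure of `𝓜_L` is a confined curve of class `W^{2,2}`, as weak
`W^{2,2}` convergence implies pointwise convergence of the curves and of their velocities. It may be
translated until it touches the circle. If its energy is as small as claimed, then `u` is small in
`C¹`. The set `{u > 0}` splits into countably many bumps, each of which is, after mollification, a
profile in its own right. As `m ↦ m^{1/3}` is subadditive, several bumps cost at least as much as
one (`delaminationConstant_mul_rpow_le_of_nonneg`). The bound is `eventually_le_penalisedEnergy`.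

For the upper bound, a curve is determined by its speed and its radial defect, up to rotations and
reflections. The defect is prescribed as `a ε² φ(· / ε)` with `ε = δ^{1/3}`, and the intermediate
value theorem yields an amplitude `a` near `1` for which the curve closes up
(`IsBumpShape.exists_polarCurve_mem_closure`). Closed curves of a slightly larger length, shrunk
into the open disc, are embedded and converge to it, so it lies in the closure of `𝓜_L`. The bound
is `eventually_exists_penalisedEnergy_le`.
-/

noncomputable section

namespace Delamination

/-! ### Profiles: scaling and non-emptiness -/

lemma profileEnergy_nonneg {α : ℝ} (hα : 0 ≤ α) (φ : ℝ → ℝ) : 0 ≤ profileEnergy α φ := by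
  unfold profileEnergy
  have : 0 ≤ ∫ x, (deriv (deriv φ) x) ^ 2 := integral_nonneg fun x => sq_nonneg _
  positivity

lemma bddBelow_profileEnergy {α : ℝ} (hα : 0 ≤ α) :
    BddBelow (profileEnergy α '' profileClass) :=
  ⟨0, by rintro _ ⟨φ, -, rfl⟩; exact profileEnergy_nonneg hα φ⟩

lemma delaminationConstant_nonneg {α : ℝ} (hα : 0 ≤ α) : 0 ≤ delaminationConstant α :=
  Real.sInf_nonneg (by rintro _ ⟨φ, -, rfl⟩; exact profileEnergy_nonneg hα φ)

lemma delaminationConstant_le {α : ℝ} (hα : 0 ≤ α) {φ : ℝ → ℝ} (hφ : φ ∈ profileClass) :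
    delaminationConstant α ≤ profileEnergy α φ :=
  csInf_le (bddBelow_profileEnergy hα) ⟨φ, hφ, rfl⟩

lemma deriv_scale (φ : ℝ → ℝ) (k l : ℝ) :
    deriv (fun x => k * φ (l * x)) = fun x => (k * l) * deriv φ (l * x) := by
  funext x
  rw [deriv_const_mul_field, deriv_comp_mul_left]
  simp [mul_assoc]

/-- Under `φ ↦ λ² φ(· / λ)` the constraint functional scales like `λ³` and the energy like `λ`,
which turns the definition of `Θ_α` into a homogeneous inequality. -/
lemma delaminationConstant_mul_rpow_le {α : ℝ} (hα : 0 ≤ α) {φ : ℝ → ℝ} (hφ : ContDiff ℝ ∞ φ)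
    (hc : HasCompactSupport φ) (h0 : ∀ x, 0 ≤ φ x) {m : ℝ} (hm : 0 < m)
    (hφm : ∫ x, ((deriv φ x) ^ 2 / 2 - φ x) = m) :
    delaminationConstant α * m ^ (1 / 3 : ℝ) ≤ profileEnergy α φ := by
  set μ : ℝ := m ^ (1 / 3 : ℝ) with hμ
  have hμ0 : 0 < μ := Real.rpow_pos_of_pos hm _
  have hμ3 : μ ^ 3 = m := by
    rw [hμ, ← Real.rpow_natCast, ← Real.rpow_mul hm.le]; norm_num
  set ψ : ℝ → ℝ := fun x => (μ⁻¹ ^ 2) * φ (μ * x) with hψ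
  have d1 : deriv ψ = fun x => (μ⁻¹ ^ 2 * μ) * deriv φ (μ * x) := deriv_scale φ _ _
  have d2 : deriv (deriv ψ) = fun x => (μ⁻¹ ^ 2 * μ * μ) * deriv (deriv φ) (μ * x) := by
    rw [d1]; exact deriv_scale (deriv φ) _ _
  have hmem : ψ ∈ profileClass := by
    refine ⟨by fun_prop, ?_, fun x => mul_nonneg (by positivity) (h0 _), ?_⟩
    · exact (hc.comp_homeomorph (Homeomorph.mulLeft₀ μ hμ0.ne')).mul_left
    · have : (fun x => (deriv ψ x) ^ 2 / 2 - ψ x)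
          = fun x => μ⁻¹ ^ 2 * ((fun y => (deriv φ y) ^ 2 / 2 - φ y) (μ * x)) := by
        funext x
        rw [d1]
        simp only [hψ]
        field_simp
      rw [this, integral_const_mul, Measure.integral_comp_mul_left
        (fun y => (deriv φ y) ^ 2 / 2 - φ y), hφm, ← hμ3, abs_of_pos (inv_pos.2 hμ0), smul_eq_mul]
      field_simp
  have hE : profileEnergy α ψ = μ⁻¹ * profileEnergy α φ := by
    unfold profileEnergy
    have e1 : (fun x => (deriv (deriv ψ) x) ^ 2)
        = fun x => (fun y => (deriv (deriv φ) y) ^ 2) (μ * x) := by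
      funext x
      simp only [d2]
      field_simp
    have e2 : {x : ℝ | 0 < ψ x} = (fun x => μ * x) ⁻¹' {x | 0 < φ x} := by
      ext x
      simp only [hψ, mem_ofPred_eq, mem_preimage]
      exact mul_pos_iff_of_pos_left (by positivity)
    rw [e1, Measure.integral_comp_mul_left (fun y => (deriv (deriv φ) y) ^ 2), e2,
      hausdorffMeasure_real, Real.volume_preimage_mul_left hμ0.ne', ENNReal.toReal_mul,
      ENNReal.toReal_ofReal (abs_nonneg _), abs_of_pos (inv_pos.2 hμ0), smul_eq_mul]
    ring
  have := delaminationConstant_le hα hmem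
  rw [hE, inv_mul_eq_div, le_div_iff₀ hμ0] at this
  exact this

lemma profileClass_nonempty : profileClass.Nonempty := by
  let b : ContDiffBump (0 : ℝ) := ⟨1, 2, one_pos, one_lt_two⟩
  have hb : ContDiff ℝ ∞ b := b.contDiff
  have hbc : HasCompactSupport b := b.hasCompactSupport
  have hd : Continuous (deriv b) := hb.continuous_deriv (by simp)
  have hdc : HasCompactSupport (deriv b) := hbc.deriv
  have i1 : Integrable (fun x => (deriv b x) ^ 2 / 2) := by
    refine Continuous.integrable_of_hasCompactSupport (by fun_prop) ?_
    exact hdc.comp_left (g := fun y : ℝ => y ^ 2 / 2) (by simp)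
  have i2 : Integrable b := hb.continuous.integrable_of_hasCompactSupport hbc
  set P := ∫ x, (deriv b x) ^ 2 / 2 with hP
  set Q := ∫ x, b x with hQ
  have hQ0 : 0 ≤ Q := integral_nonneg fun x => b.nonneg
  have hP0 : 0 < P := by
    refine lt_of_le_of_ne (integral_nonneg fun x => by positivity) fun h => ?_
    have h1 := (integral_eq_zero_iff_of_nonneg (fun x => by positivity) i1).1 (hP ▸ h.symm)
    have h2 : (fun x => (deriv b x) ^ 2 / 2) = fun _ => 0 :=
      (Continuous.ae_eq_iff_eq volume (by fun_prop) continuous_const).1 h1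
    have h3 : ∀ x, deriv b x = 0 := fun x => by simpa using congrFun h2 x
    have h4 := is_const_of_deriv_eq_zero (hb.differentiable (by simp)) h3 0 3
    rw [b.one_of_mem_closedBall (by simp [b]), b.zero_of_le_dist (by simp [b]; norm_num)] at h4
    exact one_ne_zero h4
  -- the amplitude is the positive root of `a² P - a Q = 1`
  set a := (Q + Real.sqrt (Q ^ 2 + 4 * P)) / (2 * P) with ha
  have hs : Real.sqrt (Q ^ 2 + 4 * P) ^ 2 = Q ^ 2 + 4 * P := Real.sq_sqrt (by positivity)
  have ha0 : 0 ≤ a := by positivity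
  have haeq : a ^ 2 * P - a * Q = 1 := by
    rw [ha]; field_simp; nlinarith [hs]
  have hd' : deriv (fun x => a * b x) = fun x => a * deriv b x := by
    funext x; rw [deriv_const_mul_field]
  refine ⟨fun x => a * b x, contDiff_const.mul hb, hbc.mul_left,
    fun x => mul_nonneg ha0 b.nonneg, ?_⟩
  rw [hd']
  calc ∫ x, ((a * deriv b x) ^ 2 / 2 - a * b x)
      = ∫ x, (a ^ 2 * ((deriv b x) ^ 2 / 2) - a * b x) := by congr 1; funext x; ring
    _ = 1 := by
      rw [integral_sub (i1.const_mul _) (i2.const_mul _), integral_const_mul, integral_const_mul,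
        haeq]

/-! ### Profiles of class `W^{2,2}` -/

open scoped Convolution

/-- Mollification of a primitive is the primitive of the mollification. -/
lemma hasDerivAt_convolution_primitive {ρ V W : ℝ → ℝ} (hρ : Continuous ρ)
    (hρc : HasCompactSupport ρ) (hW : Integrable W) (hV : Continuous V)
    (hVW : ∀ x y, V y - V x = ∫ s in x..y, W s) (x : ℝ) :
    HasDerivAt (ρ ⋆ V) ((ρ ⋆ W) x) x := by
  have hcont : Continuous (ρ ⋆ W) :=
    hρc.continuous_convolution_left _ hρ hW.locallyIntegrable
  have hρi : Integrable ρ := hρ.integrable_of_hasCompactSupport hρc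
  have hex : ∀ y, Integrable fun t => ρ t * V (y - t) := fun y =>
    Continuous.integrable_of_hasCompactSupport (by fun_prop) hρc.mul_right
  have key : ∀ y, (ρ ⋆ V) y = (ρ ⋆ V) 0 + ∫ s in (0 : ℝ)..y, (ρ ⋆ W) s := by
    intro y
    have h1 : Integrable (Function.uncurry fun s t => ρ t * W (s - t))
        ((volume.restrict (uIoc 0 y)).prod volume) := by
      have := hρi.convolution_integrand (ContinuousLinearMap.lsmul ℝ ℝ) hW
      refine (this.mono_measure (Measure.prod_mono Measure.restrict_le_self le_rfl)).congr ?_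
      exact Eventually.of_forall fun p => by simp [Function.uncurry]
    have h2 : ∫ s in (0 : ℝ)..y, (ρ ⋆ W) s = ∫ t, ∫ s in (0 : ℝ)..y, ρ t * W (s - t) := by
      rw [← intervalIntegral_integral_swap h1]
      simp [convolution_def]
    have h3 : ∀ t, ∫ s in (0 : ℝ)..y, ρ t * W (s - t) = ρ t * V (y - t) - ρ t * V (0 - t) := by
      intro t
      rw [intervalIntegral.integral_const_mul,
        intervalIntegral.integral_comp_sub_right (fun s => W s),
        ← hVW]
      ring
    rw [h2]
    simp only [h3]
    rw [integral_sub (hex y) (hex 0)]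
    simp [convolution_def]
  have : (ρ ⋆ V) = fun y => (ρ ⋆ V) 0 + ∫ s in (0 : ℝ)..y, (ρ ⋆ W) s := funext key
  rw [this]
  exact (intervalIntegral.integral_hasDerivAt_right (hcont.intervalIntegrable _ _)
    (hcont.stronglyMeasurableAtFilter _ _) hcont.continuousAt).const_add _

/-- Averaging does not increase the `L²` norm. -/
lemma integral_sq_convolution_le {ρ W : ℝ → ℝ} (hρ : Continuous ρ)
    (hρc : HasCompactSupport ρ) (hρ0 : ∀ x, 0 ≤ ρ x) (hρ1 : ∫ x, ρ x = 1)
    (hW : Integrable W) (hW2 : Integrable fun x => W x ^ 2) :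
    ∫ x, ((ρ ⋆ W) x) ^ 2 ≤ ∫ x, W x ^ 2 := by
  have hρi : Integrable ρ := hρ.integrable_of_hasCompactSupport hρc
  have e1 : ∀ x, Integrable fun t => ρ t * W (x - t) := fun x => by
    have := hρc.convolutionExists_left (ContinuousLinearMap.lsmul ℝ ℝ) hρ hW.locallyIntegrable x
    simpa [ConvolutionExistsAt] using this
  have e2 : ∀ x, Integrable fun t => ρ t * W (x - t) ^ 2 := fun x => by
    have := hρc.convolutionExists_left (ContinuousLinearMap.lsmul ℝ ℝ) hρ hW2.locallyIntegrable x
    simpa [ConvolutionExistsAt] using this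
  have pw : ∀ x, ((ρ ⋆ W) x) ^ 2 ≤ (ρ ⋆ fun y => W y ^ 2) x := by
    intro x
    set z := (ρ ⋆ W) x with hz
    have hz' : z = ∫ t, ρ t * W (x - t) := by simp [hz, convolution_def]
    calc z ^ 2 = ∫ t, (2 * z * (ρ t * W (x - t)) - z ^ 2 * ρ t) := by
          rw [integral_sub ((e1 x).const_mul _) (hρi.const_mul _), integral_const_mul,
            integral_const_mul, ← hz', hρ1]
          ring
      _ ≤ ∫ t, ρ t * W (x - t) ^ 2 := by
          refine integral_mono (((e1 x).const_mul _).sub (hρi.const_mul _)) (e2 x) fun t => ?_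
          have := mul_nonneg (hρ0 t) (sq_nonneg (W (x - t) - z))
          dsimp only
          nlinarith
      _ = _ := by simp [convolution_def]
  calc ∫ x, ((ρ ⋆ W) x) ^ 2 ≤ ∫ x, (ρ ⋆ fun y => W y ^ 2) x :=
        integral_mono_of_nonneg (Eventually.of_forall fun x => sq_nonneg _)
          (hρi.integrable_convolution (ContinuousLinearMap.lsmul ℝ ℝ) hW2)
          (Eventually.of_forall pw)
    _ = ∫ x, W x ^ 2 := by
        rw [integral_convolution (ContinuousLinearMap.lsmul ℝ ℝ) hρi hW2, hρ1]
        simp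

lemma abs_convolution_le {ρ V : ℝ → ℝ} (hρi : Integrable ρ) (hρ0 : ∀ x, 0 ≤ ρ x)
    (hρ1 : ∫ x, ρ x = 1) {C : ℝ} (hV : ∀ x, |V x| ≤ C) (x : ℝ) : |(ρ ⋆ V) x| ≤ C := by
  have := norm_integral_le_of_norm_le (f := fun t => ρ t * V (x - t)) (hρi.mul_const C)
    (Eventually.of_forall fun t => by
      rw [norm_mul, Real.norm_eq_abs, Real.norm_eq_abs, abs_of_nonneg (hρ0 t)]
      exact mul_le_mul_of_nonneg_left (hV _) (hρ0 t))
  rw [integral_mul_const, hρ1, one_mul] at this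
  simpa [convolution_def] using this

lemma convolution_eq_zero_of_notMem {ρ V : ℝ → ℝ} {a b r : ℝ}
    (hρ : ∀ x, r ≤ |x| → ρ x = 0) (hV : ∀ x, x ∉ Icc a b → V x = 0) {x : ℝ}
    (hx : x ∉ Icc (a - r) (b + r)) : (ρ ⋆ V) x = 0 := by
  rw [convolution_def]
  refine integral_eq_zero_of_ae (Eventually.of_forall fun t => ?_)
  by_cases ht : r ≤ |t|
  · simp [hρ t ht]
  · have : x - t ∉ Icc a b := fun h => hx ⟨by
      have := neg_abs_le t; have := h.1; linarith, by
      have := le_abs_self t; have := h.2; linarith⟩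
    simp [hV _ this]

/-- The homogeneous inequality defining `Θ_α` extends from smooth profiles to `W^{2,2}` profiles
supported in an interval, by mollification. -/
lemma delaminationConstant_mul_rpow_le_of_support {α : ℝ} (hα : 0 ≤ α) {U V W : ℝ → ℝ} {a b : ℝ}
    (hab : a ≤ b) (hU : ∀ x, HasDerivAt U (V x) x) (hVW : ∀ x y, V y - V x = ∫ s in x..y, W s)
    (hV : Continuous V) (hW : Integrable W) (hW2 : Integrable fun x => W x ^ 2)
    (hU0 : ∀ x, 0 ≤ U x)
    (hUs : ∀ x, x ∉ Icc a b → U x = 0) (hVs : ∀ x, x ∉ Icc a b → V x = 0)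
    (hm : 0 < ∫ x, (V x ^ 2 / 2 - U x)) :
    delaminationConstant α * (∫ x, (V x ^ 2 / 2 - U x)) ^ (1 / 3 : ℝ)
      ≤ (∫ x, W x ^ 2) + α * (b - a) := by
  have hUc : Continuous U := continuous_iff_continuousAt.2 fun x => (hU x).continuousAt
  have hUcs : HasCompactSupport U := HasCompactSupport.intro isCompact_Icc hUs
  have hVcs : HasCompactSupport V := HasCompactSupport.intro isCompact_Icc hVs
  have hdU : deriv U = V := funext fun x => (hU x).deriv
  have hU1 : ContDiff ℝ 1 U := contDiff_one_iff_deriv.2 ⟨fun x => (hU x).differentiableAt, hdU ▸ hV⟩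
  let r : ℕ → ℝ := fun n => 1 / ((n : ℝ) + 1)
  have hr0 : ∀ n, 0 < r n := fun n => by positivity
  have hr1 : ∀ n, r n ≤ 1 := fun n => by
    simp only [r]; rw [div_le_one (by positivity)]; linarith [(Nat.cast_nonneg n : (0 : ℝ) ≤ n)]
  have hr : Tendsto r atTop (𝓝 0) := tendsto_one_div_add_atTop_nhds_zero_nat
  let B : ℕ → ContDiffBump (0 : ℝ) := fun n =>
    ⟨r n / 2, r n, by linarith [hr0 n], by linarith [hr0 n]⟩
  let ρ : ℕ → ℝ → ℝ := fun n => (B n).normed volume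
  have hρs : ∀ n, ContDiff ℝ ∞ (ρ n) := fun n => (B n).contDiff_normed
  have hρ : ∀ n, Continuous (ρ n) := fun n => (hρs n).continuous
  have hρc : ∀ n, HasCompactSupport (ρ n) := fun n => (B n).hasCompactSupport_normed
  have hρ0 : ∀ n x, 0 ≤ ρ n x := fun n x => (B n).nonneg_normed x
  have hρ1 : ∀ n, ∫ x, ρ n x = 1 := fun n => (B n).integral_normed
  have hρi : ∀ n, Integrable (ρ n) := fun n => (hρ n).integrable_of_hasCompactSupport (hρc n)
  have hρz : ∀ n x, r n ≤ |x| → ρ n x = 0 := fun n x hx => by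
    have : x ∉ Function.support (ρ n) := by
      rw [(B n).support_normed_eq]; simpa [B] using hx
    simpa using this
  let f : ℕ → ℝ → ℝ := fun n => ρ n ⋆ U
  have hd1 : ∀ n, deriv (f n) = ρ n ⋆ V := fun n => funext fun x => by
    have := hUcs.hasDerivAt_convolution_right (ContinuousLinearMap.lsmul ℝ ℝ)
      (hρi n).locallyIntegrable hU1 x
    rw [hdU] at this
    exact this.deriv
  have hd2 : ∀ n, deriv (deriv (f n)) = ρ n ⋆ W := fun n => funext fun x => by
    rw [hd1]
    exact (hasDerivAt_convolution_primitive (hρ n) (hρc n) hW hV hVW x).deriv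
  have hfs : ∀ n, ContDiff ℝ ∞ (f n) := fun n =>
    (hρc n).contDiff_convolution_left _ (hρs n) hUc.locallyIntegrable
  have hfc : ∀ n, HasCompactSupport (f n) := fun n => (hρc n).convolution _ hUcs
  have hf0 : ∀ n x, 0 ≤ f n x := fun n x => by
    simp only [f, convolution_def]
    exact integral_nonneg fun t => by simpa using mul_nonneg (hρ0 n t) (hU0 _)
  have hfz : ∀ n x, x ∉ Icc (a - r n) (b + r n) → f n x = 0 := fun n x hx =>
    convolution_eq_zero_of_notMem (hρz n) hUs hx
  have hgz : ∀ n x, x ∉ Icc (a - r n) (b + r n) → (ρ n ⋆ V) x = 0 := fun n x hx =>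
    convolution_eq_zero_of_notMem (hρz n) hVs hx
  -- the energies
  have hE : ∀ n, profileEnergy α (f n) ≤ (∫ x, W x ^ 2) + α * (b - a + 2 * r n) := by
    intro n
    unfold profileEnergy
    rw [hd2 n, hausdorffMeasure_real]
    have h1 := integral_sq_convolution_le (hρ n) (hρc n) (hρ0 n) (hρ1 n) hW hW2
    have h2 : (volume {x | 0 < f n x}).toReal ≤ b - a + 2 * r n := by
      have : {x | 0 < f n x} ⊆ Icc (a - r n) (b + r n) := fun x hx => by
        by_contra h
        exact (ne_of_gt hx) (hfz n x h)
      refine ENNReal.toReal_le_of_le_ofReal (by linarith [hr0 n]) ((measure_mono this).trans ?_)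
      rw [Real.volume_Icc]
      exact ENNReal.ofReal_le_ofReal (by linarith)
    have := mul_le_mul_of_nonneg_left h2 hα
    linarith
  -- the constraints
  obtain ⟨C, hC⟩ := hUcs.exists_bound_of_continuous hUc
  obtain ⟨D, hD⟩ := hVcs.exists_bound_of_continuous hV
  have hlim : Tendsto (fun n => ∫ x, ((deriv (f n) x) ^ 2 / 2 - f n x)) atTop
      (𝓝 (∫ x, (V x ^ 2 / 2 - U x))) := by
    refine tendsto_integral_of_dominated_convergence
      ((Icc (a - 1) (b + 1)).indicator fun _ => D ^ 2 / 2 + C) (fun n => ?_) ?_ (fun n => ?_) ?_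
    · have := (hfs n).continuous
      have := (hfs n).continuous_deriv (by simp)
      exact Continuous.aestronglyMeasurable (by fun_prop)
    · exact (integrable_indicator_iff measurableSet_Icc).2 (by simp)
    · refine Eventually.of_forall fun x => ?_
      rw [hd1 n]
      by_cases hx : x ∈ Icc (a - 1) (b + 1)
      · rw [indicator_of_mem hx]
        have h1 := abs_convolution_le (hρi n) (hρ0 n) (hρ1 n) hD x
        have h2 := abs_convolution_le (hρi n) (hρ0 n) (hρ1 n) hC x
        have h3 : ((ρ n ⋆ V) x) ^ 2 ≤ D ^ 2 := sq_le_sq' (abs_le.1 h1).1 (abs_le.1 h1).2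
        have h4 := hf0 n x
        have h5 : f n x ≤ C := (abs_le.1 h2).2
        rw [Real.norm_eq_abs, abs_le]
        constructor <;> nlinarith [sq_nonneg ((ρ n ⋆ V) x), sq_nonneg D]
      · have hx' : x ∉ Icc (a - r n) (b + r n) := fun h => hx
          ⟨by linarith [h.1, hr1 n], by linarith [h.2, hr1 n]⟩
        rw [indicator_of_notMem hx, hfz n x hx', hgz n x hx']
        simp
    · refine Eventually.of_forall fun x => ?_
      simp only [hd1]
      have t1 := ContDiffBump.convolution_tendsto_right_of_continuous (φ := B) (μ := volume)
        (l := atTop) hr hUc x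
      have t2 := ContDiffBump.convolution_tendsto_right_of_continuous (φ := B) (μ := volume)
        (l := atTop) hr hV x
      exact ((t2.pow 2).div_const 2).sub t1
  have hev : ∀ᶠ n in atTop, delaminationConstant α *
      (∫ x, ((deriv (f n) x) ^ 2 / 2 - f n x)) ^ (1 / 3 : ℝ)
      ≤ (∫ x, W x ^ 2) + α * (b - a + 2 * r n) := by
    filter_upwards [hlim.eventually (lt_mem_nhds hm)] with n hn
    exact (delaminationConstant_mul_rpow_le hα (hfs n) (hfc n) (hf0 n) hn rfl).trans (hE n)
  refine le_of_tendsto_of_tendsto ((hlim.rpow_const (Or.inl hm.ne')).const_mul _) ?_ hev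
  have : Tendsto (fun n => (∫ x, W x ^ 2) + α * (b - a + 2 * r n)) atTop
      (𝓝 ((∫ x, W x ^ 2) + α * (b - a + 2 * 0))) :=
    ((hr.const_mul 2).const_add _ |>.const_mul α).const_add _
  simpa using this

/-- The homogeneous inequality for a `W^{2,2}` function on an interval with clamped ends. -/
lemma delaminationConstant_mul_rpow_le_of_clamped {α : ℝ} (hα : 0 ≤ α) {u v w : ℝ → ℝ} {a b : ℝ}
    (hab : a ≤ b) (hu : ∀ x, HasDerivAt u (v x) x)
    (hvw : ∀ x y, v y - v x = ∫ s in x..y, w s)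
    (hw : IntegrableOn w (Ioc a b)) (hw2 : IntegrableOn (fun x => w x ^ 2) (Ioc a b))
    (hu0 : ∀ x, 0 ≤ u x) (hua : u a = 0) (hub : u b = 0) (hva : v a = 0) (hvb : v b = 0)
    (hm : 0 < ∫ x in Ioc a b, (v x ^ 2 / 2 - u x)) :
    delaminationConstant α * (∫ x in Ioc a b, (v x ^ 2 / 2 - u x)) ^ (1 / 3 : ℝ)
      ≤ (∫ x in Ioc a b, w x ^ 2) + α * (b - a) := by
  set U := (Ioc a b).indicator u with hUdef
  set V := (Ioc a b).indicator v with hVdef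
  set W := (Ioc a b).indicator w with hWdef
  have hIcc : ∀ {f : ℝ → ℝ}, f a = 0 → ∀ x ∈ Icc a b, (Ioc a b).indicator f x = f x := by
    intro f hf x hx
    rcases eq_or_lt_of_le hx.1 with rfl | h
    · simp [hf]
    · exact indicator_of_mem (show x ∈ Ioc a b from ⟨h, hx.2⟩) f
  have hU : ∀ x, HasDerivAt U (V x) x := by
    intro x
    rcases lt_or_ge x a with h1 | h1
    · have : U =ᶠ[𝓝 x] fun _ => 0 := by
        filter_upwards [Iio_mem_nhds h1] with y hy
        exact indicator_of_notMem (fun h => absurd h.1 (not_lt.2 (le_of_lt hy))) _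
      rw [hVdef, indicator_of_notMem (fun h => absurd h.1 (not_lt.2 h1.le))]
      exact (hasDerivAt_const x (0 : ℝ)).congr_of_eventuallyEq this
    rcases lt_or_ge b x with h2 | h2
    · have : U =ᶠ[𝓝 x] fun _ => 0 := by
        filter_upwards [Ioi_mem_nhds h2] with y hy
        exact indicator_of_notMem (fun h => absurd h.2 (not_le.2 hy)) _
      rw [hVdef, indicator_of_notMem (fun h => absurd h.2 (not_le.2 h2))]
      exact (hasDerivAt_const x (0 : ℝ)).congr_of_eventuallyEq this
    rw [hVdef, hIcc hva x ⟨h1, h2⟩]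
    have hend : u x = 0 → v x = 0 → HasDerivAt U (v x) x := by
      intro e1 e2
      have h := hu x
      rw [e2, hasDerivAt_iff_isLittleO] at h ⊢
      refine Asymptotics.IsBigO.trans_isLittleO (Asymptotics.isBigO_of_le _ fun y => ?_) h
      rw [hUdef, hIcc hua x ⟨h1, h2⟩, e1]
      by_cases hy : y ∈ Ioc a b
      · rw [indicator_of_mem hy]
      · rw [indicator_of_notMem hy]; simp
    rcases eq_or_lt_of_le h1 with rfl | h1'
    · exact hend hua hva
    rcases eq_or_lt_of_le h2 with rfl | h2'
    · exact hend hub hvb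
    refine (hu x).congr_of_eventuallyEq ?_
    filter_upwards [Ioo_mem_nhds h1' h2'] with y hy
    exact indicator_of_mem (Ioo_subset_Ioc_self hy) _
  have hWi : Integrable W := (integrable_indicator_iff measurableSet_Ioc).2 hw
  have hWz : ∀ p q, Disjoint (uIoc p q) (Ioc a b) → ∫ s in p..q, W s = 0 := by
    intro p q h
    refine intervalIntegral.integral_zero_ae (Eventually.of_forall fun x hx => ?_)
    exact indicator_of_notMem (disjoint_left.1 h hx) _
  have hVa : ∀ y, V y = ∫ s in a..y, W s := by
    intro y
    have hin : ∀ y ∈ Icc a b, v y = ∫ s in a..y, W s := by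
      intro y hy
      have : v y = ∫ s in a..y, w s := by rw [← hvw, hva, sub_zero]
      rw [this]
      refine intervalIntegral.integral_congr_ae (Eventually.of_forall fun x hx => ?_)
      rw [uIoc_of_le hy.1] at hx
      exact (indicator_of_mem (show x ∈ Ioc a b from ⟨hx.1, hx.2.trans hy.2⟩) w).symm
    rcases lt_or_ge y a with h1 | h1
    · rw [hWz a y ?_, hVdef, indicator_of_notMem (fun h => absurd h.1 (not_lt.2 h1.le))]
      rw [uIoc_of_ge h1.le]
      exact disjoint_left.2 fun x hx hx' => absurd hx'.1 (not_lt.2 hx.2)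
    rcases lt_or_ge b y with h2 | h2
    · rw [← intervalIntegral.integral_add_adjacent_intervals (b := b) hWi.intervalIntegrable
        hWi.intervalIntegrable, ← hin b ⟨hab, le_rfl⟩, hvb, hWz b y ?_, hVdef,
        indicator_of_notMem (fun h => absurd h.2 (not_le.2 h2)), add_zero]
      rw [uIoc_of_le h2.le]
      exact disjoint_left.2 fun x hx hx' => absurd hx.1 (not_lt.2 hx'.2)
    · rw [hVdef, hIcc hva y ⟨h1, h2⟩, hin y ⟨h1, h2⟩]
  have hVW : ∀ x y, V y - V x = ∫ s in x..y, W s := by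
    intro x y
    rw [hVa x, hVa y, intervalIntegral.integral_interval_sub_left hWi.intervalIntegrable
      hWi.intervalIntegrable]
  have hVc : Continuous V := by
    rw [show V = fun y => ∫ s in a..y, W s from funext hVa]
    exact intervalIntegral.continuous_primitive (fun p q => hWi.intervalIntegrable) a
  have hW2e : (fun x => W x ^ 2) = (Ioc a b).indicator fun x => w x ^ 2 := by
    funext x
    by_cases hx : x ∈ Ioc a b
    · simp [hWdef, hx]
    · simp [hWdef, hx]
  have hme : (fun x => V x ^ 2 / 2 - U x)
      = (Ioc a b).indicator fun x => v x ^ 2 / 2 - u x := by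
    funext x
    by_cases hx : x ∈ Ioc a b
    · simp [hUdef, hVdef, hx]
    · simp [hUdef, hVdef, hx]
  have hmi : ∫ x, (V x ^ 2 / 2 - U x) = ∫ x in Ioc a b, (v x ^ 2 / 2 - u x) := by
    rw [hme, integral_indicator measurableSet_Ioc]
  have hwi : ∫ x, W x ^ 2 = ∫ x in Ioc a b, w x ^ 2 := by
    rw [hW2e, integral_indicator measurableSet_Ioc]
  rw [← hmi, ← hwi]
  refine delaminationConstant_mul_rpow_le_of_support hα hab hU hVW hVc hWi ?_ ?_ ?_ ?_ (hmi ▸ hm)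
  · rw [hW2e]; exact (integrable_indicator_iff measurableSet_Ioc).2 hw2
  · exact fun x => indicator_nonneg (fun y _ => hu0 y) x
  · exact fun x hx => indicator_of_notMem (fun h => hx (Ioc_subset_Icc_self h)) _
  · exact fun x hx => indicator_of_notMem (fun h => hx (Ioc_subset_Icc_self h)) _

/-! ### Decomposition into bumps -/

/-- A connected component of a bounded open subset of `ℝ` is an open interval with end points
outside the set. -/
lemma exists_connectedComponentIn_eq_Ioo {S : Set ℝ} {a b : ℝ} (hS : IsOpen S)
    (hab : S ⊆ Ioo a b) {x : ℝ} (hx : x ∈ S) :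
    ∃ p q, p < q ∧ connectedComponentIn S x = Ioo p q ∧ p ∉ S ∧ q ∉ S ∧ a ≤ p ∧ q ≤ b := by
  set I := connectedComponentIn S x with hI
  have hxI : x ∈ I := mem_connectedComponentIn hx
  have hIS : I ⊆ S := connectedComponentIn_subset S x
  have hIo : IsOpen I := hS.connectedComponentIn
  have hIp : IsPreconnected I := isPreconnected_connectedComponentIn
  have hne : I.Nonempty := ⟨x, hxI⟩
  have hb : BddBelow I := ⟨a, fun y hy => (hab (hIS hy)).1.le⟩
  have ha : BddAbove I := ⟨b, fun y hy => (hab (hIS hy)).2.le⟩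
  have hp : sInf I ∉ I := fun h => by
    have h' : I ∈ 𝓝[<] (sInf I) := mem_nhdsWithin_of_mem_nhds (hIo.mem_nhds h)
    obtain ⟨y, hy, hyI⟩ := ((eventually_mem_set.2 h').and self_mem_nhdsWithin).exists
    exact absurd (csInf_le hb hy) (not_le.2 hyI)
  have hq : sSup I ∉ I := fun h => by
    have h' : I ∈ 𝓝[>] (sSup I) := mem_nhdsWithin_of_mem_nhds (hIo.mem_nhds h)
    obtain ⟨y, hy, hyI⟩ := ((eventually_mem_set.2 h').and self_mem_nhdsWithin).exists
    exact absurd (le_csSup ha hy) (not_le.2 hyI)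
  -- a boundary point of the component that lies in `S` would belong to the component
  have hcl : ∀ y ∈ closure I, y ∈ S → y ∈ I := fun y hy hyS => by
    have h1 : IsPreconnected (insert y I) :=
      hIp.subset_closure (subset_insert _ _) (insert_subset hy subset_closure)
    exact h1.subset_connectedComponentIn (mem_insert_of_mem _ hxI) (insert_subset hyS hIS)
      (mem_insert _ _)
  refine ⟨sInf I, sSup I, ?_, ?_, fun h => hp (hcl _ (csInf_mem_closure hne hb) h),
    fun h => hq (hcl _ (csSup_mem_closure hne ha) h),
    le_csInf hne fun y hy => (hab (hIS hy)).1.le, csSup_le hne fun y hy => (hab (hIS hy)).2.le⟩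
  · exact (lt_of_le_of_ne (csInf_le hb hxI) fun h => hp (h ▸ hxI)).trans
      (lt_of_le_of_ne (le_csSup ha hxI) fun h => hq (h ▸ hxI))
  · refine Subset.antisymm (fun y hy => ?_) (IsConnected.Ioo_csInf_csSup_subset ⟨hne, hIp⟩ hb ha)
    exact ⟨lt_of_le_of_ne (csInf_le hb hy) fun h => hp (h ▸ hy),
      lt_of_le_of_ne (le_csSup ha hy) fun h => hq (h ▸ hy)⟩

/-- The homogeneous inequality for a non-negative function that may vanish in between: since
`m ↦ m^{1/3}` is subadditive, splitting into several bumps does not lower the energy. -/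
lemma delaminationConstant_mul_rpow_le_of_nonneg {α : ℝ} (hα : 0 ≤ α) {u v w : ℝ → ℝ} {a b : ℝ}
    (hab : a ≤ b) (hu : ∀ x, HasDerivAt u (v x) x) (hv : Continuous v)
    (hvw : ∀ x y, v y - v x = ∫ s in x..y, w s)
    (hw : IntegrableOn w (Ioc a b)) (hw2 : IntegrableOn (fun x => w x ^ 2) (Ioc a b))
    (hu0 : ∀ x, 0 ≤ u x) (hua : u a = 0) (hub : u b = 0) {m : ℝ} (hm : 0 < m)
    (hmle : m ≤ ∫ x in Ioc a b, (v x ^ 2 / 2 - u x)) :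
    delaminationConstant α * m ^ (1 / 3 : ℝ)
      ≤ (∫ x in Ioc a b, w x ^ 2) + α * (volume ({x | 0 < u x} ∩ Ioo a b)).toReal := by
  set Θ := delaminationConstant α with hΘ
  have hΘ0 : 0 ≤ Θ := delaminationConstant_nonneg hα
  have huc : Continuous u := continuous_iff_continuousAt.2 fun x => (hu x).continuousAt
  set S := {x | 0 < u x} ∩ Ioo a b with hSdef
  have hSo : IsOpen S := (isOpen_lt continuous_const huc).inter isOpen_Ioo
  have hSab : S ⊆ Ioo a b := inter_subset_right
  have hSabc : S ⊆ Ioc a b := hSab.trans Ioo_subset_Ioc_self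
  have hSfin : volume S ≠ ⊤ := ((measure_mono hSab).trans_lt measure_Ioo_lt_top).ne
  -- at a zero of `u` the derivative vanishes, as `u ≥ 0`
  have hv0 : ∀ x, u x = 0 → v x = 0 := fun x hx =>
    IsLocalMin.hasDerivAt_eq_zero (Eventually.of_forall fun y => hx ▸ hu0 y) (hu x)
  have hz : ∀ x, x ∉ S → a ≤ x → x ≤ b → u x = 0 := by
    intro x hx h1 h2
    rcases eq_or_lt_of_le h1 with rfl | h1
    · exact hua
    rcases eq_or_lt_of_le h2 with rfl | h2
    · exact hub
    exact le_antisymm (not_lt.1 fun h => hx ⟨h, h1, h2⟩) (hu0 x)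
  have hgi : ∀ p q, IntegrableOn (fun x => v x ^ 2 / 2 - u x) (Ioc p q) := fun p q =>
    (Continuous.integrableOn_Icc (by fun_prop)).mono_set Ioc_subset_Icc_self
  have hSm : ∫ x in S, (v x ^ 2 / 2 - u x) = ∫ x in Ioc a b, (v x ^ 2 / 2 - u x) := by
    refine (setIntegral_eq_of_subset_of_forall_sdiff_eq_zero measurableSet_Ioc hSabc
      fun x hx => ?_).symm
    have := hz x hx.2 hx.1.1.le hx.1.2
    rw [this, hv0 x this]; norm_num
  -- the bump inequality on a component
  have hcomp : ∀ p q, p < q → Ioo p q ⊆ S → p ∉ S → q ∉ S → a ≤ p → q ≤ b →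
      0 < ∫ x in Ioo p q, (v x ^ 2 / 2 - u x) →
      Θ * (∫ x in Ioo p q, (v x ^ 2 / 2 - u x)) ^ (1 / 3 : ℝ)
        ≤ (∫ x in Ioo p q, w x ^ 2) + α * (q - p) := by
    intro p q hpq hsub hp hq hap hqb hpos
    have hsubc : Ioc p q ⊆ Ioc a b := Ioc_subset_Ioc hap hqb
    have hup := hz p hp hap (hpq.le.trans hqb)
    have huq := hz q hq (hap.trans hpq.le) hqb
    rw [← integral_Ioc_eq_integral_Ioo] at hpos ⊢
    rw [← integral_Ioc_eq_integral_Ioo]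
    exact delaminationConstant_mul_rpow_le_of_clamped hα hpq.le hu hvw (hw.mono_set hsubc)
      (hw2.mono_set hsubc) hu0 hup huq (hv0 p hup) (hv0 q huq) hpos
  have hSw : ∀ T, T ⊆ S → ∫ x in T, w x ^ 2 ≤ ∫ x in Ioc a b, w x ^ 2 := fun T hT =>
    setIntegral_mono_set hw2 (Eventually.of_forall fun x => sq_nonneg _)
      (LE.le.eventuallyLE (hT.trans hSabc))
  by_cases hbig : ∃ p q, p < q ∧ Ioo p q ⊆ S ∧ p ∉ S ∧ q ∉ S ∧ a ≤ p ∧ q ≤ b ∧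
      m ≤ ∫ x in Ioo p q, (v x ^ 2 / 2 - u x)
  · obtain ⟨p, q, hpq, hsub, hp, hq, hap, hqb, hmI⟩ := hbig
    have h1 := hcomp p q hpq hsub hp hq hap hqb (hm.trans_le hmI)
    have h2 := Real.rpow_le_rpow hm.le hmI (by norm_num : (0 : ℝ) ≤ 1 / 3)
    have h3 : q - p ≤ (volume S).toReal := by
      have := ENNReal.toReal_mono hSfin (measure_mono hsub)
      rwa [Real.volume_Ioo, ENNReal.toReal_ofReal (by linarith)] at this
    have h4 := hSw _ hsub
    have h5 := mul_le_mul_of_nonneg_left h2 hΘ0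
    have h6 := mul_le_mul_of_nonneg_left h3 hα
    linarith
  push Not at hbig
  -- all bumps are small: compare with the chord of `m ↦ m^{1/3}`, which is linear
  set k := m ^ (1 / 3 : ℝ) / m with hk
  have hk0 : 0 < k := div_pos (Real.rpow_pos_of_pos hm _) hm
  have hkm : k * m = m ^ (1 / 3 : ℝ) := div_mul_cancel₀ _ hm.ne'
  have hchord : ∀ t, 0 < t → t < m → k * t ≤ t ^ (1 / 3 : ℝ) := by
    intro t ht htm
    have e1 : t ^ (1 / 3 : ℝ) = t * t ^ (-(2 / 3) : ℝ) := by
      rw [← Real.rpow_one_add' ht.le (by norm_num)]; norm_num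
    have e2 : m ^ (1 / 3 : ℝ) = m * m ^ (-(2 / 3) : ℝ) := by
      rw [← Real.rpow_one_add' hm.le (by norm_num)]; norm_num
    have e3 : k = m ^ (-(2 / 3) : ℝ) := by rw [hk, e2]; field_simp
    rw [e3, e1, mul_comm]
    exact mul_le_mul_of_nonneg_left
      (Real.rpow_le_rpow_of_nonpos ht htm.le (by norm_num)) ht.le
  set g : ℝ → ℝ := fun x => w x ^ 2 + α - Θ * k * (v x ^ 2 / 2 - u x) with hg
  have hgS : ∀ T, T ⊆ S → IntegrableOn g T ∧
      ∫ x in T, g x = (∫ x in T, w x ^ 2) + α * (volume T).toReal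
        - Θ * k * ∫ x in T, (v x ^ 2 / 2 - u x) := by
    intro T hT
    have i1 : IntegrableOn (fun x => w x ^ 2) T := hw2.mono_set (hT.trans hSabc)
    have i2 : IntegrableOn (fun _ : ℝ => α) T :=
      integrableOn_const ((measure_mono hT).trans_lt hSfin.lt_top).ne
    have i3 : IntegrableOn (fun x => Θ * k * (v x ^ 2 / 2 - u x)) T :=
      ((hgi a b).mono_set (hT.trans hSabc)).const_mul _
    refine ⟨(i1.add i2).sub i3, ?_⟩
    have e : ∫ x in T, g x = ∫ x in T, ((w x ^ 2 + α) - Θ * k * (v x ^ 2 / 2 - u x)) := rfl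
    rw [e, integral_sub (by exact i1.add i2) i3, integral_add i1 i2, integral_const_mul]
    simp [Measure.real, mul_comm α]
  have hgI : ∀ x ∈ S, 0 ≤ ∫ y in connectedComponentIn S x, g y := by
    intro x hx
    obtain ⟨p, q, hpq, hI, hp, hq, hap, hqb⟩ := exists_connectedComponentIn_eq_Ioo hSo hSab hx
    have hsub : Ioo p q ⊆ S := hI ▸ connectedComponentIn_subset S x
    rw [hI, (hgS _ hsub).2, Real.volume_Ioo, ENNReal.toReal_ofReal (by linarith)]
    have h0 : 0 ≤ ∫ x in Ioo p q, w x ^ 2 := integral_nonneg fun x => sq_nonneg _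
    have h0' : 0 ≤ α * (q - p) := mul_nonneg hα (by linarith)
    rcases le_or_gt (∫ x in Ioo p q, (v x ^ 2 / 2 - u x)) 0 with h | h
    · have := mul_nonpos_of_nonneg_of_nonpos (mul_nonneg hΘ0 hk0.le) h
      linarith
    · have h1 := hcomp p q hpq hsub hp hq hap hqb h
      have h2 := hchord _ h (hbig p q hpq hsub hp hq hap hqb)
      have h3 := mul_le_mul_of_nonneg_left h2 hΘ0
      linarith
  have hSU : S = ⋃ I : (connectedComponentIn S '' S : Set (Set ℝ)), (I : Set ℝ) := by
    ext x
    simp only [mem_iUnion, Subtype.exists, exists_prop, mem_image]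
    constructor
    · exact fun hx => ⟨_, ⟨x, hx, rfl⟩, mem_connectedComponentIn hx⟩
    · rintro ⟨_, ⟨y, hy, rfl⟩, hx⟩
      exact connectedComponentIn_subset S y hx
  have hdisj : (connectedComponentIn S '' S : Set (Set ℝ)).PairwiseDisjoint id := by
    rintro _ ⟨x, hx, rfl⟩ _ ⟨y, hy, rfl⟩ hne
    refine disjoint_left.2 fun z hzx hzy => hne ?_
    exact (connectedComponentIn_eq hzx).trans (connectedComponentIn_eq hzy).symm
  have hcount : (connectedComponentIn S '' S : Set (Set ℝ)).Countable := by
    refine hdisj.countable_of_isOpen ?_ ?_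
    · rintro _ ⟨x, hx, rfl⟩
      exact hSo.connectedComponentIn
    · rintro _ ⟨x, hx, rfl⟩
      exact ⟨x, mem_connectedComponentIn hx⟩
  have : Countable (connectedComponentIn S '' S : Set (Set ℝ)) := hcount.to_subtype
  have hnonneg : 0 ≤ ∫ x in S, g x := by
    have hi := (hgS S Subset.rfl).1
    rw [hSU] at hi ⊢
    rw [integral_iUnion (fun I => ?_) (fun I J h => ?_) hi]
    · refine tsum_nonneg fun I => ?_
      obtain ⟨_, x, hx, rfl⟩ := I
      exact hgI x hx
    · obtain ⟨_, x, hx, rfl⟩ := I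
      exact hSo.connectedComponentIn.measurableSet
    · exact hdisj I.2 J.2 (fun h' => h (Subtype.ext h'))
  rw [(hgS S Subset.rfl).2, hSm] at hnonneg
  have h1 := hSw S Subset.rfl
  have h2 := mul_le_mul_of_nonneg_left hmle (mul_nonneg hΘ0 hk0.le)
  rw [mul_assoc, hkm] at h2
  linarith

/-! ### Weak limits of curves -/

lemma memLp_indicator_const_period (s : Set ℝ) (hs : MeasurableSet s) (z : ℂ) :
    MemLp (s.indicator fun _ => z) 2 periodMeasure := by
  have : IsFiniteMeasure periodMeasure := by unfold periodMeasure; infer_instance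
  exact (memLp_const z).indicator hs

lemma WeakL2Tendsto.setIntegral {u : ℕ → ℝ → ℂ} {v : ℝ → ℂ} (h : WeakL2Tendsto u v) {a b : ℝ}
    (ha : 0 ≤ a) (hb : b ≤ 2 * Real.pi) (z : ℂ) :
    Tendsto (fun n => ∫ θ in Ioc a b, inner ℝ (u n θ) z) atTop
      (𝓝 (∫ θ in Ioc a b, inner ℝ (v θ) z)) := by
  have key : ∀ f : ℝ → ℂ, ∫ θ, inner ℝ (f θ) ((Ioc a b).indicator (fun _ => z) θ) ∂periodMeasure
      = ∫ θ in Ioc a b, inner ℝ (f θ) z := by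
    intro f
    have : (fun θ => inner ℝ (f θ) ((Ioc a b).indicator (fun _ => z) θ))
        = (Ioc a b).indicator fun θ => inner ℝ (f θ) z := by
      funext θ
      by_cases hθ : θ ∈ Ioc a b <;> simp [hθ]
    rw [this, periodMeasure, setIntegral_indicator measurableSet_Ioc,
      inter_eq_right.2 (Ioc_subset_Ioc ha hb)]
  have := h _ (memLp_indicator_const_period (Ioc a b) measurableSet_Ioc z)
  simpa only [key] using this

lemma integral_inner_const_period {F : ℝ → ℂ} {a b : ℝ} (hab : a ≤ b)
    (hF : IntervalIntegrable F volume a b) (z : ℂ) :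
    ∫ θ in Ioc a b, inner ℝ (F θ) z = inner ℝ (∫ θ in a..b, F θ) z := by
  rw [intervalIntegral.integral_of_le hab, real_inner_comm]
  have := integral_inner (𝕜 := ℝ) (μ := volume.restrict (Ioc a b)) hF.1 z
  rw [← this]
  simp only [real_inner_comm]

/-- If primitives and their densities converge weakly in `L²` and the primitives are bounded, then
the primitives converge pointwise: the increments converge, and so does the mean value. -/
lemma tendsto_of_weakL2Tendsto {f F : ℕ → ℝ → ℂ} {g G : ℝ → ℂ} {C : ℝ}
    (hf : WeakL2Tendsto f g) (hF : WeakL2Tendsto F G) (hfc : ∀ n, Continuous (f n))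
    (hgc : Continuous g)
    (hFi : ∀ n, IntervalIntegrable (F n) volume 0 (2 * Real.pi))
    (hGi : IntervalIntegrable G volume 0 (2 * Real.pi))
    (hfF : ∀ n a b, f n b - f n a = ∫ θ in a..b, F n θ) (hgG : ∀ a b, g b - g a = ∫ θ in a..b, G θ)
    (hC : ∀ n x, ‖f n x‖ ≤ C) {a : ℝ} (ha : a ∈ Icc 0 (2 * Real.pi)) :
    Tendsto (fun n => f n a) atTop (𝓝 (g a)) := by
  have hpi : (0 : ℝ) < 2 * Real.pi := Real.two_pi_pos
  have hsub : ∀ {x y : ℝ}, x ∈ Icc 0 (2 * Real.pi) → y ∈ Icc 0 (2 * Real.pi) →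
      uIcc x y ⊆ uIcc 0 (2 * Real.pi) := fun hx hy => by
    rw [uIcc_of_le hpi.le]
    exact uIcc_subset_Icc hx hy
  have incr : ∀ (z : ℂ) (b : ℝ), b ∈ Icc 0 (2 * Real.pi) →
      Tendsto (fun n => inner ℝ (f n b - f n a) z) atTop (𝓝 (inner ℝ (g b - g a) z)) := by
    intro z b hb
    rcases le_total a b with h | h
    · have := hF.setIntegral ha.1 hb.2 z
      rw [integral_inner_const_period h (hGi.mono_set (hsub ha hb)), ← hgG] at this
      refine this.congr fun n => ?_
      rw [integral_inner_const_period h ((hFi n).mono_set (hsub ha hb)), ← hfF]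
    · have := (hF.setIntegral hb.1 ha.2 z).neg
      rw [integral_inner_const_period h (hGi.mono_set (hsub hb ha)), ← hgG, ← inner_neg_left,
        neg_sub] at this
      refine this.congr fun n => ?_
      rw [integral_inner_const_period h ((hFi n).mono_set (hsub hb ha)), ← hfF, ← inner_neg_left,
        neg_sub]
  have main : ∀ z : ℂ, Tendsto (fun n => inner ℝ (f n a) z) atTop (𝓝 (inner ℝ (g a) z)) := by
    intro z
    have h1 := hf.setIntegral le_rfl le_rfl z
    have h2 : Tendsto (fun n => ∫ b in Ioc 0 (2 * Real.pi), inner ℝ (f n b - f n a) z) atTop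
        (𝓝 (∫ b in Ioc 0 (2 * Real.pi), inner ℝ (g b - g a) z)) := by
      refine tendsto_integral_of_dominated_convergence (fun _ => (C + C) * ‖z‖) (fun n => ?_)
        (integrable_const _) (fun n => Eventually.of_forall fun b => ?_) ?_
      · have := hfc n
        exact Continuous.aestronglyMeasurable (by fun_prop)
      · refine (norm_inner_le_norm _ _).trans ?_
        gcongr
        exact (norm_sub_le _ _).trans (add_le_add (hC n b) (hC n a))
      · filter_upwards [ae_restrict_mem measurableSet_Ioc] with b hb
        exact incr z b (Ioc_subset_Icc_self hb)
    have e : ∀ h : ℝ → ℂ, Continuous h → inner ℝ (h a) z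
        = ((∫ b in Ioc 0 (2 * Real.pi), inner ℝ (h b) z)
          - ∫ b in Ioc 0 (2 * Real.pi), inner ℝ (h b - h a) z) / (2 * Real.pi) := by
      intro h hh
      have i1 : IntegrableOn (fun b => inner ℝ (h b) z) (Ioc 0 (2 * Real.pi)) :=
        (Continuous.integrableOn_Icc (by fun_prop)).mono_set Ioc_subset_Icc_self
      have i2 : IntegrableOn (fun b => inner ℝ (h b - h a) z) (Ioc 0 (2 * Real.pi)) :=
        (Continuous.integrableOn_Icc (by fun_prop)).mono_set Ioc_subset_Icc_self
      rw [← integral_sub i1 i2]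
      simp only [← inner_sub_left, sub_sub_cancel]
      simp [hpi.le]
    rw [e g hgc]
    refine ((h1.sub h2).div_const _).congr fun n => (e (f n) (hfc n)).symm
  have r1 := main 1
  have r2 := main Complex.I
  have hre : Tendsto (fun n => (f n a).re) atTop (𝓝 (g a).re) := by
    simpa [Complex.inner] using r1
  have him : Tendsto (fun n => (f n a).im) atTop (𝓝 (g a).im) := by
    simpa [Complex.inner] using r2
  have := (Complex.continuous_ofReal.tendsto _).comp hre |>.add
    (((Complex.continuous_ofReal.tendsto _).comp him).mul_const Complex.I)
  simpa [Complex.re_add_im] using this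

/-- Closed `W^{2,2}` curves of constant speed `c` in the closed unit disc. -/
structure IsConfinedCurve (c : ℝ) (γ : ℝ → ℂ) : Prop where
  w22 : IsW22 γ
  norm_le : ∀ θ, ‖γ θ‖ ≤ 1
  speed : ∀ θ, ‖deriv γ θ‖ = c

lemma periodic_deriv {E : Type*} [NormedAddCommGroup E] [NormedSpace ℝ E] {γ : ℝ → E} {T : ℝ}
    (h : Function.Periodic γ T) : Function.Periodic (deriv γ) T := fun x => by
  rw [← deriv_comp_add_const, show (fun x => γ (x + T)) = γ from funext h]

lemma memLp_integrableOn {w : ℝ → ℂ} (h : MemLp w 2 periodMeasure) :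
    IntegrableOn w (Ioc 0 (2 * Real.pi)) := by
  have : IsFiniteMeasure periodMeasure := by unfold periodMeasure; infer_instance
  exact h.integrable (by norm_num)

lemma IsW22.intervalIntegrable {γ : ℝ → ℂ} (h : IsW22 γ) (a b : ℝ) :
    IntervalIntegrable (deriv (deriv γ)) volume a b := by
  have h1 : IntervalIntegrable (deriv (deriv γ)) volume 0 (0 + 2 * Real.pi) := by
    rw [zero_add, intervalIntegrable_iff_integrableOn_Ioc_of_le Real.two_pi_pos.le]
    exact memLp_integrableOn h.2.2.1
  exact (periodic_deriv (periodic_deriv h.1)).intervalIntegrable Real.two_pi_pos.ne' h1 a b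

lemma continuous_deriv_deriv {γ : ℝ → ℂ} (h : ContDiff ℝ ∞ γ) : Continuous (deriv (deriv γ)) := by
  have h1 : ContDiff ℝ ∞ (deriv γ) := by
    have : ContDiff ℝ (∞ + 1) γ := h
    exact (contDiff_succ_iff_deriv.1 this).2.2
  exact h1.continuous_deriv (by simp)

lemma IsConfinedCurve.of_mem_closure {L : ℝ} {γ : ℝ → ℂ} (h : γ ∈ curveClassClosure L) :
    IsConfinedCurve (L / (2 * Real.pi)) γ := by
  obtain ⟨hw, u, hu, hu0, hu1, hu2⟩ := h
  have hsm : ∀ n, ContDiff ℝ ∞ (u n) := fun n => (hu n).2.1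
  have hd : ∀ n, Continuous (deriv (u n)) := fun n => (hsm n).continuous_deriv (by simp)
  have hdd : ∀ n, Continuous (deriv (deriv (u n))) := fun n => continuous_deriv_deriv (hsm n)
  have hγ1 : ContDiff ℝ 1 γ := hw.2.1
  have hγd : Continuous (deriv γ) := hγ1.continuous_deriv le_rfl
  have hddf : ∀ n, Differentiable ℝ (deriv (u n)) := fun n =>
    (contDiff_succ_iff_deriv.1 (show ContDiff ℝ (∞ + 1) (u n) from hsm n)).2.2.differentiable
      (by simp)
  have per : ∀ {f : ℝ → ℂ} {P : ℂ → Prop}, Function.Periodic f (2 * Real.pi) →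
      (∀ a ∈ Icc 0 (2 * Real.pi), P (f a)) → ∀ a, P (f a) := by
    intro f P hf hP a
    obtain ⟨y, hy, hay⟩ := hf.exists_mem_Ico₀ Real.two_pi_pos a
    rw [hay]
    exact hP y (Ico_subset_Icc_self hy)
  refine ⟨hw, per (P := fun z => ‖z‖ ≤ 1) hw.1 fun a ha => ?_,
    per (P := fun z => ‖z‖ = _) (periodic_deriv hw.1) fun a ha => ?_⟩
  · have := tendsto_of_weakL2Tendsto (C := 1) hu0 hu1 (fun n => (hsm n).continuous) hγ1.continuous
      (fun n => (hd n).intervalIntegrable _ _) (hγd.intervalIntegrable _ _)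
      (fun n a b => (intervalIntegral.integral_deriv_eq_sub
        (fun x _ => (hsm n).differentiable (by simp) x) ((hd n).intervalIntegrable _ _)).symm)
      (fun a b => (intervalIntegral.integral_deriv_eq_sub
        (fun x _ => hγ1.differentiable (by simp) x) (hγd.intervalIntegrable _ _)).symm)
      (fun n x => (mem_ball_zero_iff.1 ((hu n).2.2.1 x)).le) ha
    exact le_of_tendsto' this.norm fun n => (mem_ball_zero_iff.1 ((hu n).2.2.1 a)).le
  · have := tendsto_of_weakL2Tendsto (C := L / (2 * Real.pi)) hu1 hu2 hd hγd
      (fun n => (hdd n).intervalIntegrable _ _) (hw.intervalIntegrable _ _)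
      (fun n a b => (intervalIntegral.integral_deriv_eq_sub
        (fun x _ => hddf n x) ((hdd n).intervalIntegrable _ _)).symm)
      hw.2.2.2 (fun n x => ((hu n).2.2.2.1 x).le) ha
    refine tendsto_nhds_unique this.norm ?_
    simp only [(hu _).2.2.2.1]
    exact tendsto_const_nhds

/-! ### The length of the unit circle -/

lemma lipschitzWith_exp_mul_I : LipschitzWith 1 fun t : ℝ => Complex.exp (t * Complex.I) := by
  refine lipschitzWith_of_nnnorm_deriv_le (𝕜 := ℝ) (by fun_prop) fun t => ?_
  have h : HasDerivAt (fun t : ℝ => Complex.exp (t * Complex.I))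
      (Complex.exp (t * Complex.I) * (1 * Complex.I)) t :=
    ((Complex.ofRealCLM.hasDerivAt).mul_const Complex.I).cexp
  rw [h.deriv, ← NNReal.coe_le_coe]
  simp

lemma hausdorffMeasure_sphere_le :
    μH[1] (Metric.sphere (0 : ℂ) 1) ≤ ENNReal.ofReal (2 * Real.pi) := by
  have hsub : Metric.sphere (0 : ℂ) 1
      ⊆ (fun t : ℝ => Complex.exp (t * Complex.I)) '' Ioc (-Real.pi) Real.pi := by
    intro z hz
    refine ⟨z.arg, Complex.arg_mem_Ioc z, ?_⟩
    have := Complex.norm_mul_exp_arg_mul_I z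
    rw [mem_sphere_zero_iff_norm.1 hz] at this
    simpa using this
  refine (measure_mono hsub).trans ((lipschitzWith_exp_mul_I.hausdorffMeasure_image_le
    zero_le_one _).trans ?_)
  rw [hausdorffMeasure_real, Real.volume_Ioc]
  simp [two_mul]

/-- An arc is at least as long as its chord. -/
lemma two_sin_le_hausdorffMeasure_arc {p h : ℝ} (hh : 0 < h) (hh2 : h ≤ Real.pi / 2)
    (h1 : -Real.pi ≤ p) (h2 : p + 2 * h ≤ Real.pi) :
    ENNReal.ofReal (2 * Real.sin h)
      ≤ μH[1] (Metric.sphere (0 : ℂ) 1 ∩ Complex.arg ⁻¹' Ioc p (p + 2 * h)) := by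
  set f : ℂ → ℝ := fun z => (z * Complex.exp (-((p + h : ℝ) : ℂ) * Complex.I)).im with hf
  have hfl : LipschitzWith 1 f := by
    refine LipschitzWith.of_dist_le_mul fun z w => ?_
    rw [NNReal.coe_one, one_mul, Real.dist_eq, hf]
    simp only
    rw [← Complex.sub_im, ← sub_mul]
    refine (Complex.abs_im_le_norm _).trans ?_
    have : ‖Complex.exp (-((p + h : ℝ) : ℂ) * Complex.I)‖ = 1 := by
      rw [← Complex.ofReal_neg]; exact Complex.norm_exp_ofReal_mul_I _
    rw [norm_mul, this, mul_one, Complex.dist_eq]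
  have hsub : Ioo (-Real.sin h) (Real.sin h)
      ⊆ f '' (Metric.sphere (0 : ℂ) 1 ∩ Complex.arg ⁻¹' Ioc p (p + 2 * h)) := by
    intro y hy
    have hsin1 := Real.sin_le_one h
    have ey : Real.sin (Real.arcsin y) = y :=
      Real.sin_arcsin (by linarith [hy.1]) (by linarith [hy.2])
    have l1 : -h < Real.arcsin y := by
      rw [Real.lt_arcsin_iff_sin_lt' ⟨by linarith, by linarith⟩, Real.sin_neg]
      exact hy.1
    have l2 : Real.arcsin y < h := by
      rw [Real.arcsin_lt_iff_lt_sin' ⟨by linarith, hh2⟩]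
      exact hy.2
    set t := p + h + Real.arcsin y with ht
    have harg : Complex.arg (Complex.exp (t * Complex.I)) = t := by
      rw [Complex.exp_mul_I]
      exact Complex.arg_cos_add_sin_mul_I ⟨by linarith, by linarith⟩
    refine ⟨Complex.exp (t * Complex.I), ⟨?_, ?_⟩, ?_⟩
    · simp [Complex.norm_exp_ofReal_mul_I]
    · rw [mem_preimage, harg]
      exact ⟨by linarith, by linarith⟩
    · simp only [hf]
      rw [← Complex.exp_add, ← add_mul, ← Complex.ofReal_neg, ← Complex.ofReal_add,
        Complex.exp_ofReal_mul_I_im, ht]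
      rw [show p + h + Real.arcsin y + -(p + h) = Real.arcsin y by ring, ey]
  calc ENNReal.ofReal (2 * Real.sin h) = volume (Ioo (-Real.sin h) (Real.sin h)) := by
        rw [Real.volume_Ioo]; congr 1; ring
    _ = μH[1] (Ioo (-Real.sin h) (Real.sin h)) := by rw [hausdorffMeasure_real]
    _ ≤ _ := measure_mono hsub
    _ ≤ _ := by simpa using hfl.hausdorffMeasure_image_le zero_le_one _

/-- The length of the unit circle is at least `2π`, by inscribed polygons. -/
lemma le_hausdorffMeasure_sphere :
    ENNReal.ofReal (2 * Real.pi) ≤ μH[1] (Metric.sphere (0 : ℂ) 1) := by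
  have key : ∀ n : ℕ, ENNReal.ofReal (((n + 4 : ℕ) : ℝ) *
      (2 * Real.sin (Real.pi / ((n + 4 : ℕ) : ℝ)))) ≤ μH[1] (Metric.sphere (0 : ℂ) 1) := by
    intro n
    set N : ℕ := n + 4 with hN
    have hN4 : (4 : ℝ) ≤ N := by simp [hN]
    set h := Real.pi / (N : ℝ) with hh
    have hNh : (N : ℝ) * h = Real.pi := by rw [hh]; field_simp
    have hh0 : 0 < h := by positivity
    have hh2 : h ≤ Real.pi / 2 := by
      rw [hh]; exact div_le_div_of_nonneg_left Real.pi_pos.le two_pos (by linarith)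
    let A : ℕ → Set ℂ := fun k => Metric.sphere (0 : ℂ) 1 ∩
      Complex.arg ⁻¹' Ioc (-Real.pi + k * (2 * h)) (-Real.pi + k * (2 * h) + 2 * h)
    have hA : ∀ k ∈ Finset.range N, ENNReal.ofReal (2 * Real.sin h) ≤ μH[1] (A k) := by
      intro k hk
      have hkN : (k : ℝ) + 1 ≤ N := by exact_mod_cast Finset.mem_range.1 hk
      have hk0 : (0 : ℝ) ≤ k := Nat.cast_nonneg k
      exact two_sin_le_hausdorffMeasure_arc hh0 hh2
        (by nlinarith) (by nlinarith [mul_le_mul_of_nonneg_right hkN hh0.le])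
    have hm : ∀ k, MeasurableSet (A k) := fun k =>
      Metric.isClosed_sphere.measurableSet.inter (Complex.measurable_arg measurableSet_Ioc)
    have hdlt : ∀ i j : ℕ, i < j → Disjoint (A i) (A j) := fun i j hij => by
      refine disjoint_left.2 fun z hz hz' => ?_
      have hij' : (i : ℝ) + 1 ≤ j := by exact_mod_cast hij
      have h1 := hz.2.2
      have h2 := hz'.2.1
      have := mul_le_mul_of_nonneg_right hij' hh0.le
      linarith
    have hd : (Finset.range N : Set ℕ).PairwiseDisjoint A := by
      intro i _ j _ hij
      rcases lt_or_gt_of_ne hij with h | h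
      · exact hdlt i j h
      · exact (hdlt j i h).symm
    have hs0 : 0 ≤ 2 * Real.sin h :=
      mul_nonneg two_pos.le (Real.sin_nonneg_of_nonneg_of_le_pi hh0.le (by linarith [Real.pi_pos]))
    calc ENNReal.ofReal ((N : ℝ) * (2 * Real.sin h))
        = ∑ k ∈ Finset.range N, ENNReal.ofReal (2 * Real.sin h) := by
          rw [Finset.sum_const, Finset.card_range, nsmul_eq_mul, ENNReal.ofReal_mul (by positivity),
            ENNReal.ofReal_natCast]
      _ ≤ ∑ k ∈ Finset.range N, μH[1] (A k) := Finset.sum_le_sum hA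
      _ = μH[1] (⋃ k ∈ Finset.range N, A k) := (measure_biUnion_finset hd fun k _ => hm k).symm
      _ ≤ _ := measure_mono (iUnion₂_subset fun k _ => inter_subset_left)
  have hx : Tendsto (fun n : ℕ => Real.pi / ((n + 4 : ℕ) : ℝ)) atTop (𝓝[≠] 0) := by
    refine tendsto_nhdsWithin_iff.2 ⟨?_, Eventually.of_forall fun n => by
      have : (0 : ℝ) < ((n + 4 : ℕ) : ℝ) := by positivity
      exact (div_pos Real.pi_pos this).ne'⟩
    exact (tendsto_const_div_atTop_nhds_zero_nat Real.pi).comp (tendsto_add_atTop_nat 4)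
  have hslope := (hasDerivAt_iff_tendsto_slope.1 (Real.hasDerivAt_sin 0)).comp hx
  have hlim : Tendsto (fun n : ℕ => ((n + 4 : ℕ) : ℝ) *
      (2 * Real.sin (Real.pi / ((n + 4 : ℕ) : ℝ)))) atTop (𝓝 (2 * Real.pi)) := by
    have := hslope.const_mul (2 * Real.pi)
    rw [Real.cos_zero, mul_one] at this
    refine this.congr fun n => ?_
    have : (0 : ℝ) < ((n + 4 : ℕ) : ℝ) := by positivity
    have hpi := Real.pi_pos
    simp only [Function.comp, slope, vsub_eq_sub, smul_eq_mul, Real.sin_zero, sub_zero]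
    field_simp
  exact le_of_tendsto' ((ENNReal.continuous_ofReal.tendsto _).comp hlim) key

lemma hausdorffMeasure_sphere : μH[1] (Metric.sphere (0 : ℂ) 1) = ENNReal.ofReal (2 * Real.pi) :=
  le_antisymm hausdorffMeasure_sphere_le le_hausdorffMeasure_sphere

/-! ### The radial defect of a confined curve -/

/-- Product rule for primitives of integrable functions. -/
lemma primitive_mul {F f G g : ℝ → ℝ} (hf : ∀ a b, IntervalIntegrable f volume a b)
    (hg : ∀ a b, IntervalIntegrable g volume a b) (hF : ∀ a b, F b - F a = ∫ x in a..b, f x)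
    (hG : ∀ a b, G b - G a = ∫ x in a..b, g x) (a b : ℝ) :
    F b * G b - F a * G a = ∫ x in a..b, (f x * G x + F x * g x) := by
  have eF : F = fun x => F a + ∫ t in a..x, f t := funext fun x => by rw [← hF]; ring
  have eG : G = fun x => G a + ∫ t in a..x, g t := funext fun x => by rw [← hG]; ring
  have ac : ∀ {h : ℝ → ℝ} (k : ℝ), (∀ a b, IntervalIntegrable h volume a b) →
      AbsolutelyContinuousOnInterval (fun x => k + ∫ t in a..x, h t) a b := fun {h} k hh =>
    (LipschitzOnWith.absolutelyContinuousOnInterval (K := 0)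
      ((LipschitzWith.const k).lipschitzOnWith)).add
      ((hh a b).absolutelyContinuousOnInterval_intervalIntegral left_mem_uIcc)
  have aF : AbsolutelyContinuousOnInterval F a b := by rw [eF]; exact ac _ hf
  have aG : AbsolutelyContinuousOnInterval G a b := by rw [eG]; exact ac _ hg
  rw [← aF.integral_deriv_mul_eq_sub aG]
  refine intervalIntegral.integral_congr_ae ?_
  filter_upwards [(hf a b).ae_hasDerivAt_integral, (hg a b).ae_hasDerivAt_integral]
    with x h1 h2 hx
  have hx' := uIoc_subset_uIcc hx
  have d1 : deriv F x = f x := by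
    rw [eF]; exact ((h1 hx' a left_mem_uIcc).const_add _).deriv
  have d2 : deriv G x = g x := by
    rw [eG]; exact ((h2 hx' a left_mem_uIcc).const_add _).deriv
  rw [d1, d2]

/-- `u = (1 - |γ|²) / 2`, which vanishes exactly where the curve touches the unit circle. -/
def defect (γ : ℝ → ℂ) (θ : ℝ) : ℝ := (1 - ‖γ θ‖ ^ 2) / 2

/-- `u' = -⟨γ, γ'⟩`. -/
def defectSlope (γ : ℝ → ℂ) (θ : ℝ) : ℝ := -inner ℝ (γ θ) (deriv γ θ)

/-- `u'' = -(c² + ⟨γ, γ''⟩)` for a curve of constant speed `c`. -/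
def defectCurvature (c : ℝ) (γ : ℝ → ℂ) (θ : ℝ) : ℝ :=
  -(c ^ 2 + inner ℝ (γ θ) (deriv (deriv γ) θ))

namespace IsConfinedCurve

variable {c : ℝ} {γ : ℝ → ℂ} (h : IsConfinedCurve c γ)
include h

lemma contDiff : ContDiff ℝ 1 γ := h.w22.2.1

lemma periodic : Function.Periodic γ (2 * Real.pi) := h.w22.1

lemma continuous : Continuous γ := h.contDiff.continuous

lemma continuous_deriv : Continuous (deriv γ) := h.contDiff.continuous_deriv le_rfl

lemma hasDerivAt (θ : ℝ) : HasDerivAt γ (deriv γ θ) θ :=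
  (h.contDiff.differentiable (by simp) θ).hasDerivAt

lemma defect_nonneg (θ : ℝ) : 0 ≤ defect γ θ := by
  have := h.norm_le θ
  have := norm_nonneg (γ θ)
  unfold defect
  nlinarith

lemma hasDerivAt_defect (θ : ℝ) : HasDerivAt (defect γ) (defectSlope γ θ) θ := by
  have := ((h.hasDerivAt θ).norm_sq.const_sub 1).div_const 2
  refine this.congr_deriv ?_
  unfold defectSlope
  ring

lemma continuous_defect : Continuous (defect γ) := by
  have := h.continuous
  unfold defect
  fun_prop

lemma continuous_defectSlope : Continuous (defectSlope γ) := by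
  have := h.continuous
  have := h.continuous_deriv
  unfold defectSlope
  fun_prop

lemma intervalIntegrable_inner (a b : ℝ) :
    IntervalIntegrable (fun θ => inner ℝ (γ θ) (deriv (deriv γ) θ)) volume a b := by
  have hi := h.w22.intervalIntegrable a b
  have hre : IntervalIntegrable (fun θ => (deriv (deriv γ) θ).re) volume a b :=
    ⟨hi.1.re, hi.2.re⟩
  have him : IntervalIntegrable (fun θ => (deriv (deriv γ) θ).im) volume a b :=
    ⟨hi.1.im, hi.2.im⟩
  have hc := h.continuous
  have c1 : ContinuousOn (fun θ => (γ θ).re) (uIcc a b) :=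
    (Complex.continuous_re.comp hc).continuousOn
  have c2 : ContinuousOn (fun θ => (γ θ).im) (uIcc a b) :=
    (Complex.continuous_im.comp hc).continuousOn
  have := (hre.continuousOn_mul c1).add (him.continuousOn_mul c2)
  refine this.congr fun θ _ => ?_
  simp [Complex.inner]
  ring

lemma intervalIntegrable_defectCurvature (a b : ℝ) :
    IntervalIntegrable (defectCurvature c γ) volume a b :=
  (intervalIntegrable_const.add (h.intervalIntegrable_inner a b)).neg

lemma defectSlope_sub (a b : ℝ) :
    defectSlope γ b - defectSlope γ a = ∫ θ in a..b, defectCurvature c γ θ := by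
  have hd : ∀ θ, HasDerivAt γ (deriv γ θ) θ := h.hasDerivAt
  have hi := h.w22.intervalIntegrable
  have cre : Continuous fun θ => (deriv γ θ).re := Complex.continuous_re.comp h.continuous_deriv
  have cim : Continuous fun θ => (deriv γ θ).im := Complex.continuous_im.comp h.continuous_deriv
  have p1 := primitive_mul (F := fun θ => (γ θ).re) (f := fun θ => (deriv γ θ).re)
    (G := fun θ => (deriv γ θ).re) (g := fun θ => (deriv (deriv γ) θ).re)
    (fun a b => cre.intervalIntegrable _ _) (fun a b => ⟨(hi a b).1.re, (hi a b).2.re⟩)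
    (fun a b => (intervalIntegral.integral_eq_sub_of_hasDerivAt
      (fun x _ => Complex.reCLM.hasFDerivAt.comp_hasDerivAt x (hd x))
      (cre.intervalIntegrable _ _)).symm)
    (fun a b => by
      rw [← Complex.sub_re, h.w22.2.2.2 a b]
      exact (Complex.reCLM.intervalIntegral_comp_comm (hi a b)).symm) a b
  have p2 := primitive_mul (F := fun θ => (γ θ).im) (f := fun θ => (deriv γ θ).im)
    (G := fun θ => (deriv γ θ).im) (g := fun θ => (deriv (deriv γ) θ).im)
    (fun a b => cim.intervalIntegrable _ _) (fun a b => ⟨(hi a b).1.im, (hi a b).2.im⟩)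
    (fun a b => (intervalIntegral.integral_eq_sub_of_hasDerivAt
      (fun x _ => Complex.imCLM.hasFDerivAt.comp_hasDerivAt x (hd x))
      (cim.intervalIntegrable _ _)).symm)
    (fun a b => by
      rw [← Complex.sub_im, h.w22.2.2.2 a b]
      exact (Complex.imCLM.intervalIntegral_comp_comm (hi a b)).symm) a b
  have i1 : IntervalIntegrable (fun θ => (deriv γ θ).re * (deriv γ θ).re
      + (γ θ).re * (deriv (deriv γ) θ).re) volume a b :=
    ((cre.mul cre).intervalIntegrable _ _).add
      (IntervalIntegrable.continuousOn_mul ⟨(hi a b).1.re, (hi a b).2.re⟩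
        (Complex.continuous_re.comp h.continuous).continuousOn)
  have i2 : IntervalIntegrable (fun θ => (deriv γ θ).im * (deriv γ θ).im
      + (γ θ).im * (deriv (deriv γ) θ).im) volume a b :=
    ((cim.mul cim).intervalIntegrable _ _).add
      (IntervalIntegrable.continuousOn_mul ⟨(hi a b).1.im, (hi a b).2.im⟩
        (Complex.continuous_im.comp h.continuous).continuousOn)
  have e : ∀ θ, defectCurvature c γ θ
      = -(((deriv γ θ).re * (deriv γ θ).re + (γ θ).re * (deriv (deriv γ) θ).re)
        + ((deriv γ θ).im * (deriv γ θ).im + (γ θ).im * (deriv (deriv γ) θ).im)) := by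
    intro θ
    have : c ^ 2 = (deriv γ θ).re * (deriv γ θ).re + (deriv γ θ).im * (deriv γ θ).im := by
      rw [← h.speed θ, ← Complex.normSq_eq_norm_sq, Complex.normSq_apply]
    unfold defectCurvature
    simp only [Complex.inner, Complex.mul_re, Complex.conj_re, Complex.conj_im]
    rw [this]
    ring
  simp only [e]
  rw [intervalIntegral.integral_neg, intervalIntegral.integral_add i1 i2, ← p1, ← p2]
  unfold defectSlope
  simp only [Complex.inner, Complex.mul_re, Complex.conj_re, Complex.conj_im]
  ring

lemma periodic_defect : Function.Periodic (defect γ) (2 * Real.pi) := fun θ => by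
  simp only [defect, h.periodic θ]

lemma periodic_defectSlope : Function.Periodic (defectSlope γ) (2 * Real.pi) := fun θ => by
  simp only [defectSlope, h.periodic θ, periodic_deriv h.periodic θ]

lemma periodic_defectCurvature : Function.Periodic (defectCurvature c γ) (2 * Real.pi) :=
  fun θ => by
    simp only [defectCurvature, h.periodic θ, periodic_deriv (periodic_deriv h.periodic) θ]

lemma memLp_defectCurvature : MemLp (defectCurvature c γ) 2 periodMeasure := by
  have : IsFiniteMeasure periodMeasure := by unfold periodMeasure; infer_instance
  have h2 : MemLp (fun θ => (inner ℝ (γ θ) (deriv (deriv γ) θ) : ℝ)) 2 periodMeasure := by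
    refine MemLp.of_le h.w22.2.2.1 ?_ (Eventually.of_forall fun θ => ?_)
    · exact h.continuous.aestronglyMeasurable.inner h.w22.2.2.1.1
    · refine (norm_inner_le_norm _ _).trans ?_
      exact mul_le_of_le_one_left (norm_nonneg _) (h.norm_le θ)
  have h3 : MemLp (fun _ : ℝ => c ^ 2) 2 periodMeasure := memLp_const _
  exact (h3.add h2).neg

lemma intervalIntegrable_sq_defectCurvature (a b : ℝ) :
    IntervalIntegrable (fun θ => defectCurvature c γ θ ^ 2) volume a b := by
  have h1 : IntervalIntegrable (fun θ => defectCurvature c γ θ ^ 2) volume 0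
      (0 + 2 * Real.pi) := by
    rw [zero_add, intervalIntegrable_iff_integrableOn_Ioc_of_le Real.two_pi_pos.le]
    exact h.memLp_defectCurvature.integrable_sq
  refine Function.Periodic.intervalIntegrable (fun θ => ?_) Real.two_pi_pos.ne' h1 a b
  rw [h.periodic_defectCurvature θ]

/-- The acceleration of a curve of constant speed is orthogonal to its velocity. -/
lemma inner_deriv_deriv (θ : ℝ) : inner ℝ (deriv (deriv γ) θ) (deriv γ θ) = (0 : ℝ) := by
  by_cases hd : DifferentiableAt ℝ (deriv γ) θ
  · have h1 := hd.hasDerivAt.norm_sq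
    have h2 : HasDerivAt (fun θ => ‖deriv γ θ‖ ^ 2) 0 θ := by
      simp only [h.speed]
      exact hasDerivAt_const _ _
    have h3 := h1.unique h2
    rw [real_inner_comm]
    simpa using h3
  · simp [deriv_zero_of_not_differentiableAt hd]

lemma elasticEnergy_eq : elasticEnergy γ
    = c⁻¹ ^ 3 * ∫ θ in Ioc 0 (2 * Real.pi), ‖deriv (deriv γ) θ‖ ^ 2 := by
  unfold elasticEnergy periodMeasure
  rw [← integral_const_mul]
  congr 1
  funext θ
  rw [h.inner_deriv_deriv, h.speed, div_eq_mul_inv, inv_pow]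
  ring

/-- Since `|κ| ≥ |⟨γ, γ''⟩| / c²` in the unit disc, the energy is bounded below by that of the
circle of the same length, plus the exact quadratic remainder `∫ |u''|²`. -/
lemma le_elasticEnergy (hc : 0 < c) :
    2 * Real.pi * c + c⁻¹ ^ 3 * ∫ θ in Ioc 0 (2 * Real.pi), defectCurvature c γ θ ^ 2
      ≤ elasticEnergy γ := by
  have : IsFiniteMeasure periodMeasure := by unfold periodMeasure; infer_instance
  set w := defectCurvature c γ with hw
  have iw : IntegrableOn w (Ioc 0 (2 * Real.pi)) :=
    (h.intervalIntegrable_defectCurvature 0 (2 * Real.pi)).1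
  have iw2 : IntegrableOn (fun θ => w θ ^ 2) (Ioc 0 (2 * Real.pi)) :=
    (h.intervalIntegrable_sq_defectCurvature 0 (2 * Real.pi)).1
  have hw0 : ∫ θ in Ioc 0 (2 * Real.pi), w θ = 0 := by
    rw [← intervalIntegral.integral_of_le Real.two_pi_pos.le, ← h.defectSlope_sub]
    have := h.periodic_defectSlope 0
    rw [zero_add] at this
    rw [this, sub_self]
  have e1 : ∫ θ in Ioc 0 (2 * Real.pi), (c ^ 2 + w θ) ^ 2
      = 2 * Real.pi * c ^ 4 + ∫ θ in Ioc 0 (2 * Real.pi), w θ ^ 2 := by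
    have : (fun θ => (c ^ 2 + w θ) ^ 2) = fun θ => c ^ 4 + (2 * c ^ 2 * w θ + w θ ^ 2) := by
      funext θ; ring
    rw [this, integral_add (integrable_const _) (by exact (iw.const_mul _).add iw2),
      integral_add (iw.const_mul _) iw2, integral_const_mul, hw0]
    simp [Real.pi_pos.le]
  have e2 : ∫ θ in Ioc 0 (2 * Real.pi), (c ^ 2 + w θ) ^ 2
      ≤ ∫ θ in Ioc 0 (2 * Real.pi), ‖deriv (deriv γ) θ‖ ^ 2 := by
    refine integral_mono_of_nonneg (Eventually.of_forall fun θ => sq_nonneg _)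
      (h.w22.2.2.1.norm.integrable_sq) (Eventually.of_forall fun θ => ?_)
    have e3 : c ^ 2 + w θ = -inner ℝ (γ θ) (deriv (deriv γ) θ) := by
      rw [hw]; unfold defectCurvature; ring
    have e4 := abs_real_inner_le_norm (γ θ) (deriv (deriv γ) θ)
    have e5 : |(inner ℝ (γ θ) (deriv (deriv γ) θ) : ℝ)| ≤ ‖deriv (deriv γ) θ‖ := by
      exact e4.trans (mul_le_of_le_one_left (norm_nonneg _) (h.norm_le θ))
    dsimp only
    rw [e3, neg_sq]
    exact sq_le_sq' (abs_le.1 e5).1 (abs_le.1 e5).2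
  rw [h.elasticEnergy_eq]
  rw [e1] at e2
  have := mul_le_mul_of_nonneg_left e2 (by positivity : (0 : ℝ) ≤ c⁻¹ ^ 3)
  refine le_trans (le_of_eq ?_) this
  rw [mul_add]
  congr 1
  field_simp

end IsConfinedCurve

/-! ### Winding around the origin -/

/-- The winding number of a closed curve around the origin is an integer. -/
lemma exists_integral_logDeriv_eq {γ : ℝ → ℂ} (hγ : ContDiff ℝ 1 γ)
    (hper : Function.Periodic γ (2 * Real.pi)) (h0 : ∀ θ, γ θ ≠ 0) :
    ∃ k : ℤ, ∫ θ in (0 : ℝ)..2 * Real.pi, deriv γ θ / γ θ = k * (2 * Real.pi * Complex.I) := by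
  have hq : Continuous fun θ => deriv γ θ / γ θ :=
    (hγ.continuous_deriv le_rfl).div hγ.continuous h0
  set Q : ℝ → ℂ := fun x => ∫ θ in (0 : ℝ)..x, deriv γ θ / γ θ with hQ
  have hQd : ∀ x, HasDerivAt Q (deriv γ x / γ x) x := fun x =>
    intervalIntegral.integral_hasDerivAt_right (hq.intervalIntegrable _ _)
      (hq.stronglyMeasurableAtFilter _ _) hq.continuousAt
  have hd : ∀ x, HasDerivAt (fun x => γ x * Complex.exp (-Q x)) 0 x := fun x => by
    have h1 := ((hγ.differentiable (by simp) x).hasDerivAt).mul (hQd x).neg.cexp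
    refine h1.congr_deriv ?_
    have := h0 x
    field_simp
    ring
  have hconst := is_const_of_deriv_eq_zero (fun x => (hd x).differentiableAt)
    (fun x => (hd x).deriv) (2 * Real.pi) 0
  have hγe : γ (2 * Real.pi) = γ 0 := by simpa using hper 0
  have hQ0 : Q 0 = 0 := by simp [hQ]
  rw [hγe, hQ0, neg_zero, Complex.exp_zero] at hconst
  have h1 : Complex.exp (-Q (2 * Real.pi)) = 1 := mul_left_cancel₀ (h0 0) hconst
  rw [Complex.exp_neg, inv_eq_one, Complex.exp_eq_one_iff] at h1
  exact h1

lemma norm_sq_eq_sub_defect (γ : ℝ → ℂ) (θ : ℝ) : ‖γ θ‖ ^ 2 = 1 - 2 * defect γ θ := by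
  unfold defect; ring

/-- Elementary lower bound for the angular speed `r` of a curve of speed `c` with radial defect `u`
and radial slope `v`, so that `r² ρ² = c² ρ - v²` for `ρ = 1 - 2 u`. -/
lemma le_abs_angularSpeed {c u v ε r : ℝ} (hε : 0 < ε) (hε1 : ε ≤ 1) (hc : 1 ≤ c) (hu : 0 ≤ u)
    (hu1 : u ≤ ε / 16) (hv : |v| ≤ ε / 16)
    (hr : r ^ 2 * (1 - 2 * u) ^ 2 = c ^ 2 * (1 - 2 * u) - v ^ 2) :
    c * (1 + u) - (1 + ε) * (v ^ 2 / 2) ≤ |r| := by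
  set A := c * (1 + u) - (1 + ε) * (v ^ 2 / 2) with hA
  have hs0 : 0 ≤ v ^ 2 := sq_nonneg v
  have hs : v ^ 2 ≤ ε / 256 := by
    have : v ^ 2 ≤ (ε / 16) ^ 2 := sq_le_sq' (abs_le.1 hv).1 (abs_le.1 hv).2
    nlinarith
  set s := v ^ 2 with hsdef
  set ρ := 1 - 2 * u with hρ
  have hρ0 : 1 - ε / 8 ≤ ρ := by rw [hρ]; linarith
  have hρpos : 0 < ρ := by linarith
  have hρ2 : 1 - ε / 4 ≤ ρ ^ 2 := by nlinarith
  have h1 : ρ * (1 + u) ^ 2 ≤ 1 := by rw [hρ]; nlinarith [mul_nonneg hu (sq_nonneg u), sq_nonneg u]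
  have h2 : (1 + ε) * (1 - ε / 256) ≤ c * (1 + u) * (1 + ε) - (1 + ε) ^ 2 * s / 4 := by
    have e1 : 1 ≤ c * (1 + u) := by nlinarith
    have e2 : (1 + ε) * s / 4 ≤ ε / 256 := by nlinarith
    have e3 : (1 + ε) * (1 - ε / 256) ≤ (1 + ε) * (c * (1 + u) - (1 + ε) * s / 4) :=
      mul_le_mul_of_nonneg_left (by linarith) (by linarith)
    linarith
  have h3 : 1 ≤ ρ ^ 2 * (c * (1 + u) * (1 + ε) - (1 + ε) ^ 2 * s / 4) := by
    have e1 : (1 - ε / 4) * ((1 + ε) * (1 - ε / 256))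
        ≤ ρ ^ 2 * (c * (1 + u) * (1 + ε) - (1 + ε) ^ 2 * s / 4) :=
      mul_le_mul hρ2 h2 (mul_nonneg (by linarith) (by linarith)) (sq_nonneg _)
    have e2 : 1 + ε / 2 ≤ (1 - ε / 4) * (1 + ε) := by nlinarith
    have e3 : 1 ≤ (1 + ε / 2) * (1 - ε / 256) := by nlinarith
    have e4 := mul_le_mul_of_nonneg_right e2 (by linarith : 0 ≤ 1 - ε / 256)
    linarith
  have h4 : A ^ 2 * ρ ^ 2 ≤ r ^ 2 * ρ ^ 2 := by
    rw [hr]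
    have e1 : A ^ 2 * ρ ^ 2 = c ^ 2 * ρ * (ρ * (1 + u) ^ 2)
        - s * (ρ ^ 2 * (c * (1 + u) * (1 + ε) - (1 + ε) ^ 2 * s / 4)) := by
      rw [hA]; ring
    have e2 := mul_le_mul_of_nonneg_left h1 (by positivity : 0 ≤ c ^ 2 * ρ)
    have e3 := mul_le_mul_of_nonneg_left h3 hs0
    linarith
  have h5 : A ^ 2 ≤ r ^ 2 := le_of_mul_le_mul_right h4 (by positivity)
  exact (le_abs_self A).trans (sq_le_sq.1 h5)

namespace IsConfinedCurve

variable {c : ℝ} {γ : ℝ → ℂ} (h : IsConfinedCurve c γ)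
include h

lemma angularSpeed_sq {θ : ℝ} (h0 : γ θ ≠ 0) :
    (deriv γ θ / γ θ).im ^ 2 * (1 - 2 * defect γ θ) ^ 2
      = c ^ 2 * (1 - 2 * defect γ θ) - defectSlope γ θ ^ 2 := by
  rw [← norm_sq_eq_sub_defect, ← h.speed θ, defectSlope, ← Complex.normSq_eq_norm_sq,
    ← Complex.normSq_eq_norm_sq]
  have hn : Complex.normSq (γ θ) ≠ 0 := by simpa using h0
  rw [Complex.div_im]
  simp only [Complex.inner, Complex.mul_re, Complex.conj_re, Complex.conj_im]
  field_simp
  simp only [Complex.normSq_apply]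
  ring

/-- The winding number of a nearly circular confined curve is `±1`, which bounds its excess length
by the linearised length functional. -/
lemma excess_le {ε : ℝ} (hε : 0 < ε) (hε1 : ε ≤ 1) (hc : 1 ≤ c) (hc1 : c ≤ 11 / 10)
    (hu : ∀ θ, defect γ θ ≤ ε / 16) (hv : ∀ θ, |defectSlope γ θ| ≤ ε / 16) :
    2 * Real.pi * c - 2 * Real.pi
      ≤ ∫ θ in Ioc 0 (2 * Real.pi), ((1 + ε) * (defectSlope γ θ ^ 2 / 2) - defect γ θ) := by
  have hpi := Real.pi_pos
  have hu0 := h.defect_nonneg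
  have h0 : ∀ θ, γ θ ≠ 0 := fun θ h' => by
    have := norm_sq_eq_sub_defect γ θ
    rw [h'] at this
    have := hu θ
    norm_num at *
    linarith
  set r : ℝ → ℝ := fun θ => (deriv γ θ / γ θ).im with hr
  have hq : Continuous fun θ => deriv γ θ / γ θ := h.continuous_deriv.div h.continuous h0
  have hrc : Continuous r := Complex.continuous_im.comp hq
  have hlow : ∀ θ, c * (1 + defect γ θ) - (1 + ε) * (defectSlope γ θ ^ 2 / 2) ≤ |r θ| := fun θ =>
    le_abs_angularSpeed hε hε1 hc (hu0 θ) (hu θ) (hv θ) (h.angularSpeed_sq (h0 θ))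
  have hv2 : ∀ θ, defectSlope γ θ ^ 2 ≤ (ε / 16) ^ 2 := fun θ =>
    sq_le_sq' (abs_le.1 (hv θ)).1 (abs_le.1 (hv θ)).2
  have hr0 : ∀ θ, r θ ≠ 0 := fun θ h' => by
    have h1 := hlow θ
    rw [h', abs_zero] at h1
    have h2 := hv2 θ
    have h3 : 1 ≤ c * (1 + defect γ θ) := by nlinarith [hu0 θ]
    nlinarith
  have hr2 : ∀ θ, |r θ| < 2 := fun θ => by
    refine abs_lt_of_sq_lt_sq ?_ two_pos.le
    have h1 := h.angularSpeed_sq (h0 θ)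
    have h2 : 7 / 8 ≤ 1 - 2 * defect γ θ := by linarith [hu θ]
    have h3 : 1 - 2 * defect γ θ ≤ 1 := by linarith [hu0 θ]
    have h4 : c ^ 2 ≤ 121 / 100 := by nlinarith
    have h5 : r θ ^ 2 * (1 - 2 * defect γ θ) ^ 2 ≤ 121 / 100 := by
      rw [h1]; nlinarith [sq_nonneg (defectSlope γ θ), sq_nonneg c]
    have h6 : (7 / 8) ^ 2 ≤ (1 - 2 * defect γ θ) ^ 2 := by nlinarith
    nlinarith [mul_le_mul_of_nonneg_left h6 (sq_nonneg (r θ))]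
  -- the angular speed does not change sign, hence `∫ |r|` is an integer multiple of `2π`
  obtain ⟨k, hk⟩ := exists_integral_logDeriv_eq h.contDiff h.periodic h0
  have hk' : ∫ θ in (0 : ℝ)..2 * Real.pi, r θ = k * (2 * Real.pi) := by
    have e1 := Complex.imCLM.intervalIntegral_comp_comm (hq.intervalIntegrable 0 (2 * Real.pi))
      (μ := volume)
    simp only [Complex.imCLM_apply] at e1
    rw [hr, e1, hk]
    simp
  have hsign : ∃ j : ℤ, ∫ θ in (0 : ℝ)..2 * Real.pi, |r θ| = j * (2 * Real.pi) := by
    by_cases hpos : ∀ θ, 0 < r θ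
    · refine ⟨k, ?_⟩
      rw [← hk']
      exact intervalIntegral.integral_congr fun θ _ => abs_of_pos (hpos θ)
    · push Not at hpos
      obtain ⟨θ₁, hθ₁⟩ := hpos
      have hneg : ∀ θ, r θ < 0 := fun θ => by
        by_contra hθ
        obtain ⟨x, hx⟩ := mem_range_of_exists_le_of_exists_ge hrc ⟨θ₁, hθ₁⟩ ⟨θ, not_lt.1 hθ⟩
        exact hr0 x hx
      refine ⟨-k, ?_⟩
      push_cast
      rw [neg_mul, ← hk', ← intervalIntegral.integral_neg]
      exact intervalIntegral.integral_congr fun θ _ => abs_of_neg (hneg θ)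
  obtain ⟨j, hj⟩ := hsign
  have hj1 : j ≤ 1 := by
    have h1 : ∫ θ in (0 : ℝ)..2 * Real.pi, |r θ| < ∫ θ in (0 : ℝ)..2 * Real.pi, (2 : ℝ) :=
      intervalIntegral.integral_lt_integral_of_continuousOn_of_le_of_exists_lt (by linarith)
        hrc.abs.continuousOn continuousOn_const (fun θ _ => (hr2 θ).le)
        ⟨0, ⟨le_rfl, by linarith⟩, hr2 0⟩
    rw [hj, intervalIntegral.integral_const, smul_eq_mul] at h1
    have h2 : (j : ℝ) < 2 := by
      by_contra h'
      nlinarith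
    have : j < 2 := by exact_mod_cast h2
    omega
  have hle : ∫ θ in (0 : ℝ)..2 * Real.pi, |r θ| ≤ 2 * Real.pi := by
    rw [hj]
    have : (j : ℝ) ≤ 1 := by exact_mod_cast hj1
    nlinarith
  have cu := h.continuous_defect
  have cv := h.continuous_defectSlope
  have hint : ∫ θ in (0 : ℝ)..2 * Real.pi,
      (c - ((1 + ε) * (defectSlope γ θ ^ 2 / 2) - defect γ θ))
      ≤ ∫ θ in (0 : ℝ)..2 * Real.pi, |r θ| := by
    refine intervalIntegral.integral_mono_on (by linarith)
      (Continuous.intervalIntegrable (by fun_prop) _ _)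
      (Continuous.intervalIntegrable (by fun_prop) _ _) fun θ _ => ?_
    have := hlow θ
    nlinarith [mul_le_mul_of_nonneg_right hc (hu0 θ)]
  rw [intervalIntegral.integral_sub (by simp) (Continuous.intervalIntegrable (by fun_prop) _ _),
    intervalIntegral.integral_const, smul_eq_mul] at hint
  rw [← intervalIntegral.integral_of_le (by linarith)]
  linarith

lemma integral_sq_defectCurvature_shift (t : ℝ) :
    ∫ θ in Ioc t (t + 2 * Real.pi), defectCurvature c γ θ ^ 2
      = ∫ θ in Ioc 0 (2 * Real.pi), defectCurvature c γ θ ^ 2 := by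
  have hper : Function.Periodic (fun θ => defectCurvature c γ θ ^ 2) (2 * Real.pi) := fun θ => by
    simp only [h.periodic_defectCurvature θ]
  have := hper.intervalIntegral_add_eq t 0
  rwa [zero_add, intervalIntegral.integral_of_le (by linarith [Real.pi_pos]),
    intervalIntegral.integral_of_le Real.two_pi_pos.le] at this

/-- A touching curve with small `∫ |u''|²` is `C¹`-close to the unit circle. -/
lemma abs_defectSlope_le {t τ : ℝ} (ht : defect γ t = 0) (hτ : 0 < τ)
    (hA : ∫ θ in Ioc 0 (2 * Real.pi), defectCurvature c γ θ ^ 2 ≤ τ ^ 2 / (2 * Real.pi)) (θ : ℝ) :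
    |defectSlope γ θ| ≤ τ := by
  have hpi := Real.pi_pos
  have hvt : defectSlope γ t = 0 :=
    IsLocalMin.hasDerivAt_eq_zero (Eventually.of_forall fun y => ht ▸ h.defect_nonneg y)
      (h.hasDerivAt_defect t)
  obtain ⟨x, hx, hθx⟩ := h.periodic_defectSlope.exists_mem_Ico Real.two_pi_pos θ t
  rw [hθx]
  have iw := h.intervalIntegrable_defectCurvature t (t + 2 * Real.pi)
  have iw2 := h.intervalIntegrable_sq_defectCurvature t (t + 2 * Real.pi)
  have hle : t ≤ t + 2 * Real.pi := by linarith
  have e1 : defectSlope γ x = ∫ θ in t..x, defectCurvature c γ θ := by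
    rw [← h.defectSlope_sub, hvt, sub_zero]
  have e2 : |∫ θ in t..x, defectCurvature c γ θ| ≤ ∫ θ in t..x, |defectCurvature c γ θ| :=
    intervalIntegral.abs_integral_le_integral_abs hx.1
  have e3 : ∫ θ in t..x, |defectCurvature c γ θ|
      ≤ ∫ θ in t..t + 2 * Real.pi, |defectCurvature c γ θ| :=
    intervalIntegral.integral_mono_interval le_rfl hx.1 hx.2.le
      (Eventually.of_forall fun θ => abs_nonneg _) iw.abs
  -- Young's inequality with the weight that balances both terms
  have e4 : ∫ θ in t..t + 2 * Real.pi, |defectCurvature c γ θ|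
      ≤ ∫ θ in t..t + 2 * Real.pi, (Real.pi / τ * defectCurvature c γ θ ^ 2
        + τ / (4 * Real.pi)) := by
    refine intervalIntegral.integral_mono_on hle iw.abs ((iw2.const_mul _).add (by simp))
      fun θ _ => ?_
    have h1 := sq_nonneg (2 * Real.pi * |defectCurvature c γ θ| - τ)
    have h2 : Real.pi / τ * defectCurvature c γ θ ^ 2 + τ / (4 * Real.pi)
        - |defectCurvature c γ θ|
        = (2 * Real.pi * |defectCurvature c γ θ| - τ) ^ 2 / (4 * Real.pi * τ) := by
      rw [← sq_abs (defectCurvature c γ θ)]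
      field_simp
      ring
    have h3 : 0 ≤ (2 * Real.pi * |defectCurvature c γ θ| - τ) ^ 2 / (4 * Real.pi * τ) := by
      positivity
    linarith
  have e0 := h.integral_sq_defectCurvature_shift t
  rw [← intervalIntegral.integral_of_le hle] at e0
  rw [intervalIntegral.integral_add (iw2.const_mul _) (by simp),
    intervalIntegral.integral_const_mul, intervalIntegral.integral_const, smul_eq_mul, e0] at e4
  have e5 := mul_le_mul_of_nonneg_left hA (by positivity : 0 ≤ Real.pi / τ)
  have e6 : Real.pi / τ * (τ ^ 2 / (2 * Real.pi)) = τ / 2 := by field_simp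
  have e7 : (t + 2 * Real.pi - t) * (τ / (4 * Real.pi)) = τ / 2 := by field_simp; ring
  rw [e1]
  linarith

lemma defect_le {t τ : ℝ} (ht : defect γ t = 0) (hv : ∀ θ, |defectSlope γ θ| ≤ τ) (θ : ℝ) :
    defect γ θ ≤ 2 * Real.pi * τ := by
  have hτ : 0 ≤ τ := (abs_nonneg _).trans (hv 0)
  obtain ⟨x, hx, hθx⟩ := h.periodic_defect.exists_mem_Ico Real.two_pi_pos θ t
  rw [hθx]
  have := Convex.norm_image_sub_le_of_norm_hasDerivWithin_le (s := univ) (C := τ)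
    (fun y _ => (h.hasDerivAt_defect y).hasDerivWithinAt) (fun y _ => hv y) convex_univ
    (mem_univ t) (mem_univ x)
  rw [ht, sub_zero, Real.norm_eq_abs, Real.norm_eq_abs, abs_of_nonneg (sub_nonneg.2 hx.1)] at this
  have h1 := le_abs_self (defect γ x)
  have h2 : τ * (x - t) ≤ τ * (2 * Real.pi) := mul_le_mul_of_nonneg_left (by linarith [hx.2]) hτ
  linarith

/-- The uncovered part of the circle is, up to the excess length, at least as long as the part of
the parameter interval on which the curve is detached. -/
lemma le_hausdorffMeasure_diff (hc : 1 ≤ c) (t : ℝ) :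
    (volume ({θ | 0 < defect γ θ} ∩ Ioo t (t + 2 * Real.pi))).toReal
        - (2 * Real.pi * c - 2 * Real.pi)
      ≤ (μH[1] (Metric.sphere (0 : ℂ) 1 \ range γ)).toReal := by
  have hpi := Real.pi_pos
  set S := {θ | 0 < defect γ θ} ∩ Ioo t (t + 2 * Real.pi) with hS
  set Z := Ico t (t + 2 * Real.pi) \ S with hZ
  have hSm : MeasurableSet S :=
    ((isOpen_lt continuous_const h.continuous_defect).inter isOpen_Ioo).measurableSet
  have hSsub : S ⊆ Ico t (t + 2 * Real.pi) := inter_subset_right.trans Ioo_subset_Ico_self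
  have hSfin : volume S ≠ ⊤ := ((measure_mono hSsub).trans_lt measure_Ico_lt_top).ne
  have hZvol : (volume Z).toReal = 2 * Real.pi - (volume S).toReal := by
    rw [hZ, measure_sdiff hSsub hSm.nullMeasurableSet hSfin, Real.volume_Ico,
      ENNReal.toReal_sub_of_le (by
        rw [← Real.volume_Ico]; exact measure_mono hSsub) ENNReal.ofReal_ne_top,
      ENNReal.toReal_ofReal (by linarith)]
    ring
  have hlip : LipschitzWith c.toNNReal γ := by
    refine lipschitzWith_of_nnnorm_deriv_le (h.contDiff.differentiable (by simp)) fun θ => ?_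
    rw [← NNReal.coe_le_coe, coe_nnnorm, h.speed, Real.coe_toNNReal _ (by linarith)]
  have hcov : Metric.sphere (0 : ℂ) 1 ⊆ (Metric.sphere (0 : ℂ) 1 \ range γ) ∪ γ '' Z := by
    intro z hz
    by_cases hr : z ∈ range γ
    · right
      obtain ⟨y, rfl⟩ := hr
      obtain ⟨x, hx, hyx⟩ := h.periodic.exists_mem_Ico Real.two_pi_pos y t
      rw [hyx] at hz ⊢
      refine ⟨x, ⟨hx, fun hxS => ?_⟩, rfl⟩
      have h1 : 0 < defect γ x := hxS.1
      rw [defect, mem_sphere_zero_iff_norm.1 hz] at h1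
      norm_num at h1
    · exact Or.inl ⟨hz, hr⟩
  have hfin : μH[1] (Metric.sphere (0 : ℂ) 1 \ range γ) ≠ ⊤ := by
    refine ((measure_mono sdiff_subset).trans_lt ?_).ne
    rw [hausdorffMeasure_sphere]
    exact ENNReal.ofReal_lt_top
  have hZfin : volume Z ≠ ⊤ := ((measure_mono sdiff_subset).trans_lt measure_Ico_lt_top).ne
  have h1 : ENNReal.ofReal (2 * Real.pi)
      ≤ μH[1] (Metric.sphere (0 : ℂ) 1 \ range γ) + c.toNNReal * volume Z := by
    rw [← hausdorffMeasure_sphere]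
    refine (measure_mono hcov).trans ((measure_union_le _ _).trans ?_)
    gcongr
    have := hlip.hausdorffMeasure_image_le zero_le_one Z
    rwa [hausdorffMeasure_real, ENNReal.rpow_one] at this
  have hf2 : (c.toNNReal : ENNReal) * volume Z ≠ ⊤ := ENNReal.mul_ne_top ENNReal.coe_ne_top hZfin
  have h2 := ENNReal.toReal_mono (ENNReal.add_ne_top.2 ⟨hfin, hf2⟩) h1
  rw [ENNReal.toReal_ofReal (by linarith), ENNReal.toReal_add hfin hf2, ENNReal.toReal_mul,
    ENNReal.coe_toReal, Real.coe_toNNReal _ (by linarith), hZvol] at h2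
  have h3 := mul_le_mul_of_nonneg_right hc (ENNReal.toReal_nonneg (a := volume S))
  linarith

end IsConfinedCurve

/-! ### The lower bound -/

/-- A confined curve can be translated until it touches the unit circle; this does not increase the
penalised energy. -/
lemma IsConfinedCurve.exists_touching {α c : ℝ} (hα : 0 ≤ α) {γ : ℝ → ℂ}
    (h : IsConfinedCurve c γ) :
    ∃ γ', IsConfinedCurve c γ' ∧ (∃ t, defect γ' t = 0) ∧
      penalisedEnergy α γ' ≤ penalisedEnergy α γ := by
  by_cases ht : ∃ t, defect γ t = 0
  · exact ⟨γ, h, ht, le_rfl⟩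
  have hK : IsCompact (Icc (0 : ℝ) (2 * Real.pi)) := isCompact_Icc
  have hne : (Icc (0 : ℝ) (2 * Real.pi)).Nonempty := ⟨0, le_rfl, Real.two_pi_pos.le⟩
  have hγc := h.continuous
  -- `M s` is the largest distance from the origin after a translation by `s`; it passes through `1`
  let f : ℝ → ℝ → ℝ := fun s θ => ‖γ θ + s‖
  let M : ℝ → ℝ := fun s => sSup (f s '' Icc 0 (2 * Real.pi))
  have hfs : ∀ s, Continuous (f s) := fun s => by fun_prop
  have hM : Continuous M := hK.continuous_sSup (by fun_prop)
  have hbdd : ∀ s, BddAbove (f s '' Icc 0 (2 * Real.pi)) := fun s =>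
    (hK.image (hfs s)).bddAbove
  have hM0 : M 0 ≤ 1 := csSup_le (hne.image _) (by
    rintro _ ⟨θ, -, rfl⟩
    simpa [f] using h.norm_le θ)
  have hM2 : 1 ≤ M 2 := by
    refine le_trans ?_ (le_csSup (hbdd 2)
      ⟨0, ⟨le_rfl, Real.two_pi_pos.le⟩, rfl⟩)
    have h1 : ‖((2 : ℝ) : ℂ)‖ ≤ ‖γ 0 + ((2 : ℝ) : ℂ)‖ + ‖γ 0‖ := by
      have := norm_sub_le (γ 0 + ((2 : ℝ) : ℂ)) (γ 0)
      rwa [add_sub_cancel_left] at this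
    have h2 := h.norm_le 0
    simp only [Complex.norm_real, Real.norm_eq_abs, abs_two] at h1
    simp only [f]
    linarith
  obtain ⟨s, -, hs⟩ := intermediate_value_Icc (zero_le_two (α := ℝ)) hM.continuousOn ⟨hM0, hM2⟩
  have hder : deriv (fun θ => γ θ + s) = deriv γ := funext fun θ => by simp
  have hper : Function.Periodic (fun θ => γ θ + s) (2 * Real.pi) := fun θ => by
    simp only [h.periodic θ]
  have hle : ∀ θ, ‖γ θ + s‖ ≤ 1 := fun θ => by
    obtain ⟨y, hy, hθy⟩ := hper.exists_mem_Ico₀ Real.two_pi_pos θ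
    rw [hθy, ← hs]
    exact le_csSup (hbdd s) ⟨y, Ico_subset_Icc_self hy, rfl⟩
  have h' : IsConfinedCurve c (fun θ => γ θ + s) :=
    ⟨⟨hper, h.contDiff.add contDiff_const, by rw [hder]; exact h.w22.2.2.1,
      by rw [hder]; exact h.w22.2.2.2⟩, hle, by rw [hder]; exact h.speed⟩
  refine ⟨_, h', ?_, ?_⟩
  · obtain ⟨t, -, htm⟩ := hK.exists_sSup_image_eq hne (hfs s).continuousOn
    refine ⟨t, ?_⟩
    have : ‖γ t + s‖ = 1 := by rw [← hs]; exact htm.symm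
    simp [defect, this]
  · have hdis : Metric.sphere (0 : ℂ) 1 \ range γ = Metric.sphere (0 : ℂ) 1 := by
      refine sdiff_eq_left.2 (disjoint_left.2 ?_)
      rintro _ hz ⟨t, rfl⟩
      exact ht ⟨t, by simp [defect, mem_sphere_zero_iff_norm.1 hz]⟩
    unfold penalisedEnergy
    have e1 : elasticEnergy (fun θ => γ θ + s) = elasticEnergy γ := by
      unfold elasticEnergy; rw [hder]
    rw [e1, hdis]
    gcongr
    · rw [hausdorffMeasure_sphere]; exact ENNReal.ofReal_ne_top
    · exact sdiff_subset

lemma elasticEnergy_le_penalisedEnergy {α : ℝ} (hα : 0 ≤ α) (γ : ℝ → ℂ) :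
    elasticEnergy γ ≤ penalisedEnergy α γ := by
  unfold penalisedEnergy
  have : 0 ≤ α * (μH[1] (Metric.sphere (0 : ℂ) 1 \ range γ)).toReal := by positivity
  linarith

lemma tendsto_rpow_third : Tendsto (fun δ : ℝ => δ ^ (1 / 3 : ℝ)) (𝓝[>] 0) (𝓝 0) := by
  have := (Real.continuousAt_rpow_const 0 (1 / 3 : ℝ) (Or.inr (by norm_num))).tendsto
  rw [Real.zero_rpow (by norm_num)] at this
  exact this.mono_left nhdsWithin_le_nhds

/-- The lower bound for a touching curve, with the smallness conditions on `δ` made explicit. The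
defect, multiplied by `1 + ε`, is compared with the profile problem; the powers of `1 + ε` collect
the losses. -/
lemma IsConfinedCurve.le_penalisedEnergy_of_touching {α δ ε : ℝ} (hα : 0 ≤ α) (hε : 0 < ε)
    (hε1 : ε ≤ 1) (hδ : 0 < δ) (hδ1 : δ ≤ 2 * Real.pi * (1 / 10)) (hδ2 : δ ≤ 2 * Real.pi * ε)
    (hδ3 : 2 * (delaminationConstant α * δ ^ (1 / 3 : ℝ))
      ≤ (ε / (32 * Real.pi)) ^ 2 / (2 * Real.pi))
    {γ : ℝ → ℂ} (h : IsConfinedCurve (1 + δ / (2 * Real.pi)) γ) {t : ℝ} (ht : defect γ t = 0) :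
    2 * Real.pi + delaminationConstant α * δ ^ (1 / 3 : ℝ) / (1 + ε) ^ 5 - α * δ
      ≤ penalisedEnergy α γ := by
  have hpi := Real.pi_pos
  have hpi3 := Real.pi_gt_three
  set Θ := delaminationConstant α with hΘ
  have hΘ0 : 0 ≤ Θ := delaminationConstant_nonneg hα
  set X := δ ^ (1 / 3 : ℝ) with hX
  have hX0 : 0 ≤ X := Real.rpow_nonneg hδ.le _
  set c := 1 + δ / (2 * Real.pi) with hc
  have hcδ : 2 * Real.pi * c - 2 * Real.pi = δ := by rw [hc]; field_simp; ring
  have hc1 : 1 ≤ c := by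
    have : 0 ≤ δ / (2 * Real.pi) := by positivity
    rw [hc]
    linarith
  have hc11 : c ≤ 11 / 10 := by nlinarith
  have hcε : c ≤ 1 + ε := by nlinarith
  have hc0 : 0 < c := by linarith
  set τ := ε / (32 * Real.pi) with hτ
  have hτ0 : 0 < τ := by positivity
  have hτ1 : τ ≤ ε / 16 := by
    rw [hτ]; exact div_le_div_of_nonneg_left hε.le (by norm_num) (by linarith)
  have hτ2 : 2 * Real.pi * τ = ε / 16 := by rw [hτ]; field_simp; norm_num
  have hε5 : 1 ≤ (1 + ε) ^ 5 := one_le_pow₀ (by linarith)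
  -- only curves violating the bound matter, and these have small `∫ |u''|²`
  by_contra hcon
  rw [not_le] at hcon
  set A := ∫ θ in Ioc 0 (2 * Real.pi), defectCurvature c γ θ ^ 2 with hA
  have hA0 : 0 ≤ A := integral_nonneg fun θ => sq_nonneg _
  have hE := h.le_elasticEnergy hc0
  rw [← hA] at hE
  have hEW := elasticEnergy_le_penalisedEnergy hα γ
  have hdiv : Θ * X / (1 + ε) ^ 5 ≤ Θ * X := div_le_self (mul_nonneg hΘ0 hX0) hε5
  have hαδ : 0 ≤ α * δ := mul_nonneg hα hδ.le
  have hAle : c⁻¹ ^ 3 * A ≤ Θ * X := by linarith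
  have hA2 : A ≤ τ ^ 2 / (2 * Real.pi) := by
    have e1 : A = c ^ 3 * (c⁻¹ ^ 3 * A) := by field_simp
    have e2 : c ^ 3 ≤ 2 := by
      have : c ^ 3 ≤ (11 / 10) ^ 3 := pow_le_pow_left₀ hc0.le hc11 3
      norm_num at this ⊢
      linarith
    have e3 := mul_le_mul e2 hAle (by positivity) two_pos.le
    linarith
  have hv : ∀ θ, |defectSlope γ θ| ≤ τ := h.abs_defectSlope_le ht hτ0 hA2
  have hu : ∀ θ, defect γ θ ≤ ε / 16 := fun θ => by
    rw [← hτ2]; exact h.defect_le ht hv θ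
  have hexc := h.excess_le hε hε1 hc1 hc11 hu fun θ => (hv θ).trans hτ1
  rw [hcδ] at hexc
  -- rescaling the defect by `1 + ε` absorbs the nonlinear error in the excess length
  have cu := h.continuous_defect
  have cv := h.continuous_defectSlope
  have hshift : ∫ θ in Ioc t (t + 2 * Real.pi),
      (((1 + ε) * defectSlope γ θ) ^ 2 / 2 - (1 + ε) * defect γ θ)
      = (1 + ε) * ∫ θ in Ioc 0 (2 * Real.pi),
        ((1 + ε) * (defectSlope γ θ ^ 2 / 2) - defect γ θ) := by
    have hper : Function.Periodic
        (fun θ => ((1 + ε) * defectSlope γ θ) ^ 2 / 2 - (1 + ε) * defect γ θ) (2 * Real.pi) :=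
      fun θ => by simp only [h.periodic_defect θ, h.periodic_defectSlope θ]
    have e := hper.intervalIntegral_add_eq t 0
    rw [zero_add, intervalIntegral.integral_of_le (by linarith),
      intervalIntegral.integral_of_le (by linarith)] at e
    rw [e, ← integral_const_mul]
    congr 1
    funext θ
    ring
  have hprof := delaminationConstant_mul_rpow_le_of_nonneg hα (a := t) (b := t + 2 * Real.pi)
    (u := fun θ => (1 + ε) * defect γ θ) (v := fun θ => (1 + ε) * defectSlope γ θ)
    (w := fun θ => (1 + ε) * defectCurvature c γ θ) (m := δ) (by linarith)
    (fun x => (h.hasDerivAt_defect x).const_mul _) (by fun_prop)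
    (fun x y => by
      rw [intervalIntegral.integral_const_mul, ← h.defectSlope_sub]; ring)
    ((h.intervalIntegrable_defectCurvature t (t + 2 * Real.pi)).1.const_mul _)
    (by
      have := ((h.intervalIntegrable_sq_defectCurvature t (t + 2 * Real.pi)).1.const_mul
        ((1 + ε) ^ 2))
      simp only [mul_pow]
      exact this)
    (fun x => mul_nonneg (by linarith) (h.defect_nonneg x)) (by simp [ht])
    (by simp [h.periodic_defect t, ht]) hδ
    (by
      rw [hshift]
      have := mul_le_mul_of_nonneg_left hexc (by linarith : 0 ≤ ε)
      nlinarith)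
  have hset : {x | 0 < (1 + ε) * defect γ x} = {x | 0 < defect γ x} := by
    ext x
    exact mul_pos_iff_of_pos_left (show 0 < 1 + ε by linarith)
  have hH := h.le_hausdorffMeasure_diff hc1 t
  rw [hcδ] at hH
  simp only [mul_pow, integral_const_mul] at hprof
  rw [h.integral_sq_defectCurvature_shift t, ← hA, hset, ← hΘ, ← hX] at hprof
  set V := (volume ({θ | 0 < defect γ θ} ∩ Ioo t (t + 2 * Real.pi))).toReal with hV
  have hV0 : 0 ≤ V := ENNReal.toReal_nonneg
  have hW : 2 * Real.pi * c + c⁻¹ ^ 3 * A + α * (V - δ) ≤ penalisedEnergy α γ := by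
    unfold penalisedEnergy
    have := mul_le_mul_of_nonneg_left hH hα
    linarith
  have hfin : Θ * X / (1 + ε) ^ 5 ≤ c⁻¹ ^ 3 * A + α * V := by
    rw [div_le_iff₀ (by positivity)]
    have e1 : (1 + ε) ^ 2 * A ≤ c⁻¹ ^ 3 * A * (1 + ε) ^ 5 := by
      have : c ^ 3 ≤ (1 + ε) ^ 3 := pow_le_pow_left₀ hc0.le hcε 3
      have e : c⁻¹ ^ 3 * A * (1 + ε) ^ 5 = (1 + ε) ^ 2 * A * ((1 + ε) ^ 3 / c ^ 3) := by
        field_simp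
      rw [e]
      exact le_mul_of_one_le_right (by positivity) ((one_le_div (by positivity)).2 this)
    have e2 : α * V ≤ α * V * (1 + ε) ^ 5 :=
      le_mul_of_one_le_right (mul_nonneg hα hV0) hε5
    rw [add_mul]
    linarith
  linarith

/-- The lower bound of the expansion. -/
lemma eventually_le_penalisedEnergy {α η : ℝ} (hα : 0 ≤ α) (hη : 0 < η) :
    ∀ᶠ δ : ℝ in 𝓝[>] 0, ∀ γ ∈ curveClassClosure (2 * Real.pi + δ),
      2 * Real.pi + (delaminationConstant α - η) * δ ^ (1 / 3 : ℝ) ≤ penalisedEnergy α γ := by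
  have hpi := Real.pi_pos
  set Θ := delaminationConstant α with hΘ
  have hlim : Tendsto (fun ε : ℝ => Θ / (1 + ε) ^ 5) (𝓝[>] 0) (𝓝 Θ) := by
    have : ContinuousAt (fun ε : ℝ => Θ / (1 + ε) ^ 5) 0 :=
      ContinuousAt.div (by fun_prop) (by fun_prop) (by norm_num)
    have h := this.tendsto
    simp only [add_zero, one_pow, div_one] at h
    exact h.mono_left nhdsWithin_le_nhds
  obtain ⟨ε, ⟨hε2, hε1⟩, hε0⟩ := ((hlim.eventually (lt_mem_nhds (by linarith : Θ - η / 2 < Θ))).and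
    ((nhdsWithin_le_nhds (Iic_mem_nhds one_pos)) : ∀ᶠ ε : ℝ in 𝓝[>] 0, ε ∈ Iic 1)).and
    self_mem_nhdsWithin |>.exists
  have hε0 : 0 < ε := hε0
  have hε1 : ε ≤ 1 := hε1
  have hX := tendsto_rpow_third
  have l1 : ∀ᶠ δ : ℝ in 𝓝[>] 0, δ ≤ 2 * Real.pi * (1 / 10) :=
    nhdsWithin_le_nhds (Iic_mem_nhds (by positivity))
  have l2 : ∀ᶠ δ : ℝ in 𝓝[>] 0, δ ≤ 2 * Real.pi * ε :=
    nhdsWithin_le_nhds (Iic_mem_nhds (by positivity))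
  have l3 : ∀ᶠ δ : ℝ in 𝓝[>] 0, 2 * (Θ * δ ^ (1 / 3 : ℝ))
      ≤ (ε / (32 * Real.pi)) ^ 2 / (2 * Real.pi) := by
    have : Tendsto (fun δ : ℝ => 2 * (Θ * δ ^ (1 / 3 : ℝ))) (𝓝[>] 0) (𝓝 (2 * (Θ * 0))) :=
      (hX.const_mul _).const_mul _
    rw [mul_zero, mul_zero] at this
    exact (this.eventually (gt_mem_nhds (by positivity))).mono fun _ h => h.le
  have l4 : ∀ᶠ δ : ℝ in 𝓝[>] 0, α * (δ ^ (1 / 3 : ℝ)) ^ 2 ≤ η / 2 := by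
    have : Tendsto (fun δ : ℝ => α * (δ ^ (1 / 3 : ℝ)) ^ 2) (𝓝[>] 0) (𝓝 (α * 0 ^ 2)) :=
      (hX.pow 2).const_mul _
    rw [zero_pow two_ne_zero, mul_zero] at this
    exact (this.eventually (gt_mem_nhds (by positivity))).mono fun _ h => h.le
  filter_upwards [l1, l2, l3, l4, self_mem_nhdsWithin] with δ h1 h2 h3 h4 hδ γ hγ
  have hδ : 0 < δ := hδ
  have hconf := IsConfinedCurve.of_mem_closure hγ
  have hspeed : (2 * Real.pi + δ) / (2 * Real.pi) = 1 + δ / (2 * Real.pi) := by field_simp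
  rw [hspeed] at hconf
  obtain ⟨γ', hγ', ⟨t, ht⟩, hle⟩ := hconf.exists_touching hα
  have hmain := hγ'.le_penalisedEnergy_of_touching hα hε0 hε1 hδ h1 h2 h3 ht
  have hX0 : 0 ≤ δ ^ (1 / 3 : ℝ) := Real.rpow_nonneg hδ.le _
  have hX3 : (δ ^ (1 / 3 : ℝ)) ^ 3 = δ := by
    rw [← Real.rpow_natCast, ← Real.rpow_mul hδ.le]; norm_num
  set X := δ ^ (1 / 3 : ℝ) with hXdef
  have e1 : α * δ ≤ η / 2 * X := by
    have : α * δ = α * X ^ 2 * X := by rw [← hX3]; ring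
    rw [this]
    exact mul_le_mul_of_nonneg_right h4 hX0
  have e2 : (Θ - η / 2) * X ≤ Θ * X / (1 + ε) ^ 5 := by
    rw [mul_div_right_comm]
    exact mul_le_mul_of_nonneg_right hε2.le hX0
  rw [← hΘ] at hmain
  linarith

/-! ### Periodic bumps -/

/-- The `T`-periodic extension of the restriction of `f` to `[0, T)`. -/
def periodize (T : ℝ) (f : ℝ → ℝ) (x : ℝ) : ℝ := f (T * Int.fract (x / T))

section Periodize

variable {T p q : ℝ} {f : ℝ → ℝ}

lemma periodize_periodic (hT : 0 < T) (f : ℝ → ℝ) : Function.Periodic (periodize T f) T :=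
  fun x => by
    unfold periodize
    rw [add_div, div_self hT.ne', Int.fract_add_one]

lemma periodize_eq (hT : 0 < T) (f : ℝ → ℝ) {x : ℝ} (hx : x ∈ Ico 0 T) : periodize T f x = f x := by
  unfold periodize
  rw [Int.fract_eq_self.2 ⟨div_nonneg hx.1 hT.le, (div_lt_one hT).2 hx.2⟩, mul_div_cancel₀ _ hT.ne']

/-- Near every point the periodic extension of a function supported inside `(0, T)` is a translate
of the function. -/
lemma periodize_eventuallyEq (hT : 0 < T) (hp : 0 < p) (hq : q < T)
    (hf : ∀ x, x ∉ Icc p q → f x = 0) (x : ℝ) :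
    periodize T f =ᶠ[𝓝 x] fun y => f (y - ⌊x / T⌋ * T) := by
  set k := ⌊x / T⌋ with hk
  have hk1 : (k : ℝ) * T ≤ x := (le_div_iff₀ hT).1 (Int.floor_le (x / T))
  have hk2 : x < (k + 1) * T := (div_lt_iff₀ hT).1 (Int.lt_floor_add_one (x / T))
  have hsame : ∀ y, (k : ℝ) * T ≤ y → y < (k + 1) * T → periodize T f y = f (y - k * T) := by
    intro y h1 h2
    have hfl : ⌊y / T⌋ = k := Int.floor_eq_iff.2 ⟨(le_div_iff₀ hT).2 h1, (div_lt_iff₀ hT).2 h2⟩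
    unfold periodize
    rw [Int.fract, hfl]
    congr 1
    field_simp
  rcases eq_or_lt_of_le hk1 with h | h
  · have m1 : ∀ᶠ y in 𝓝 x, y < x + p := gt_mem_nhds (by linarith)
    have m2 : ∀ᶠ y in 𝓝 x, x - (T - q) < y := lt_mem_nhds (by linarith)
    have m3 : ∀ᶠ y in 𝓝 x, y < (k + 1) * T := gt_mem_nhds hk2
    have m4 : ∀ᶠ y in 𝓝 x, x - T < y := lt_mem_nhds (by linarith)
    filter_upwards [m1, m2, m3, m4] with y h1 h2 h3 h4
    rcases le_or_gt ((k : ℝ) * T) y with h5 | h5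
    · exact hsame y h5 h3
    · have hfl : ⌊y / T⌋ = k - 1 := Int.floor_eq_iff.2
        ⟨(le_div_iff₀ hT).2 (by push_cast; linarith), (div_lt_iff₀ hT).2 (by push_cast; linarith)⟩
      have e : T * Int.fract (y / T) = y - k * T + T := by
        rw [Int.fract, hfl]; push_cast; field_simp; ring
      rw [periodize, e, hf _ fun h' => absurd h'.2 (not_le.2 (by linarith)),
        hf _ fun h' => absurd h'.1 (not_le.2 (by linarith))]
  · filter_upwards [lt_mem_nhds h, gt_mem_nhds hk2] with y h1 h2
    exact hsame y h1.le h2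

lemma contDiff_periodize (hT : 0 < T) (hp : 0 < p) (hq : q < T)
    (hf : ∀ x, x ∉ Icc p q → f x = 0) (hs : ContDiff ℝ ∞ f) : ContDiff ℝ ∞ (periodize T f) :=
  contDiff_iff_contDiffAt.2 fun x =>
    (hs.comp (contDiff_id.sub contDiff_const)).contDiffAt.congr_of_eventuallyEq
      (periodize_eventuallyEq hT hp hq hf x)

lemma deriv_eq_zero_of_notMem (hf : ∀ x, x ∉ Icc p q → f x = 0) (x : ℝ) (hx : x ∉ Icc p q) :
    deriv f x = 0 := by
  have : f =ᶠ[𝓝 x] fun _ => 0 := by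
    filter_upwards [isClosed_Icc.isOpen_compl.mem_nhds hx] with y hy using hf y hy
  rw [this.deriv_eq, deriv_const]

lemma deriv_periodize (hT : 0 < T) (hp : 0 < p) (hq : q < T)
    (hf : ∀ x, x ∉ Icc p q → f x = 0) : deriv (periodize T f) = periodize T (deriv f) := by
  funext x
  rw [(periodize_eventuallyEq hT hp hq hf x).deriv_eq,
    (periodize_eventuallyEq hT hp hq (deriv_eq_zero_of_notMem hf) x).eq_of_nhds,
    deriv_comp_sub_const]

lemma integral_periodize (hT : 0 < T) (hp : 0 < p) (hq : q < T)
    (hf : ∀ x, x ∉ Icc p q → f x = 0) : ∫ x in Ioc 0 T, periodize T f x = ∫ x, f x := by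
  have h1 : ∫ x in Ioc 0 T, periodize T f x = ∫ x in Ioo 0 T, f x := by
    rw [integral_Ioc_eq_integral_Ioo]
    exact setIntegral_congr_fun measurableSet_Ioo fun x hx =>
      periodize_eq hT f (Ioo_subset_Ico_self hx)
  rw [h1]
  refine setIntegral_eq_integral_of_forall_compl_eq_zero fun x hx => hf x fun h => hx ?_
  exact ⟨hp.trans_le h.1, h.2.trans_lt hq⟩

end Periodize

lemma integral_comp_sub_div_eq (g : ℝ → ℝ) {ε : ℝ} (hε : 0 < ε) (b : ℝ) :
    ∫ x, g ((x - b) / ε) = ε * ∫ x, g x := by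
  rw [integral_sub_right_eq_self (fun x => g (x / ε)) b, Measure.integral_comp_div,
    abs_of_pos hε, smul_eq_mul]

/-- The rescaled profile `ε² φ((· - π) / ε)`, made `2π`-periodic. -/
lemma exists_periodic_bump {φ : ℝ → ℝ} (hφ : φ ∈ profileClass) :
    ∃ K P Q : ℝ, 0 ≤ K ∧ 0 ≤ Q ∧ P = 1 + Q ∧ ∃ ε₀ > 0, ∀ ε, 0 < ε → ε < ε₀ →
      ∃ U : ℝ → ℝ, ContDiff ℝ ∞ U ∧ Function.Periodic U (2 * Real.pi) ∧
        (∀ θ, 0 ≤ U θ) ∧ (∀ θ, U θ ≤ K * ε ^ 2) ∧ (∀ θ, |deriv U θ| ≤ K * ε) ∧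
        ∫ θ in Ioc 0 (2 * Real.pi), U θ = ε ^ 3 * Q ∧
        ∫ θ in Ioc 0 (2 * Real.pi), (deriv U θ) ^ 2 / 2 = ε ^ 3 * P ∧
        ∫ θ in Ioc 0 (2 * Real.pi), (deriv (deriv U) θ) ^ 2
          = ε * ∫ x, (deriv (deriv φ) x) ^ 2 ∧
        (volume ({θ | 0 < U θ} ∩ Ico 0 (2 * Real.pi))).toReal
          ≤ ε * (volume {x | 0 < φ x}).toReal := by
  obtain ⟨hs, hc, h0, hm⟩ := hφ
  have hpi := Real.pi_pos
  have hd : Continuous (deriv φ) := hs.continuous_deriv (by simp)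
  have hdc : HasCompactSupport (deriv φ) := hc.deriv
  obtain ⟨C₀, hC₀⟩ := hc.exists_bound_of_continuous hs.continuous
  obtain ⟨C₁, hC₁⟩ := hdc.exists_bound_of_continuous hd
  obtain ⟨A, hA⟩ : ∃ A, ∀ x, A < |x| → φ x = 0 := by
    obtain ⟨A, hA⟩ := hc.isCompact.isBounded.subset_closedBall 0
    refine ⟨A, fun x hx => ?_⟩
    by_contra h
    have := hA (subset_tsupport _ h)
    rw [mem_closedBall_zero_iff, Real.norm_eq_abs] at this
    linarith
  have i2 : Integrable φ := hs.continuous.integrable_of_hasCompactSupport hc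
  have i1 : Integrable fun x => (deriv φ x) ^ 2 / 2 := by
    refine Continuous.integrable_of_hasCompactSupport (by fun_prop) ?_
    exact hdc.comp_left (g := fun y : ℝ => y ^ 2 / 2) (by simp)
  have hPQ : ∫ x, (deriv φ x) ^ 2 / 2 = 1 + ∫ x, φ x := by
    rw [integral_sub i1 i2] at hm; linarith
  refine ⟨max C₀ C₁, ∫ x, (deriv φ x) ^ 2 / 2, ∫ x, φ x,
    le_max_of_le_left ((norm_nonneg _).trans (hC₀ 0)), integral_nonneg h0, hPQ,
    Real.pi / (|A| + 1), by positivity, fun ε hε hε1 => ?_⟩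
  have hεA : ε * (|A| + 1) < Real.pi := (lt_div_iff₀ (by positivity)).1 hε1
  set B := |A| + 1 with hB
  have hB0 : 0 < B := by positivity
  have hT := Real.two_pi_pos
  have hp : 0 < Real.pi - ε * B := by linarith
  have hq : Real.pi + ε * B < 2 * Real.pi := by linarith
  have hout : ∀ {x : ℝ}, x ∉ Icc (Real.pi - ε * B) (Real.pi + ε * B) → A < |(x - Real.pi) / ε| := by
    intro x hx
    by_contra h
    have h1 : |(x - Real.pi) / ε| ≤ B := by
      have := le_abs_self A
      linarith [not_lt.1 h]
    rw [abs_div, abs_of_pos hε, div_le_iff₀ hε, abs_le] at h1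
    exact hx ⟨by linarith [h1.1], by linarith [h1.2]⟩
  have hz : ∀ {g : ℝ → ℝ}, (∀ x, A < |x| → g x = 0) → ∀ x,
      x ∉ Icc (Real.pi - ε * B) (Real.pi + ε * B) → g ((x - Real.pi) / ε) = 0 :=
    fun hg x hx => hg _ (hout hx)
  have hdz : ∀ {g : ℝ → ℝ}, (∀ x, A < |x| → g x = 0) → ∀ x, A < |x| → deriv g x = 0 := by
    intro g hg x hx
    have : g =ᶠ[𝓝 x] fun _ => 0 := by
      filter_upwards [(isOpen_lt continuous_const continuous_abs).mem_nhds hx]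
        with y hy using hg y hy
    rw [this.deriv_eq, deriv_const]
  have dsc : ∀ (k : ℝ) (g : ℝ → ℝ), deriv (fun x => k * g ((x - Real.pi) / ε))
      = fun x => k / ε * deriv g ((x - Real.pi) / ε) := by
    intro k g
    funext x
    rw [deriv_const_mul_field]
    have : (fun x => g ((x - Real.pi) / ε)) = fun x => (fun y => g (ε⁻¹ * y)) (x - Real.pi) := by
      funext y; simp only [inv_mul_eq_div]
    have e := deriv_comp_sub_const (fun y => g (ε⁻¹ * y)) Real.pi x
    rw [this, e, deriv_comp_mul_left, smul_eq_mul, div_eq_mul_inv k, mul_assoc, div_eq_inv_mul]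
  set f : ℝ → ℝ := fun x => ε ^ 2 * φ ((x - Real.pi) / ε) with hf
  have hfz : ∀ x, x ∉ Icc (Real.pi - ε * B) (Real.pi + ε * B) → f x = 0 := fun x hx => by
    simp only [hf, hz hA x hx, mul_zero]
  have hfs : ContDiff ℝ ∞ f := by
    have : ContDiff ℝ ∞ fun x : ℝ => (x - Real.pi) / ε :=
      (contDiff_id.sub contDiff_const).div_const ε
    exact contDiff_const.mul (hs.comp this)
  have hf1 : deriv f = fun x => ε * deriv φ ((x - Real.pi) / ε) := by
    rw [hf, dsc]
    funext x
    field_simp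
  have hf2 : deriv (deriv f) = fun x => deriv (deriv φ) ((x - Real.pi) / ε) := by
    rw [hf1, dsc]
    funext x
    field_simp
  have hU1 : deriv (periodize (2 * Real.pi) f)
      = periodize (2 * Real.pi) fun x => ε * deriv φ ((x - Real.pi) / ε) := by
    rw [deriv_periodize hT hp hq hfz, hf1]
  have hU2 : deriv (deriv (periodize (2 * Real.pi) f))
      = periodize (2 * Real.pi) fun x => deriv (deriv φ) ((x - Real.pi) / ε) := by
    rw [deriv_periodize hT hp hq hfz, deriv_periodize hT hp hq (deriv_eq_zero_of_notMem hfz), hf2]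
  have hint : ∀ g : ℝ → ℝ, (∀ x, A < |x| → g x = 0) →
      ∫ θ in Ioc 0 (2 * Real.pi), periodize (2 * Real.pi) (fun x => g ((x - Real.pi) / ε)) θ
        = ε * ∫ x, g x := by
    intro g hg
    rw [integral_periodize hT hp hq (hz hg), integral_comp_sub_div_eq g hε]
  refine ⟨periodize (2 * Real.pi) f, contDiff_periodize hT hp hq hfz hfs,
    periodize_periodic hT f, fun θ => mul_nonneg (sq_nonneg _) (h0 _), fun θ => ?_, fun θ => ?_,
    ?_, ?_, ?_, ?_⟩
  · have := (le_abs_self _).trans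
      (hC₀ ((2 * Real.pi * Int.fract (θ / (2 * Real.pi)) - Real.pi) / ε))
    have := mul_le_mul_of_nonneg_left (this.trans (le_max_left C₀ C₁)) (sq_nonneg ε)
    simp only [periodize, hf]
    linarith
  · rw [hU1]
    simp only [periodize]
    rw [abs_mul, abs_of_pos hε, mul_comm]
    exact mul_le_mul_of_nonneg_right ((hC₁ _).trans (le_max_right _ _)) hε.le
  · have e := hint (fun y => ε ^ 2 * φ y) fun x hx => by simp [hA x hx]
    rw [integral_const_mul] at e
    calc _ = ε * (ε ^ 2 * ∫ x, φ x) := e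
      _ = _ := by ring
  · rw [hU1]
    have e := hint (fun y => ε ^ 2 * ((deriv φ y) ^ 2 / 2)) fun x hx => by simp [hdz hA x hx]
    rw [integral_const_mul] at e
    calc _ = ∫ θ in Ioc 0 (2 * Real.pi), periodize (2 * Real.pi)
          (fun x => (fun y => ε ^ 2 * ((deriv φ y) ^ 2 / 2)) ((x - Real.pi) / ε)) θ := by
          congr 1; funext θ; simp only [periodize]; ring
      _ = ε * (ε ^ 2 * ∫ x, (deriv φ x) ^ 2 / 2) := e
      _ = _ := by ring
  · rw [hU2]
    exact hint (fun y => (deriv (deriv φ) y) ^ 2) fun x hx => by simp [hdz (hdz hA) x hx]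
  · have hsub : {θ | 0 < periodize (2 * Real.pi) f θ} ∩ Ico 0 (2 * Real.pi)
        ⊆ (fun x => x - Real.pi) ⁻¹' ((fun x => ε⁻¹ * x) ⁻¹' {x | 0 < φ x}) := by
      rintro θ ⟨h1, h2⟩
      have h1 : 0 < periodize (2 * Real.pi) f θ := h1
      rw [periodize_eq hT f h2] at h1
      have h3 : 0 < φ ((θ - Real.pi) / ε) := (mul_pos_iff_of_pos_left (by positivity)).1 h1
      simpa [inv_mul_eq_div] using h3
    have hfin : volume {x | 0 < φ x} ≠ ⊤ := by
      refine ((measure_mono ?_).trans_lt hc.isCompact.measure_lt_top).ne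
      exact fun x hx => subset_tsupport _ (ne_of_gt hx)
    have hvol : volume ((fun x => x - Real.pi) ⁻¹' ((fun x => ε⁻¹ * x) ⁻¹' {x | 0 < φ x}))
        = ENNReal.ofReal ε * volume {x | 0 < φ x} := by
      simp only [sub_eq_add_neg]
      rw [measure_preimage_add_right, Real.volume_preimage_mul_left (inv_ne_zero hε.ne'), inv_inv,
        abs_of_pos hε]
    have := ENNReal.toReal_mono (by rw [hvol]; exact ENNReal.mul_ne_top ENNReal.ofReal_ne_top hfin)
      (measure_mono hsub)
    rwa [hvol, ENNReal.toReal_mul, ENNReal.toReal_ofReal hε.le] at this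

/-! ### Curves with prescribed radial defect -/

/-- The conditions on a radial defect `u` under which the curve of speed `c` with
`|γ|² = 1 - 2 u` is smooth and turns strictly around the origin. -/
structure IsRadialDefect (c : ℝ) (u : ℝ → ℝ) : Prop where
  one_le : 1 ≤ c
  contDiff : ContDiff ℝ ∞ u
  periodic : Function.Periodic u (2 * Real.pi)
  nonneg : ∀ θ, 0 ≤ u θ
  le : ∀ θ, u θ ≤ 1 / 8
  slope_le : ∀ θ, |deriv u θ| ≤ 1 / 4

/-- `⟨γ', iγ⟩` for a curve of speed `c` with radial defect `u`. -/
def tangential (c : ℝ) (u : ℝ → ℝ) (θ : ℝ) : ℝ :=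
  Real.sqrt (c ^ 2 * (1 - 2 * u θ) - (deriv u θ) ^ 2)

/-- The polar angle of the curve of speed `c` with radial defect `u`. -/
def polarAngle (c : ℝ) (u : ℝ → ℝ) (θ : ℝ) : ℝ :=
  ∫ t in (0 : ℝ)..θ, tangential c u t / (1 - 2 * u t)

/-- The curve of speed `c` with radial defect `u`, starting on the positive real axis. -/
def polarCurve (c : ℝ) (u : ℝ → ℝ) (θ : ℝ) : ℂ :=
  (Real.sqrt (1 - 2 * u θ) : ℂ) * Complex.exp (polarAngle c u θ * Complex.I)

/-- The derivative of `polarCurve`. -/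
def polarVelocity (c : ℝ) (u : ℝ → ℝ) (θ : ℝ) : ℂ :=
  Complex.exp (polarAngle c u θ * Complex.I) *
    ((-((deriv u θ : ℝ) : ℂ) + (tangential c u θ : ℂ) * Complex.I) / (Real.sqrt (1 - 2 * u θ) : ℂ))

/-- The second derivative of `polarCurve`: it is normal to the velocity, and its size is determined
by `⟨γ, γ''⟩ = -(c² + u'')`. -/
def polarAcceleration (c : ℝ) (u : ℝ → ℝ) (θ : ℝ) : ℂ :=
  Complex.I * polarVelocity c u θ *
    (((c ^ 2 + deriv (deriv u) θ : ℝ) : ℂ) / (tangential c u θ : ℂ))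

lemma contDiff_deriv_of_smooth {f : ℝ → ℝ} (h : ContDiff ℝ ∞ f) : ContDiff ℝ ∞ (deriv f) :=
  (contDiff_succ_iff_deriv.1 (show ContDiff ℝ (∞ + 1) f from h)).2.2

/-- The algebraic identity behind the formula for `polarAcceleration`. -/
lemma polarAcceleration_identity {E r s v w c : ℂ} (hr : r ≠ 0) (hs : s ≠ 0)
    (h : s ^ 2 = c ^ 2 * r ^ 2 - v ^ 2) :
    E * (s / r ^ 2 * Complex.I) * ((-v + s * Complex.I) / r)
      + E * (((-w + (c ^ 2 * (-2 * v) - 2 * v * w) / (2 * s) * Complex.I) * r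
        - (-v + s * Complex.I) * (-2 * v / (2 * r))) / r ^ 2)
      = Complex.I * (E * ((-v + s * Complex.I) / r)) * ((c ^ 2 + w) / s) := by
  have h2 := Complex.I_sq
  field_simp
  linear_combination (-s * E) * h
    + E * (s ^ 3 - s * c ^ 2 * r ^ 2 - s * w * r ^ 2) * h2

namespace IsRadialDefect

variable {c : ℝ} {u : ℝ → ℝ} (h : IsRadialDefect c u)
include h

lemma rho_ge (θ : ℝ) : 3 / 4 ≤ 1 - 2 * u θ := by linarith [h.le θ]

lemma rho_pos (θ : ℝ) : 0 < 1 - 2 * u θ := by linarith [h.rho_ge θ]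

lemma slope_sq_le (θ : ℝ) : deriv u θ ^ 2 ≤ 1 / 16 := by
  have := sq_le_sq' (abs_le.1 (h.slope_le θ)).1 (abs_le.1 (h.slope_le θ)).2
  norm_num at this ⊢
  exact this

lemma radicand_pos (θ : ℝ) : 0 < c ^ 2 * (1 - 2 * u θ) - (deriv u θ) ^ 2 := by
  have h1 := h.slope_sq_le θ
  have h2 := h.rho_ge θ
  have h3 : 1 ≤ c ^ 2 := one_le_pow₀ h.one_le
  nlinarith

lemma tangential_pos (θ : ℝ) : 0 < tangential c u θ := Real.sqrt_pos.2 (h.radicand_pos θ)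

lemma tangential_sq (θ : ℝ) :
    tangential c u θ ^ 2 = c ^ 2 * (1 - 2 * u θ) - (deriv u θ) ^ 2 :=
  Real.sq_sqrt (h.radicand_pos θ).le

lemma contDiff_tangential : ContDiff ℝ ∞ (tangential c u) := by
  have h1 := h.contDiff
  have h2 := contDiff_deriv_of_smooth h1
  exact ContDiff.sqrt (by fun_prop) fun θ => (h.radicand_pos θ).ne'

lemma contDiff_angularSpeed : ContDiff ℝ ∞ fun θ => tangential c u θ / (1 - 2 * u θ) := by
  have h1 := h.contDiff
  exact h.contDiff_tangential.div (by fun_prop) fun θ => (h.rho_pos θ).ne'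

lemma hasDerivAt_polarAngle (θ : ℝ) :
    HasDerivAt (polarAngle c u) (tangential c u θ / (1 - 2 * u θ)) θ :=
  have hc := h.contDiff_angularSpeed.continuous
  intervalIntegral.integral_hasDerivAt_right (hc.intervalIntegrable _ _)
    (hc.stronglyMeasurableAtFilter _ _) hc.continuousAt

lemma contDiff_polarAngle : ContDiff ℝ ∞ (polarAngle c u) := by
  have : ContDiff ℝ (∞ + 1) (polarAngle c u) := by
    refine contDiff_succ_iff_deriv.2 ⟨fun θ => (h.hasDerivAt_polarAngle θ).differentiableAt,
      by simp, ?_⟩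
    rw [show deriv (polarAngle c u) = _ from funext fun θ => (h.hasDerivAt_polarAngle θ).deriv]
    exact h.contDiff_angularSpeed
  exact this

lemma contDiff_polarCurve : ContDiff ℝ ∞ (polarCurve c u) := by
  have h1 := h.contDiff
  have h2 : ContDiff ℝ ∞ fun θ => Real.sqrt (1 - 2 * u θ) :=
    ContDiff.sqrt (by fun_prop) fun θ => (h.rho_pos θ).ne'
  have h3 := h.contDiff_polarAngle
  have h4 : ContDiff ℝ ∞ fun θ => ((Real.sqrt (1 - 2 * u θ) : ℝ) : ℂ) :=
    Complex.ofRealCLM.contDiff.comp h2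
  have h5 : ContDiff ℝ ∞ fun θ => ((polarAngle c u θ : ℝ) : ℂ) :=
    Complex.ofRealCLM.contDiff.comp h3
  exact h4.mul (h5.mul contDiff_const).cexp

lemma hasDerivAt_u (θ : ℝ) : HasDerivAt u (deriv u θ) θ :=
  (h.contDiff.differentiable (by simp) θ).hasDerivAt

lemma hasDerivAt_deriv_u (θ : ℝ) : HasDerivAt (deriv u) (deriv (deriv u) θ) θ :=
  ((contDiff_deriv_of_smooth h.contDiff).differentiable (by simp) θ).hasDerivAt

lemma hasDerivAt_radius (θ : ℝ) : HasDerivAt (fun θ => (Real.sqrt (1 - 2 * u θ) : ℂ))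
    (-2 * ((deriv u θ : ℝ) : ℂ) / (2 * (Real.sqrt (1 - 2 * u θ) : ℂ))) θ := by
  have := (((h.hasDerivAt_u θ).const_mul 2).const_sub 1).sqrt (h.rho_pos θ).ne'
  refine this.ofReal_comp.congr_deriv ?_
  push_cast
  ring

lemma hasDerivAt_phase (θ : ℝ) : HasDerivAt (fun θ => Complex.exp (polarAngle c u θ * Complex.I))
    (Complex.exp (polarAngle c u θ * Complex.I) *
      ((tangential c u θ : ℂ) / (Real.sqrt (1 - 2 * u θ) : ℂ) ^ 2 * Complex.I)) θ := by
  have := ((h.hasDerivAt_polarAngle θ).ofReal_comp.mul_const Complex.I).cexp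
  refine this.congr_deriv ?_
  rw [← Complex.ofReal_pow, Real.sq_sqrt (h.rho_pos θ).le]
  push_cast
  ring

lemma radius_ne_zero (θ : ℝ) : (Real.sqrt (1 - 2 * u θ) : ℂ) ≠ 0 :=
  Complex.ofReal_ne_zero.2 (Real.sqrt_pos.2 (h.rho_pos θ)).ne'

lemma hasDerivAt_polarCurve (θ : ℝ) : HasDerivAt (polarCurve c u) (polarVelocity c u θ) θ := by
  refine ((h.hasDerivAt_radius θ).mul (h.hasDerivAt_phase θ)).congr_deriv ?_
  have := h.radius_ne_zero θ
  unfold polarVelocity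
  field_simp

lemma hasDerivAt_polarVelocity (θ : ℝ) :
    HasDerivAt (polarVelocity c u) (polarAcceleration c u θ) θ := by
  have hs : HasDerivAt (tangential c u)
      ((c ^ 2 * (-2 * deriv u θ) - 2 * deriv u θ * deriv (deriv u) θ)
        / (2 * tangential c u θ)) θ := by
    have := ((((h.hasDerivAt_u θ).const_mul 2).const_sub 1).const_mul (c ^ 2)).sub
      ((h.hasDerivAt_deriv_u θ).pow 2)
    refine (this.sqrt (h.radicand_pos θ).ne').congr_deriv ?_
    simp only [tangential]
    congr 1
    push_cast
    ring
  have hN : HasDerivAt (fun θ => -((deriv u θ : ℝ) : ℂ) + (tangential c u θ : ℂ) * Complex.I)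
      (-((deriv (deriv u) θ : ℝ) : ℂ)
        + ((c ^ 2 * (-2 * deriv u θ) - 2 * deriv u θ * deriv (deriv u) θ)
        / (2 * tangential c u θ) : ℝ) * Complex.I) θ :=
    (h.hasDerivAt_deriv_u θ).ofReal_comp.neg.add (hs.ofReal_comp.mul_const Complex.I)
  refine ((h.hasDerivAt_phase θ).mul (hN.div (h.hasDerivAt_radius θ)
    (h.radius_ne_zero θ))).congr_deriv ?_
  have hsq : (tangential c u θ : ℂ) ^ 2
      = (c : ℂ) ^ 2 * (Real.sqrt (1 - 2 * u θ) : ℂ) ^ 2 - ((deriv u θ : ℝ) : ℂ) ^ 2 := by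
    rw [← Complex.ofReal_pow (Real.sqrt _), Real.sq_sqrt (h.rho_pos θ).le,
      ← Complex.ofReal_pow (tangential c u θ), h.tangential_sq]
    push_cast
    ring
  have := polarAcceleration_identity (E := Complex.exp (polarAngle c u θ * Complex.I))
    (w := ((deriv (deriv u) θ : ℝ) : ℂ)) (h.radius_ne_zero θ)
    (Complex.ofReal_ne_zero.2 (h.tangential_pos θ).ne') hsq
  unfold polarAcceleration polarVelocity
  push_cast at this ⊢
  exact this

lemma deriv_polarCurve : deriv (polarCurve c u) = polarVelocity c u :=
  funext fun θ => (h.hasDerivAt_polarCurve θ).deriv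

lemma deriv_polarVelocity : deriv (polarVelocity c u) = polarAcceleration c u :=
  funext fun θ => (h.hasDerivAt_polarVelocity θ).deriv

lemma norm_sq_polarCurve (θ : ℝ) : ‖polarCurve c u θ‖ ^ 2 = 1 - 2 * u θ := by
  rw [polarCurve, norm_mul, Complex.norm_exp_ofReal_mul_I, mul_one, Complex.norm_real,
    Real.norm_eq_abs, sq_abs, Real.sq_sqrt (h.rho_pos θ).le]

lemma norm_polarCurve_le (θ : ℝ) : ‖polarCurve c u θ‖ ≤ 1 := by
  have h1 := h.norm_sq_polarCurve θ
  have h2 := h.nonneg θ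
  nlinarith [norm_nonneg (polarCurve c u θ)]

lemma norm_polarVelocity (θ : ℝ) : ‖polarVelocity c u θ‖ = c := by
  have hc : 0 ≤ c := by linarith [h.one_le]
  have h1 : ‖-((deriv u θ : ℝ) : ℂ) + (tangential c u θ : ℂ) * Complex.I‖ ^ 2
      = c ^ 2 * (1 - 2 * u θ) := by
    rw [← Complex.normSq_eq_norm_sq, ← Complex.ofReal_neg, Complex.normSq_add_mul_I,
      h.tangential_sq]
    ring
  have h2 : ‖polarVelocity c u θ‖ ^ 2 = c ^ 2 := by
    rw [polarVelocity, norm_mul, Complex.norm_exp_ofReal_mul_I, one_mul, norm_div, div_pow, h1,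
      Complex.norm_real, Real.norm_eq_abs, sq_abs, Real.sq_sqrt (h.rho_pos θ).le]
    have := (h.rho_pos θ).ne'
    field_simp
  exact (pow_left_inj₀ (norm_nonneg _) hc two_ne_zero).1 h2

lemma norm_sq_polarAcceleration (θ : ℝ) : ‖polarAcceleration c u θ‖ ^ 2
    = c ^ 2 * (c ^ 2 + deriv (deriv u) θ) ^ 2 / (c ^ 2 * (1 - 2 * u θ) - (deriv u θ) ^ 2) := by
  rw [polarAcceleration, norm_mul, norm_mul, Complex.norm_I, one_mul, h.norm_polarVelocity,
    norm_div, Complex.norm_real, Complex.norm_real, Real.norm_eq_abs, Real.norm_eq_abs, mul_pow,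
    div_pow, sq_abs, sq_abs, h.tangential_sq]
  ring

lemma strictMono_polarAngle : StrictMono (polarAngle c u) :=
  strictMono_of_deriv_pos fun θ => by
    rw [(h.hasDerivAt_polarAngle θ).deriv]
    exact div_pos (h.tangential_pos θ) (h.rho_pos θ)

lemma polarAngle_add (hclosed : polarAngle c u (2 * Real.pi) = 2 * Real.pi) (θ : ℝ) :
    polarAngle c u (θ + 2 * Real.pi) = polarAngle c u θ + 2 * Real.pi := by
  have hc := h.contDiff_angularSpeed.continuous
  have hper : Function.Periodic (fun θ => tangential c u θ / (1 - 2 * u θ)) (2 * Real.pi) :=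
    fun θ => by simp only [tangential, h.periodic θ, periodic_deriv h.periodic θ]
  have h1 := hper.intervalIntegral_add_eq θ 0
  rw [zero_add] at h1
  have h2 : ∫ t in (0 : ℝ)..2 * Real.pi, tangential c u t / (1 - 2 * u t) = 2 * Real.pi := hclosed
  have h3 := intervalIntegral.integral_add_adjacent_intervals (μ := volume)
    (hc.intervalIntegrable 0 θ) (hc.intervalIntegrable θ (θ + 2 * Real.pi))
  unfold polarAngle
  rw [← h3, h1, h2]

lemma periodic_polarCurve (hclosed : polarAngle c u (2 * Real.pi) = 2 * Real.pi) :
    Function.Periodic (polarCurve c u) (2 * Real.pi) := fun θ => by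
  have : Complex.exp (2 * (Real.pi : ℂ) * Complex.I) = 1 := Complex.exp_two_pi_mul_I
  simp only [polarCurve, h.periodic θ, h.polarAngle_add hclosed θ]
  push_cast
  rw [add_mul, Complex.exp_add, this, mul_one]

lemma polarAngle_mem (hclosed : polarAngle c u (2 * Real.pi) = 2 * Real.pi) {θ : ℝ}
    (hθ : θ ∈ Ico 0 (2 * Real.pi)) : polarAngle c u θ ∈ Ico 0 (2 * Real.pi) := by
  have h0 : polarAngle c u 0 = 0 := by simp [polarAngle]
  constructor
  · rw [← h0]; exact h.strictMono_polarAngle.monotone hθ.1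
  · rw [← hclosed]; exact h.strictMono_polarAngle hθ.2

lemma injOn_polarCurve (hclosed : polarAngle c u (2 * Real.pi) = 2 * Real.pi) :
    InjOn (polarCurve c u) (Ico 0 (2 * Real.pi)) := by
  intro x hx y hy hxy
  have hn : Real.sqrt (1 - 2 * u x) = Real.sqrt (1 - 2 * u y) := by
    have := congrArg norm hxy
    simpa [polarCurve, Complex.norm_exp_ofReal_mul_I, abs_of_nonneg (Real.sqrt_nonneg _)]
      using this
  have he : Complex.exp (polarAngle c u x * Complex.I)
      = Complex.exp (polarAngle c u y * Complex.I) := by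
    simp only [polarCurve, hn] at hxy
    exact mul_left_cancel₀ (h.radius_ne_zero y) hxy
  obtain ⟨n, hn⟩ := Complex.exp_eq_exp_iff_exists_int.1 he
  have hreal : polarAngle c u x = polarAngle c u y + n * (2 * Real.pi) := by
    have := congrArg Complex.im hn
    simpa using this
  have hX := h.polarAngle_mem hclosed hx
  have hY := h.polarAngle_mem hclosed hy
  have hpi := Real.two_pi_pos
  have hn0 : n = 0 := by
    have h1 : (n : ℝ) < 1 := by
      by_contra hcon
      nlinarith [hX.1, hX.2, hY.1, hY.2]
    have h2 : (-1 : ℝ) < n := by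
      by_contra hcon
      nlinarith [hX.1, hX.2, hY.1, hY.2]
    have h1' : n < 1 := by exact_mod_cast h1
    have h2' : -1 < n := by exact_mod_cast h2
    omega
  rw [hn0] at hreal
  exact h.strictMono_polarAngle.injective (by simpa using hreal)

end IsRadialDefect

lemma isW22_of_contDiff {γ : ℝ → ℂ} (h : ContDiff ℝ ∞ γ)
    (hp : Function.Periodic γ (2 * Real.pi)) : IsW22 γ := by
  have hdd := continuous_deriv_deriv h
  have hd : Differentiable ℝ (deriv γ) :=
    (contDiff_succ_iff_deriv.1 (show ContDiff ℝ (∞ + 1) γ from h)).2.2.differentiable (by simp)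
  refine ⟨hp, h.of_le (by simp), ?_, fun a b => ?_⟩
  · have : IsFiniteMeasure periodMeasure := by unfold periodMeasure; infer_instance
    obtain ⟨C, hC⟩ := isCompact_Icc.exists_bound_of_continuousOn
      (hdd.continuousOn (s := Icc 0 (2 * Real.pi)))
    refine MemLp.of_bound hdd.aestronglyMeasurable C ?_
    filter_upwards [ae_restrict_mem measurableSet_Ioc] with x hx using hC x (Ioc_subset_Icc_self hx)
  · exact (intervalIntegral.integral_deriv_eq_sub (fun x _ => hd x)
      (hdd.intervalIntegrable _ _)).symm

namespace IsRadialDefect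

variable {c : ℝ} {u : ℝ → ℝ} (h : IsRadialDefect c u)
include h

lemma isConfinedCurve (hclosed : polarAngle c u (2 * Real.pi) = 2 * Real.pi) :
    IsConfinedCurve c (polarCurve c u) :=
  ⟨isW22_of_contDiff h.contDiff_polarCurve (h.periodic_polarCurve hclosed), h.norm_polarCurve_le,
    fun θ => by rw [h.deriv_polarCurve, h.norm_polarVelocity]⟩

/-- The energy exceeds that of the circle of the same length by at most `∫ |u''|²`, up to a factor
close to one. -/
lemma elasticEnergy_polarCurve_le (hclosed : polarAngle c u (2 * Real.pi) = 2 * Real.pi) {κ : ℝ}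
    (hκ1 : κ < 1) (hκ : ∀ θ, 2 * u θ + deriv u θ ^ 2 ≤ κ) :
    elasticEnergy (polarCurve c u)
      ≤ (2 * Real.pi * c + ∫ θ in Ioc 0 (2 * Real.pi), (deriv (deriv u) θ) ^ 2) / (1 - κ) := by
  have hc1 := h.one_le
  have hc0 : 0 < c := by linarith
  have hκ' : 0 < 1 - κ := by linarith
  have hw : Continuous (deriv (deriv u)) :=
    (contDiff_deriv_of_smooth (contDiff_deriv_of_smooth h.contDiff)).continuous
  have hint : ∀ {f : ℝ → ℝ}, Continuous f → IntegrableOn f (Ioc 0 (2 * Real.pi)) := fun hf =>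
    hf.integrableOn_Icc.mono_set Ioc_subset_Icc_self
  rw [(h.isConfinedCurve hclosed).elasticEnergy_eq, h.deriv_polarCurve, h.deriv_polarVelocity]
  have hw0 : ∫ θ in Ioc 0 (2 * Real.pi), deriv (deriv u) θ = 0 := by
    rw [← intervalIntegral.integral_of_le Real.two_pi_pos.le,
      intervalIntegral.integral_eq_sub_of_hasDerivAt (fun θ _ => h.hasDerivAt_deriv_u θ)
        (hw.intervalIntegrable _ _)]
    have := periodic_deriv h.periodic 0
    rw [zero_add] at this
    rw [this, sub_self]
  have e1 : ∫ θ in Ioc 0 (2 * Real.pi), (c ^ 2 + deriv (deriv u) θ) ^ 2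
      = 2 * Real.pi * c ^ 4 + ∫ θ in Ioc 0 (2 * Real.pi), (deriv (deriv u) θ) ^ 2 := by
    have : (fun θ => (c ^ 2 + deriv (deriv u) θ) ^ 2)
        = fun θ => c ^ 4 + (2 * c ^ 2 * deriv (deriv u) θ + (deriv (deriv u) θ) ^ 2) := by
      funext θ; ring
    rw [this, integral_add (hint continuous_const) (hint (by fun_prop)),
      integral_add (hint (by fun_prop)) (hint (by fun_prop)), integral_const_mul, hw0]
    simp [Real.pi_pos.le]
  set J := ∫ θ in Ioc 0 (2 * Real.pi), (deriv (deriv u) θ) ^ 2 with hJ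
  have hJ0 : 0 ≤ J := integral_nonneg fun θ => sq_nonneg _
  have e2 : ∫ θ in Ioc 0 (2 * Real.pi), ‖polarAcceleration c u θ‖ ^ 2
      ≤ (2 * Real.pi * c ^ 4 + J) / (1 - κ) := by
    rw [← e1, ← integral_div]
    refine integral_mono_of_nonneg (Eventually.of_forall fun θ => sq_nonneg _)
      (hint (by fun_prop)) (Eventually.of_forall fun θ => ?_)
    dsimp only
    rw [h.norm_sq_polarAcceleration, div_le_div_iff₀ (h.radicand_pos θ) hκ']
    have h1 : c ^ 2 * (1 - κ) ≤ c ^ 2 * (1 - 2 * u θ) - (deriv u θ) ^ 2 := by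
      have h2 := mul_le_mul_of_nonneg_left (hκ θ) (sq_nonneg c)
      have h3 : deriv u θ ^ 2 ≤ c ^ 2 * deriv u θ ^ 2 :=
        le_mul_of_one_le_left (sq_nonneg _) (one_le_pow₀ hc1)
      linarith
    have := mul_le_mul_of_nonneg_left h1 (sq_nonneg (c ^ 2 + deriv (deriv u) θ))
    linarith
  have e3 := mul_le_mul_of_nonneg_left e2 (by positivity : (0 : ℝ) ≤ c⁻¹ ^ 3)
  refine e3.trans ?_
  rw [← mul_div_assoc]
  refine div_le_div_of_nonneg_right ?_ hκ'.le
  have e4 : c⁻¹ ^ 3 * (2 * Real.pi * c ^ 4) = 2 * Real.pi * c := by field_simp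
  have e5 : c⁻¹ ^ 3 * J ≤ J :=
    mul_le_of_le_one_left hJ0 (pow_le_one₀ (by positivity) (inv_le_one_of_one_le₀ hc1))
  rw [mul_add, e4]
  linarith

/-- The part of the circle not covered by the curve is the radial projection of the detached
part. -/
lemma hausdorffMeasure_diff_polarCurve_le
    (hclosed : polarAngle c u (2 * Real.pi) = 2 * Real.pi) {κ : ℝ}
    (hκ1 : κ < 1) (hκ : ∀ θ, 2 * u θ ≤ κ) :
    (μH[1] (Metric.sphere (0 : ℂ) 1 \ range (polarCurve c u))).toReal
      ≤ c / (1 - κ) * (volume ({θ | 0 < u θ} ∩ Ico 0 (2 * Real.pi))).toReal := by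
  have hc0 : 0 ≤ c := by linarith [h.one_le]
  have hκ' : 0 < 1 - κ := by linarith
  have hq : 0 ≤ c / (1 - κ) := by positivity
  have hlip : LipschitzWith (c / (1 - κ)).toNNReal (polarAngle c u) := by
    refine lipschitzWith_of_nnnorm_deriv_le
      (fun θ => (h.hasDerivAt_polarAngle θ).differentiableAt) fun θ => ?_
    rw [← NNReal.coe_le_coe, coe_nnnorm, (h.hasDerivAt_polarAngle θ).deriv,
      Real.coe_toNNReal _ hq, Real.norm_eq_abs,
      abs_of_pos (div_pos (h.tangential_pos θ) (h.rho_pos θ))]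
    refine div_le_div₀ hc0 ?_ hκ' (by linarith [hκ θ])
    refine Real.sqrt_le_iff.2 ⟨hc0, ?_⟩
    have := mul_nonneg (sq_nonneg c) (h.nonneg θ)
    nlinarith [sq_nonneg (deriv u θ)]
  have hlip2 := lipschitzWith_exp_mul_I.comp hlip
  have hcont : Continuous (polarAngle c u) := h.contDiff_polarAngle.continuous
  set S := {θ | 0 < u θ} ∩ Ico 0 (2 * Real.pi) with hS
  have hsub : Metric.sphere (0 : ℂ) 1 \ range (polarCurve c u)
      ⊆ ((fun t : ℝ => Complex.exp (t * Complex.I)) ∘ polarAngle c u) '' S := by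
    rintro z ⟨hz, hzr⟩
    have hz1 : z = Complex.exp (z.arg * Complex.I) := by
      have := Complex.norm_mul_exp_arg_mul_I z
      rw [mem_sphere_zero_iff_norm.1 hz] at this
      simpa using this.symm
    -- a representative of the argument in `[0, 2π)`
    obtain ⟨s, hs, hzs⟩ : ∃ s ∈ Ico 0 (2 * Real.pi), z = Complex.exp ((s : ℝ) * Complex.I) := by
      have hper : Function.Periodic (fun t : ℝ => Complex.exp (t * Complex.I)) (2 * Real.pi) := by
        intro t
        have : Complex.exp (2 * (Real.pi : ℂ) * Complex.I) = 1 := Complex.exp_two_pi_mul_I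
        push_cast
        rw [add_mul, Complex.exp_add, this, mul_one]
      obtain ⟨s, hs, hs'⟩ := hper.exists_mem_Ico₀ Real.two_pi_pos z.arg
      exact ⟨s, hs, hz1.trans hs'⟩
    have h0 : polarAngle c u 0 = 0 := by simp [polarAngle]
    obtain ⟨θ, hθ, hθs⟩ := intermediate_value_Ico Real.two_pi_pos.le hcont.continuousOn
      (show s ∈ Ico (polarAngle c u 0) (polarAngle c u (2 * Real.pi)) by rw [h0, hclosed]; exact hs)
    refine ⟨θ, ⟨lt_of_le_of_ne (h.nonneg θ) fun hu => hzr ⟨θ, ?_⟩, hθ⟩, ?_⟩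
    · rw [polarCurve, ← hu, hθs, hzs]
      simp
    · simp only [Function.comp, hθs, hzs]
  have hSfin : volume S ≠ ⊤ := ((measure_mono inter_subset_right).trans_lt measure_Ico_lt_top).ne
  have h1 := (measure_mono hsub).trans (hlip2.hausdorffMeasure_image_le zero_le_one S)
  rw [hausdorffMeasure_real, ENNReal.rpow_one, one_mul] at h1
  have h2 := ENNReal.toReal_mono (ENNReal.mul_ne_top ENNReal.coe_ne_top hSfin) h1
  rwa [ENNReal.toReal_mul, ENNReal.coe_toReal, Real.coe_toNNReal _ hq] at h2

end IsRadialDefect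

/-! ### Closing the curve and approximating it from inside -/

lemma weakL2Tendsto_of_bounded {f : ℕ → ℝ → ℂ} {g : ℝ → ℂ} {C : ℝ} (hf : ∀ n, Continuous (f n))
    (hC : ∀ n θ, ‖f n θ‖ ≤ C) (hlim : ∀ θ, Tendsto (fun n => f n θ) atTop (𝓝 (g θ))) :
    WeakL2Tendsto f g := by
  intro k hk
  have : IsFiniteMeasure periodMeasure := by unfold periodMeasure; infer_instance
  have hki : Integrable k periodMeasure := hk.integrable (by norm_num)
  refine tendsto_integral_of_dominated_convergence (fun θ => C * ‖k θ‖) (fun n => ?_)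
    (hki.norm.const_mul C) (fun n => Eventually.of_forall fun θ => ?_)
    (Eventually.of_forall fun θ => (hlim θ).inner tendsto_const_nhds)
  · exact (hf n).aestronglyMeasurable.inner hki.1
  · exact (norm_inner_le_norm _ _).trans (mul_le_mul_of_nonneg_right (hC n θ) (norm_nonneg _))

/-- A smooth periodic function all of whose multiples by amplitudes in `[1/2, 3/2]` are admissible
radial defects. -/
structure IsBumpShape (U : ℝ → ℝ) : Prop where
  contDiff : ContDiff ℝ ∞ U
  periodic : Function.Periodic U (2 * Real.pi)
  nonneg : ∀ θ, 0 ≤ U θ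
  le : ∀ θ, U θ ≤ 1 / 16
  slope_le : ∀ θ, |deriv U θ| ≤ 1 / 8

lemma deriv_amplitude (U : ℝ → ℝ) (a : ℝ) :
    deriv (fun θ => a * U θ) = fun θ => a * deriv U θ := by
  funext θ; rw [deriv_const_mul_field]

lemma tendsto_radius {U : ℝ → ℝ} {A : ℕ → ℝ} {a : ℝ} (hAa : Tendsto A atTop (𝓝 a)) (θ : ℝ) :
    Tendsto (fun n => ((Real.sqrt (1 - 2 * (A n * U θ)) : ℝ) : ℂ)) atTop
      (𝓝 ((Real.sqrt (1 - 2 * (a * U θ)) : ℝ) : ℂ)) :=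
  (Complex.continuous_ofReal.tendsto _).comp ((Real.continuous_sqrt.tendsto _).comp
    (((hAa.mul_const _).const_mul _).const_sub _))

lemma tendsto_tangential {U : ℝ → ℝ} {A C : ℕ → ℝ} {a c : ℝ} (hAa : Tendsto A atTop (𝓝 a))
    (hCc : Tendsto C atTop (𝓝 c)) (θ : ℝ) :
    Tendsto (fun n => ((tangential (C n) (fun t => A n * U t) θ : ℝ) : ℂ)) atTop
      (𝓝 ((tangential c (fun t => a * U t) θ : ℝ) : ℂ)) := by
  refine (Complex.continuous_ofReal.tendsto _).comp ?_
  simp only [tangential, deriv_amplitude]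
  exact (Real.continuous_sqrt.tendsto _).comp
    (((hCc.pow 2).mul (((hAa.mul_const _).const_mul _).const_sub _)).sub ((hAa.mul_const _).pow 2))

lemma IsRadialDefect.shrunk_mem_curveClass {u : ℝ → ℝ} {C k : ℝ} (hR : IsRadialDefect C u)
    (hk0 : 0 < k) (hk1 : k < 1) (hcl : polarAngle C u (2 * Real.pi) = 2 * Real.pi) :
    (fun θ => (k : ℂ) * polarCurve C u θ) ∈ curveClass (2 * Real.pi * (k * C)) := by
  have hkn : ‖(k : ℂ)‖ = k := by rw [Complex.norm_real, Real.norm_eq_abs, abs_of_pos hk0]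
  refine ⟨fun θ => ?_, contDiff_const.mul hR.contDiff_polarCurve, fun θ => ?_, fun θ => ?_,
    fun x hx y hy hxy => ?_⟩
  · simp only [hR.periodic_polarCurve hcl θ]
  · rw [mem_ball_zero_iff, norm_mul, hkn]
    exact (mul_le_of_le_one_right hk0.le (hR.norm_polarCurve_le θ)).trans_lt hk1
  · rw [((hR.hasDerivAt_polarCurve θ).const_mul _).deriv, norm_mul, hkn, hR.norm_polarVelocity]
    field_simp
  · exact hR.injOn_polarCurve hcl hx hy
      (mul_left_cancel₀ (Complex.ofReal_ne_zero.2 hk0.ne') hxy)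

namespace IsBumpShape

variable {U : ℝ → ℝ} (h : IsBumpShape U)
include h

lemma isRadialDefect {a c : ℝ} (ha : a ∈ Icc (1 / 2 : ℝ) (3 / 2)) (hc : 1 ≤ c) :
    IsRadialDefect c fun θ => a * U θ where
  one_le := hc
  contDiff := contDiff_const.mul h.contDiff
  periodic := fun θ => by simp only [h.periodic θ]
  nonneg := fun θ => mul_nonneg (by linarith [ha.1]) (h.nonneg θ)
  le := fun θ => by
    have := mul_le_mul ha.2 (h.le θ) (h.nonneg θ) (by norm_num)
    linarith
  slope_le := fun θ => by
    rw [deriv_amplitude, abs_mul, abs_of_nonneg (by linarith [ha.1] : 0 ≤ a)]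
    have := mul_le_mul ha.2 (h.slope_le θ) (abs_nonneg _) (by norm_num)
    linarith

lemma continuousOn_polarAngle (θ : ℝ) :
    ContinuousOn (fun p : ℝ × ℝ => polarAngle p.2 (fun t => p.1 * U t) θ)
      (Icc (1 / 2 : ℝ) (3 / 2) ×ˢ univ) := by
  rw [continuousOn_iff_continuous_domRestrict]
  have hU := h.contDiff.continuous
  have hU' := (contDiff_deriv_of_smooth h.contDiff).continuous
  have hF : Continuous (Function.uncurry fun (p : ↥(Icc (1 / 2 : ℝ) (3 / 2) ×ˢ (univ : Set ℝ)))
      (t : ℝ) => Real.sqrt ((p : ℝ × ℝ).2 ^ 2 * (1 - 2 * ((p : ℝ × ℝ).1 * U t))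
        - ((p : ℝ × ℝ).1 * deriv U t) ^ 2) / (1 - 2 * ((p : ℝ × ℝ).1 * U t))) := by
    refine Continuous.div (by fun_prop) (by fun_prop) fun p => ?_
    exact ((h.isRadialDefect p.1.2.1 le_rfl).rho_pos p.2).ne'
  have := intervalIntegral.continuous_parametric_intervalIntegral_of_continuous (a₀ := 0)
    (μ := volume) hF (s := fun _ => θ) continuous_const
  refine this.congr fun p => ?_
  simp only [polarAngle, tangential, domRestrict_apply, deriv_amplitude]

lemma tendsto_polarAngle {A C : ℕ → ℝ} {a c : ℝ} (hA : ∀ n, A n ∈ Icc (1 / 2 : ℝ) (3 / 2))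
    (ha : a ∈ Icc (1 / 2 : ℝ) (3 / 2)) (hAa : Tendsto A atTop (𝓝 a))
    (hCc : Tendsto C atTop (𝓝 c)) (θ : ℝ) :
    Tendsto (fun n => polarAngle (C n) (fun t => A n * U t) θ) atTop
      (𝓝 (polarAngle c (fun t => a * U t) θ)) := by
  have hp : (a, c) ∈ Icc (1 / 2 : ℝ) (3 / 2) ×ˢ (univ : Set ℝ) := mk_mem_prod ha (mem_univ c)
  have h1 := (h.continuousOn_polarAngle θ).continuousWithinAt hp
  have h2 : Tendsto (fun n => (A n, C n)) atTop
      (𝓝[Icc (1 / 2 : ℝ) (3 / 2) ×ˢ univ] (a, c)) :=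
    tendsto_nhdsWithin_iff.2 ⟨hAa.prodMk_nhds hCc,
      Eventually.of_forall fun n => mk_mem_prod (hA n) (mem_univ _)⟩
  simpa only [Function.comp_def] using Tendsto.comp h1.tendsto h2

lemma tendsto_phase {A C : ℕ → ℝ} {a c : ℝ} (hA : ∀ n, A n ∈ Icc (1 / 2 : ℝ) (3 / 2))
    (ha : a ∈ Icc (1 / 2 : ℝ) (3 / 2)) (hAa : Tendsto A atTop (𝓝 a))
    (hCc : Tendsto C atTop (𝓝 c)) (θ : ℝ) :
    Tendsto (fun n => Complex.exp (polarAngle (C n) (fun t => A n * U t) θ * Complex.I)) atTop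
      (𝓝 (Complex.exp (polarAngle c (fun t => a * U t) θ * Complex.I))) :=
  (Complex.continuous_exp.tendsto _).comp
    (((Complex.continuous_ofReal.tendsto _).comp
      (h.tendsto_polarAngle hA ha hAa hCc θ)).mul_const _)

lemma tendsto_polarCurve {A C : ℕ → ℝ} {a c : ℝ} (hA : ∀ n, A n ∈ Icc (1 / 2 : ℝ) (3 / 2))
    (ha : a ∈ Icc (1 / 2 : ℝ) (3 / 2)) (hAa : Tendsto A atTop (𝓝 a))
    (hCc : Tendsto C atTop (𝓝 c)) (θ : ℝ) :
    Tendsto (fun n => polarCurve (C n) (fun t => A n * U t) θ) atTop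
      (𝓝 (polarCurve c (fun t => a * U t) θ)) :=
  (tendsto_radius hAa θ).mul (h.tendsto_phase hA ha hAa hCc θ)

lemma tendsto_polarVelocity {A C : ℕ → ℝ} {a c : ℝ} (hA : ∀ n, A n ∈ Icc (1 / 2 : ℝ) (3 / 2))
    (ha : a ∈ Icc (1 / 2 : ℝ) (3 / 2)) (hAa : Tendsto A atTop (𝓝 a)) (hc : 1 ≤ c)
    (hCc : Tendsto C atTop (𝓝 c)) (θ : ℝ) :
    Tendsto (fun n => polarVelocity (C n) (fun t => A n * U t) θ) atTop
      (𝓝 (polarVelocity c (fun t => a * U t) θ)) := by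
  have hder : Tendsto (fun n => ((deriv (fun t => A n * U t) θ : ℝ) : ℂ)) atTop
      (𝓝 ((deriv (fun t => a * U t) θ : ℝ) : ℂ)) := by
    simp only [deriv_amplitude]
    exact (Complex.continuous_ofReal.tendsto _).comp (hAa.mul_const _)
  exact (h.tendsto_phase hA ha hAa hCc θ).mul
    ((hder.neg.add ((tendsto_tangential hAa hCc θ).mul_const _)).div (tendsto_radius hAa θ)
      ((h.isRadialDefect ha hc).radius_ne_zero θ))

lemma tendsto_polarAcceleration {A C : ℕ → ℝ} {a c : ℝ}
    (hA : ∀ n, A n ∈ Icc (1 / 2 : ℝ) (3 / 2)) (ha : a ∈ Icc (1 / 2 : ℝ) (3 / 2))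
    (hAa : Tendsto A atTop (𝓝 a)) (hc : 1 ≤ c) (hCc : Tendsto C atTop (𝓝 c)) (θ : ℝ) :
    Tendsto (fun n => polarAcceleration (C n) (fun t => A n * U t) θ) atTop
      (𝓝 (polarAcceleration c (fun t => a * U t) θ)) := by
  have hder2 : Tendsto (fun n => ((C n ^ 2 + deriv (deriv fun t => A n * U t) θ : ℝ) : ℂ)) atTop
      (𝓝 ((c ^ 2 + deriv (deriv fun t => a * U t) θ : ℝ) : ℂ)) := by
    simp only [deriv_amplitude]
    exact (Complex.continuous_ofReal.tendsto _).comp ((hCc.pow 2).add (hAa.mul_const _))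
  exact ((h.tendsto_polarVelocity hA ha hAa hc hCc θ).const_mul _).mul
    (hder2.div (tendsto_tangential hAa hCc θ)
      (Complex.ofReal_ne_zero.2 ((h.isRadialDefect ha hc).tangential_pos θ).ne'))

lemma exists_bound_deriv_deriv : ∃ W, ∀ θ, |deriv (deriv U) θ| ≤ W := by
  have hUdd : Continuous (deriv (deriv U)) :=
    (contDiff_deriv_of_smooth (contDiff_deriv_of_smooth h.contDiff)).continuous
  obtain ⟨W, hW⟩ := isCompact_Icc.exists_bound_of_continuousOn
    (hUdd.continuousOn (s := Icc 0 (2 * Real.pi)))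
  have h2 := periodic_deriv (periodic_deriv h.periodic)
  refine ⟨W, fun θ => ?_⟩
  obtain ⟨y, hy, hθy⟩ := h2.exists_mem_Ico₀ Real.two_pi_pos θ
  rw [hθy]
  exact hW y (Ico_subset_Icc_self hy)

lemma exists_bound_polarAcceleration (R : ℝ) : ∃ B, ∀ a ∈ Icc (1 / 2 : ℝ) (3 / 2), ∀ c, 1 ≤ c →
    c ≤ R → ∀ θ, ‖polarAcceleration c (fun t => a * U t) θ‖ ≤ B := by
  obtain ⟨W, hW⟩ := h.exists_bound_deriv_deriv
  have hW0 : 0 ≤ W := (abs_nonneg _).trans (hW 0)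
  refine ⟨R * ((R ^ 2 + 3 / 2 * W) * 2), fun a ha c hc hcR θ => ?_⟩
  have hR := h.isRadialDefect ha hc
  have ht := hR.tangential_pos θ
  have e0 : ‖polarAcceleration c (fun t => a * U t) θ‖
      = c * (|c ^ 2 + a * deriv (deriv U) θ| / tangential c (fun t => a * U t) θ) := by
    rw [polarAcceleration, norm_mul, norm_mul, Complex.norm_I, one_mul, hR.norm_polarVelocity,
      norm_div, Complex.norm_real, Complex.norm_real, Real.norm_eq_abs, Real.norm_eq_abs,
      abs_of_pos ht]
    simp only [deriv_amplitude]
  have e1 : |c ^ 2 + a * deriv (deriv U) θ| ≤ R ^ 2 + 3 / 2 * W := by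
    refine (abs_add_le _ _).trans (add_le_add ?_ ?_)
    · rw [abs_of_nonneg (sq_nonneg _)]
      exact pow_le_pow_left₀ (by linarith) hcR 2
    · rw [abs_mul, abs_of_nonneg (by linarith [ha.1] : 0 ≤ a)]
      exact mul_le_mul ha.2 (hW θ) (abs_nonneg _) (by norm_num)
  have e2 : 1 / 2 ≤ tangential c (fun t => a * U t) θ := by
    have h1 := hR.slope_sq_le θ
    have h2 := hR.rho_ge θ
    have h3 : 1 ≤ c ^ 2 := one_le_pow₀ hc
    have h4 : 3 / 4 ≤ c ^ 2 * (1 - 2 * (a * U θ)) := by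
      have := mul_le_mul h3 h2 (by norm_num) (by positivity)
      linarith
    refine Real.le_sqrt_of_sq_le ?_
    linarith
  rw [e0]
  refine mul_le_mul hcR ?_ (by positivity) (by linarith)
  rw [div_le_iff₀ ht]
  have e3 := mul_le_mul_of_nonneg_left e2 (by positivity : 0 ≤ (R ^ 2 + 3 / 2 * W) * 2)
  linarith

/-- Along converging amplitudes and speeds, the closed curves, slightly shrunk, converge to the
closed limit curve. -/
lemma polarCurve_mem_closure {A C : ℕ → ℝ} {a c : ℝ} (hA : ∀ n, A n ∈ Icc (1 / 2 : ℝ) (3 / 2))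
    (ha : a ∈ Icc (1 / 2 : ℝ) (3 / 2)) (hAa : Tendsto A atTop (𝓝 a)) (hc : 1 ≤ c)
    (hC : ∀ n, c < C n) (hC1 : ∀ n, C n ≤ c + 1) (hCc : Tendsto C atTop (𝓝 c))
    (hcl : ∀ n, polarAngle (C n) (fun t => A n * U t) (2 * Real.pi) = 2 * Real.pi)
    (hcl' : polarAngle c (fun t => a * U t) (2 * Real.pi) = 2 * Real.pi) :
    polarCurve c (fun t => a * U t) ∈ curveClassClosure (2 * Real.pi * c) := by
  have hR : ∀ n, IsRadialDefect (C n) fun t => A n * U t := fun n =>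
    h.isRadialDefect (hA n) (hc.trans (hC n).le)
  have hR' := h.isRadialDefect ha hc
  have hc0 : 0 < c := by linarith
  have hC0 : ∀ n, 0 < C n := fun n => hc0.trans (hC n)
  obtain ⟨k, hk0, hk1, hkC, hk⟩ : ∃ k : ℕ → ℝ, (∀ n, 0 < k n) ∧ (∀ n, k n < 1) ∧
      (∀ n, k n * C n = c) ∧ Tendsto (fun n => ((k n : ℝ) : ℂ)) atTop (𝓝 1) := by
    refine ⟨fun n => c / C n, fun n => div_pos hc0 (hC0 n), fun n => (div_lt_one (hC0 n)).2 (hC n),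
      fun n => div_mul_cancel₀ _ (hC0 n).ne', ?_⟩
    have h1 : Tendsto (fun n => c / C n) atTop (𝓝 (c / c)) := tendsto_const_nhds.div hCc hc0.ne'
    rw [div_self hc0.ne'] at h1
    have h2 := (Complex.continuous_ofReal.tendsto _).comp h1
    rw [Complex.ofReal_one] at h2
    exact h2
  have hmem : ∀ n, (fun θ => (k n : ℂ) * polarCurve (C n) (fun t => A n * U t) θ)
      ∈ curveClass (2 * Real.pi * c) := fun n => by
    have := (hR n).shrunk_mem_curveClass (hk0 n) (hk1 n) (hcl n)
    rwa [hkC] at this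
  have hv1 : ∀ n, deriv (fun θ => (k n : ℂ) * polarCurve (C n) (fun t => A n * U t) θ)
      = fun θ => (k n : ℂ) * polarVelocity (C n) (fun t => A n * U t) θ :=
    fun n => funext fun θ => (((hR n).hasDerivAt_polarCurve θ).const_mul _).deriv
  have hv2 : ∀ n, deriv (fun θ => (k n : ℂ) * polarVelocity (C n) (fun t => A n * U t) θ)
      = fun θ => (k n : ℂ) * polarAcceleration (C n) (fun t => A n * U t) θ :=
    fun n => funext fun θ => (((hR n).hasDerivAt_polarVelocity θ).const_mul _).deriv
  have hscale : ∀ {f : ℕ → ℂ} {z : ℂ}, Tendsto f atTop (𝓝 z) →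
      Tendsto (fun n => (k n : ℂ) * f n) atTop (𝓝 z) := fun {f z} hf => by
    have := hk.mul hf
    rwa [one_mul] at this
  have hnorm : ∀ n (z : ℂ), ‖(k n : ℂ) * z‖ ≤ ‖z‖ := fun n z => by
    rw [norm_mul, Complex.norm_real, Real.norm_eq_abs, abs_of_pos (hk0 n)]
    exact mul_le_of_le_one_left (norm_nonneg _) (hk1 n).le
  obtain ⟨B, hB⟩ := h.exists_bound_polarAcceleration (c + 1)
  refine ⟨isW22_of_contDiff hR'.contDiff_polarCurve (hR'.periodic_polarCurve hcl'),
    fun n θ => (k n : ℂ) * polarCurve (C n) (fun t => A n * U t) θ, hmem, ?_, ?_, ?_⟩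
  · exact weakL2Tendsto_of_bounded (C := 1) (fun n => (hmem n).2.1.continuous)
      (fun n θ => (hnorm n _).trans ((hR n).norm_polarCurve_le θ))
      fun θ => hscale (h.tendsto_polarCurve hA ha hAa hCc θ)
  · rw [hR'.deriv_polarCurve]
    refine weakL2Tendsto_of_bounded (C := c + 1) (fun n => (hmem n).2.1.continuous_deriv (by simp))
      (fun n θ => ?_) fun θ => ?_
    · rw [hv1]
      refine (hnorm n _).trans ?_
      rw [(hR n).norm_polarVelocity]
      exact hC1 n
    · simp only [hv1]
      exact hscale (h.tendsto_polarVelocity hA ha hAa hc hCc θ)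
  · rw [hR'.deriv_polarCurve, hR'.deriv_polarVelocity]
    refine weakL2Tendsto_of_bounded (C := B) (fun n => continuous_deriv_deriv (hmem n).2.1)
      (fun n θ => ?_) fun θ => ?_
    · rw [hv1, hv2]
      exact (hnorm n _).trans (hB _ (hA n) _ (hc.trans (hC n).le) (hC1 n) θ)
    · simp only [hv1, hv2]
      exact hscale (h.tendsto_polarAcceleration hA ha hAa hc hCc θ)

/-- If the total angle crosses `2π` between two amplitudes, some amplitude in between yields a
closed curve in the closure of the smooth embedded curves. -/
lemma exists_polarCurve_mem_closure {a₁ a₂ c : ℝ} (h1 : 1 / 2 ≤ a₁) (h12 : a₁ ≤ a₂)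
    (h2 : a₂ ≤ 3 / 2) (hc : 1 ≤ c)
    (hlow : 2 * Real.pi < polarAngle c (fun t => a₁ * U t) (2 * Real.pi))
    (hup : polarAngle c (fun t => a₂ * U t) (2 * Real.pi) < 2 * Real.pi) :
    ∃ a ∈ Icc a₁ a₂, polarAngle c (fun t => a * U t) (2 * Real.pi) = 2 * Real.pi ∧
      polarCurve c (fun t => a * U t) ∈ curveClassClosure (2 * Real.pi * c) := by
  have hsub : Icc a₁ a₂ ⊆ Icc (1 / 2 : ℝ) (3 / 2) := Icc_subset_Icc h1 h2
  have hcont := h.continuousOn_polarAngle (2 * Real.pi)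
  let C : ℕ → ℝ := fun n => c + 1 / ((n : ℝ) + 1)
  have hCc : Tendsto C atTop (𝓝 c) := by
    have := (tendsto_one_div_add_atTop_nhds_zero_nat (𝕜 := ℝ)).const_add c
    rw [add_zero] at this
    exact this
  have hClt : ∀ n, c < C n := fun n => by
    have : (0 : ℝ) < 1 / ((n : ℝ) + 1) := by positivity
    simp only [C]; linarith
  have hCle : ∀ n, C n ≤ c + 1 := fun n => by
    have : 1 / ((n : ℝ) + 1) ≤ 1 := by
      rw [div_le_one (by positivity)]; linarith [(Nat.cast_nonneg n : (0 : ℝ) ≤ n)]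
    simp only [C]; linarith
  have ev1 := (h.tendsto_polarAngle (A := fun _ => a₁) (fun _ => hsub ⟨le_rfl, h12⟩)
    (hsub ⟨le_rfl, h12⟩) tendsto_const_nhds hCc (2 * Real.pi)).eventually (lt_mem_nhds hlow)
  have ev2 := (h.tendsto_polarAngle (A := fun _ => a₂) (fun _ => hsub ⟨h12, le_rfl⟩)
    (hsub ⟨h12, le_rfl⟩) tendsto_const_nhds hCc (2 * Real.pi)).eventually (gt_mem_nhds hup)
  obtain ⟨N, hN⟩ := eventually_atTop.1 (ev1.and ev2)
  have hex : ∀ n, ∃ a ∈ Icc a₁ a₂,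
      polarAngle (C (n + N)) (fun t => a * U t) (2 * Real.pi) = 2 * Real.pi := by
    intro n
    obtain ⟨g1, g2⟩ := hN (n + N) (Nat.le_add_left _ _)
    have hco : ContinuousOn (fun a => polarAngle (C (n + N)) (fun t => a * U t) (2 * Real.pi))
        (Icc a₁ a₂) :=
      hcont.comp (f := fun a : ℝ => (a, C (n + N))) (by fun_prop) fun a ha => ⟨hsub ha, mem_univ _⟩
    exact intermediate_value_Icc' h12 hco ⟨g2.le, g1.le⟩
  choose A hA hAcl using hex
  obtain ⟨a, ha, φ, hφ, hlim⟩ := isCompact_Icc.tendsto_subseq hA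
  have hCφ : Tendsto (fun n => C (φ n + N)) atTop (𝓝 c) :=
    hCc.comp ((tendsto_add_atTop_nat N).comp hφ.tendsto_atTop)
  have hcl : polarAngle c (fun t => a * U t) (2 * Real.pi) = 2 * Real.pi := by
    refine tendsto_nhds_unique (h.tendsto_polarAngle (A := A ∘ φ) (fun n => hsub (hA _))
      (hsub ha) hlim hCφ (2 * Real.pi)) ?_
    simp only [Function.comp, hAcl]
    exact tendsto_const_nhds
  exact ⟨a, ha, hcl, h.polarCurve_mem_closure (A := A ∘ φ) (C := fun n => C (φ n + N))
    (fun n => hsub (hA _)) (hsub ha) hlim hc (fun n => hClt _) (fun n => hCle _) hCφ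
    (fun n => hAcl _) hcl⟩

end IsBumpShape

/-! ### The upper bound -/

/-- Elementary upper bound for the angular speed `s / ρ`, where `s² = c² ρ - v²` and `ρ = 1 - 2 u`;
the counterpart of `le_abs_angularSpeed`. -/
lemma angularSpeed_le {c u v s : ℝ} (hc : 1 ≤ c) (hu : 0 ≤ u) (hu1 : u ≤ 1 / 8)
    (hv : v ^ 2 ≤ 1 / 16) (hs : s ^ 2 = c ^ 2 * (1 - 2 * u) - v ^ 2) :
    s / (1 - 2 * u) ≤ c * (1 + u + 4 * u ^ 2) - (v ^ 2 / 2) / c := by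
  have hc0 : 0 < c := by linarith
  have hρ : 0 < 1 - 2 * u := by linarith
  set T := 1 + u + 4 * u ^ 2 with hT
  have hT1 : 1 ≤ T := by nlinarith
  have hB : 0 ≤ c * T - (v ^ 2 / 2) / c := by
    have h1 : (v ^ 2 / 2) / c ≤ v ^ 2 / 2 := div_le_self (by positivity) hc
    have h2 : 1 ≤ c * T := one_le_mul_of_one_le_of_one_le hc hT1
    linarith
  rw [div_le_iff₀ hρ]
  refine abs_le_of_sq_le_sq' ?_ (mul_nonneg hB hρ.le) |>.2
  have e : ((c * T - (v ^ 2 / 2) / c) * (1 - 2 * u)) ^ 2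
      = c ^ 2 * (1 - 2 * u) * ((1 - 2 * u) * T ^ 2) - v ^ 2 * ((1 - 2 * u) ^ 2 * T)
        + ((v ^ 2 / 2) / c * (1 - 2 * u)) ^ 2 := by
    field_simp
    ring
  have u2 : u ^ 2 ≤ u / 8 := by nlinarith
  have h1 : 1 ≤ (1 - 2 * u) * T ^ 2 := by
    have : (1 - 2 * u) * T ^ 2 = 1 + u ^ 2 * (5 - 10 * u - 32 * (u * u ^ 2)) := by rw [hT]; ring
    have h3 : u * u ^ 2 ≤ 1 / 64 := by nlinarith
    have := mul_nonneg (sq_nonneg u) (by linarith : 0 ≤ 5 - 10 * u - 32 * (u * u ^ 2))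
    linarith
  have h2 : (1 - 2 * u) ^ 2 * T ≤ 1 := by
    have : (1 - 2 * u) ^ 2 * T = 1 - u * (3 - 4 * u + 4 * u ^ 2 * (3 - 4 * u)) := by rw [hT]; ring
    have h3 := mul_nonneg (sq_nonneg u) (by linarith : 0 ≤ 3 - 4 * u)
    have := mul_nonneg hu (by linarith : 0 ≤ 3 - 4 * u + 4 * u ^ 2 * (3 - 4 * u))
    linarith
  have h3 := mul_le_mul_of_nonneg_left h1 (mul_nonneg (sq_nonneg c) hρ.le)
  have h4 := mul_le_mul_of_nonneg_left h2 (sq_nonneg v)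
  rw [hs, e]
  nlinarith [sq_nonneg ((v ^ 2 / 2) / c * (1 - 2 * u))]

namespace IsRadialDefect

variable {c : ℝ} {u : ℝ → ℝ} (h : IsRadialDefect c u)
include h

lemma polarAngle_two_pi_le {m : ℝ} (hm : ∀ θ, u θ ≤ m) :
    polarAngle c u (2 * Real.pi) ≤ 2 * Real.pi * c
      + c * (1 + 4 * m) * (∫ θ in Ioc 0 (2 * Real.pi), u θ)
      - (∫ θ in Ioc 0 (2 * Real.pi), (deriv u θ) ^ 2 / 2) / c := by
  have hc0 : 0 < c := by linarith [h.one_le]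
  have hu := h.contDiff.continuous
  have hv := (contDiff_deriv_of_smooth h.contDiff).continuous
  have hint : ∀ {f : ℝ → ℝ}, Continuous f → IntegrableOn f (Ioc 0 (2 * Real.pi)) := fun hf =>
    hf.integrableOn_Icc.mono_set Ioc_subset_Icc_self
  have e : ∫ θ in Ioc 0 (2 * Real.pi), (c + c * (1 + 4 * m) * u θ - (deriv u θ) ^ 2 / 2 / c)
      = 2 * Real.pi * c + c * (1 + 4 * m) * (∫ θ in Ioc 0 (2 * Real.pi), u θ)
        - (∫ θ in Ioc 0 (2 * Real.pi), (deriv u θ) ^ 2 / 2) / c := by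
    rw [integral_sub (hint (by fun_prop)) (hint (by fun_prop)),
      integral_add (hint (by fun_prop)) (hint (by fun_prop)), integral_const_mul, integral_div]
    simp [Real.pi_pos.le]
  rw [← e, polarAngle, intervalIntegral.integral_of_le Real.two_pi_pos.le]
  refine setIntegral_mono (hint h.contDiff_angularSpeed.continuous) (hint (by fun_prop)) fun θ => ?_
  have h1 := angularSpeed_le h.one_le (h.nonneg θ) (h.le θ) (h.slope_sq_le θ) (h.tangential_sq θ)
  have h2 : c * (4 * u θ ^ 2) ≤ c * (4 * m * u θ) := by
    refine mul_le_mul_of_nonneg_left ?_ hc0.le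
    have := mul_le_mul_of_nonneg_right (hm θ) (h.nonneg θ)
    linarith
  dsimp only
  linarith

lemma le_polarAngle_two_pi {ε : ℝ} (hε : 0 < ε) (hε1 : ε ≤ 1) (hu : ∀ θ, u θ ≤ ε / 16)
    (hv : ∀ θ, |deriv u θ| ≤ ε / 16) :
    2 * Real.pi * c + (∫ θ in Ioc 0 (2 * Real.pi), u θ)
      - (1 + ε) * (∫ θ in Ioc 0 (2 * Real.pi), (deriv u θ) ^ 2 / 2)
      ≤ polarAngle c u (2 * Real.pi) := by
  have huc := h.contDiff.continuous
  have hvc := (contDiff_deriv_of_smooth h.contDiff).continuous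
  have hint : ∀ {f : ℝ → ℝ}, Continuous f → IntegrableOn f (Ioc 0 (2 * Real.pi)) := fun hf =>
    hf.integrableOn_Icc.mono_set Ioc_subset_Icc_self
  have e : ∫ θ in Ioc 0 (2 * Real.pi), (c + u θ - (1 + ε) * ((deriv u θ) ^ 2 / 2))
      = 2 * Real.pi * c + (∫ θ in Ioc 0 (2 * Real.pi), u θ)
        - (1 + ε) * (∫ θ in Ioc 0 (2 * Real.pi), (deriv u θ) ^ 2 / 2) := by
    rw [integral_sub (hint (by fun_prop)) (hint (by fun_prop)),
      integral_add (hint (by fun_prop)) (hint (by fun_prop)), integral_const_mul]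
    simp [Real.pi_pos.le]
  rw [← e, polarAngle, intervalIntegral.integral_of_le Real.two_pi_pos.le]
  refine setIntegral_mono (hint (by fun_prop)) (hint h.contDiff_angularSpeed.continuous) fun θ => ?_
  have hρ := h.rho_pos θ
  have h1 := le_abs_angularSpeed (r := tangential c u θ / (1 - 2 * u θ)) hε hε1 h.one_le
    (h.nonneg θ) (hu θ) (hv θ) (by
      rw [div_pow, div_mul_cancel₀ _ (pow_pos hρ 2).ne', h.tangential_sq])
  rw [abs_of_pos (div_pos (h.tangential_pos θ) hρ)] at h1
  have h2 := le_mul_of_one_le_left (h.nonneg θ) h.one_le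
  dsimp only
  linarith

end IsRadialDefect

lemma eventually_lt_of_continuous {f : ℝ → ℝ} (hf : Continuous f) {b : ℝ} (h : f 0 < b) :
    ∀ᶠ x in 𝓝[>] (0 : ℝ), f x < b :=
  nhdsWithin_le_nhds (hf.continuousAt.eventually (gt_mem_nhds h))

lemma integral_amplitude_slope (U : ℝ → ℝ) (a : ℝ) {P : ℝ}
    (hP : ∫ θ in Ioc 0 (2 * Real.pi), (deriv U θ) ^ 2 / 2 = P) :
    ∫ θ in Ioc 0 (2 * Real.pi), (deriv (fun t => a * U t) θ) ^ 2 / 2 = a ^ 2 * P := by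
  rw [← hP, ← integral_const_mul, deriv_amplitude]
  congr 1
  funext θ
  ring

namespace IsBumpShape

variable {U : ℝ → ℝ} (h : IsBumpShape U)
include h

/-- A bump which is too flat yields too large a total angle. -/
lemma two_pi_lt_polarAngle {δ β ε c P Q K : ℝ} (hδ : 0 < δ) (hβ : 0 < β) (hβ2 : β < 1 / 2)
    (hε : 0 < ε) (hε1 : ε ≤ 1) (hc : 1 ≤ c) (hcδ : 2 * Real.pi * c = 2 * Real.pi + δ) (hQ : 0 ≤ Q)
    (hPQ : P = 1 + Q) (hεP : ε * P < β) (hK : K ≤ ε / 32) (hU : ∀ θ, U θ ≤ K)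
    (hU' : ∀ θ, |deriv U θ| ≤ K) (hIQ : ∫ θ in Ioc 0 (2 * Real.pi), U θ = δ * Q)
    (hIP : ∫ θ in Ioc 0 (2 * Real.pi), (deriv U θ) ^ 2 / 2 = δ * P) :
    2 * Real.pi < polarAngle c (fun t => (1 - β) * U t) (2 * Real.pi) := by
  have m : 1 - β ∈ Icc (1 / 2 : ℝ) (3 / 2) := ⟨by linarith, by linarith⟩
  have hb0 : 0 ≤ 1 - β := by linarith
  have hb1 : 1 - β ≤ 1 := by linarith
  have := (h.isRadialDefect m hc).le_polarAngle_two_pi hε hε1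
    (fun θ => by
      have := mul_le_of_le_one_left (h.nonneg θ) hb1
      linarith [hU θ])
    (fun θ => by
      rw [deriv_amplitude, abs_mul, abs_of_nonneg hb0]
      have := mul_le_of_le_one_left (abs_nonneg (deriv U θ)) hb1
      linarith [hU' θ])
  rw [integral_const_mul, hIQ, integral_amplitude_slope _ _ hIP, hcδ] at this
  refine lt_of_lt_of_le ?_ this
  have key : 0 < 1 + (1 - β) * Q - (1 + ε) * ((1 - β) ^ 2 * P) := by
    have e1 : ε * P * (1 - β) ^ 2 ≤ ε * P :=
      mul_le_of_le_one_right (mul_nonneg hε.le (by linarith)) (pow_le_one₀ hb0 hb1)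
    have e2 : 0 ≤ β * (1 - β) * Q := mul_nonneg (mul_nonneg hβ.le hb0) hQ
    have e3 : 0 < β * (1 - β) := mul_pos hβ (by linarith)
    have e4 : 1 + (1 - β) * Q - (1 + ε) * ((1 - β) ^ 2 * P)
        = β + β * (1 - β) + β * (1 - β) * Q - ε * P * (1 - β) ^ 2 := by rw [hPQ]; ring
    rw [e4]
    linarith
  have := mul_pos hδ key
  linarith

/-- A bump which is too steep yields too small a total angle. -/
lemma polarAngle_lt_two_pi {δ β c P Q K : ℝ} (hδ : 0 < δ) (hβ : 0 < β) (hβ2 : β < 1 / 2)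
    (hc : 1 ≤ c) (hcδ : 2 * Real.pi * c = 2 * Real.pi + δ) (hU : ∀ θ, U θ ≤ K)
    (hPQ : c + c ^ 2 * (1 + 4 * (2 * K)) * ((1 + β) * Q) < (1 + β) ^ 2 * P)
    (hIQ : ∫ θ in Ioc 0 (2 * Real.pi), U θ = δ * Q)
    (hIP : ∫ θ in Ioc 0 (2 * Real.pi), (deriv U θ) ^ 2 / 2 = δ * P) :
    polarAngle c (fun t => (1 + β) * U t) (2 * Real.pi) < 2 * Real.pi := by
  have m : 1 + β ∈ Icc (1 / 2 : ℝ) (3 / 2) := ⟨by linarith, by linarith⟩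
  have hc0 : 0 < c := by linarith
  have := (h.isRadialDefect m hc).polarAngle_two_pi_le (m := 2 * K)
    (fun θ => mul_le_mul (by linarith) (hU θ) (h.nonneg θ) (by norm_num))
  rw [integral_const_mul, hIQ, integral_amplitude_slope _ _ hIP, hcδ] at this
  refine lt_of_le_of_lt this ?_
  have e1 : δ * (c + c ^ 2 * (1 + 4 * (2 * K)) * ((1 + β) * Q)) / c
      < δ * ((1 + β) ^ 2 * P) / c :=
    div_lt_div_of_pos_right (mul_lt_mul_of_pos_left hPQ hδ) hc0
  have e2 : δ * (c + c ^ 2 * (1 + 4 * (2 * K)) * ((1 + β) * Q)) / c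
      = δ + c * (1 + 4 * (2 * K)) * ((1 + β) * (δ * Q)) := by field_simp
  have e3 : (1 + β) ^ 2 * (δ * P) / c = δ * ((1 + β) ^ 2 * P) / c := by ring
  rw [e2] at e1
  rw [e3]
  linarith

lemma penalisedEnergy_polarCurve_le {α a b c κ J V : ℝ} (hα : 0 ≤ α)
    (ha : a ∈ Icc (1 / 2 : ℝ) (3 / 2)) (hab : a ≤ b) (hc : 1 ≤ c)
    (hcl : polarAngle c (fun t => a * U t) (2 * Real.pi) = 2 * Real.pi) (hκ1 : κ < 1)
    (hκ : ∀ θ, 3 * U θ + 9 / 4 * deriv U θ ^ 2 ≤ κ)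
    (hJ : ∫ θ in Ioc 0 (2 * Real.pi), (deriv (deriv U) θ) ^ 2 = J)
    (hV : (volume ({θ | 0 < U θ} ∩ Ico 0 (2 * Real.pi))).toReal ≤ V) :
    penalisedEnergy α (polarCurve c fun t => a * U t)
      ≤ (2 * Real.pi * c + b ^ 2 * J + α * (c * V)) / (1 - κ) := by
  have hR := h.isRadialDefect ha hc
  have ha0 : 0 < a := by linarith [ha.1]
  have hκ' : 0 < 1 - κ := by linarith
  have hu : ∀ θ, 2 * (a * U θ) ≤ 3 * U θ := fun θ => by
    have := mul_le_mul_of_nonneg_right ha.2 (h.nonneg θ)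
    linarith
  have ha2 : a ^ 2 ≤ 9 / 4 := (pow_le_pow_left₀ ha0.le ha.2 2).trans_eq (by norm_num)
  have hel := hR.elasticEnergy_polarCurve_le hcl hκ1 fun θ => by
    rw [deriv_amplitude, mul_pow]
    have := mul_le_mul_of_nonneg_right ha2 (sq_nonneg (deriv U θ))
    linarith [hκ θ, hu θ]
  have hme := hR.hausdorffMeasure_diff_polarCurve_le hcl hκ1 fun θ => by
    linarith [hκ θ, hu θ, sq_nonneg (deriv U θ)]
  have hE : ∫ θ in Ioc 0 (2 * Real.pi), (deriv (deriv fun t => a * U t) θ) ^ 2 = a ^ 2 * J := by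
    rw [← hJ, ← integral_const_mul, deriv_amplitude, deriv_amplitude]
    congr 1
    funext θ
    ring
  have hset : {θ | 0 < a * U θ} = {θ | 0 < U θ} := by
    ext θ
    exact mul_pos_iff_of_pos_left ha0
  have hJ0 : 0 ≤ J := by
    rw [← hJ]
    exact integral_nonneg fun _ => sq_nonneg _
  rw [hE] at hel
  rw [hset] at hme
  have hme' := mul_le_mul_of_nonneg_left
    (hme.trans (mul_le_mul_of_nonneg_left hV (by positivity))) hα
  have hel' := hel.trans (div_le_div_of_nonneg_right (add_le_add_right
    (mul_le_mul_of_nonneg_right (pow_le_pow_left₀ ha0.le hab 2) hJ0) (2 * Real.pi * c)) hκ'.le)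
  have e : (2 * Real.pi * c + b ^ 2 * J + α * (c * V)) / (1 - κ)
      = (2 * Real.pi * c + b ^ 2 * J) / (1 - κ) + α * (c / (1 - κ) * V) := by ring
  rw [e]
  exact add_le_add hel' hme'

end IsBumpShape

/-- The competitor built from a profile `φ`: its radial defect is a bump `ε² φ(· / ε)`, with
`ε = δ^{1/3}`, whose amplitude is adjusted so that the curve closes up. -/
lemma eventually_exists_penalisedEnergy_le_cube {α η : ℝ} {φ : ℝ → ℝ} (hα : 0 ≤ α) (hη : 0 < η)
    (hφ : φ ∈ profileClass) :
    ∀ᶠ X : ℝ in 𝓝[>] 0, ∃ γ ∈ curveClassClosure (2 * Real.pi + X ^ 3),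
      penalisedEnergy α γ ≤ 2 * Real.pi + (profileEnergy α φ + η) * X := by
  obtain ⟨K, P, Q, hK, hQ, hPQ, ε₀, hε₀, hbump⟩ := exists_periodic_bump hφ
  set E := ∫ x, (deriv (deriv φ) x) ^ 2 with hE
  set S := (volume {x : ℝ | 0 < φ x}).toReal with hS
  have hprof : profileEnergy α φ = E + α * S := by rw [profileEnergy, hausdorffMeasure_real]
  rw [hprof]
  -- the tolerance `β` for the amplitude
  obtain ⟨β, ⟨hβE, hβ2⟩, hβ0⟩ := ((eventually_lt_of_continuous
    (f := fun β => (1 + β) ^ 2 * E + α * S) (b := E + α * S + η) (by fun_prop)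
    (by simpa using hη)).and (eventually_lt_of_continuous continuous_id
      (by norm_num : (0 : ℝ) < 1 / 2))).and self_mem_nhdsWithin |>.exists
  have hβ0 : 0 < β := hβ0
  have hβ2 : β < 1 / 2 := hβ2
  -- the loss `ε` in the lower bound for the total angle
  obtain ⟨ε, ⟨hεP, hε1⟩, hε⟩ := ((eventually_lt_of_continuous (f := fun ε => ε * P) (b := β)
    (by fun_prop) (by simpa using hβ0)).and (eventually_lt_of_continuous continuous_id
      (by norm_num : (0 : ℝ) < 1))).and self_mem_nhdsWithin |>.exists
  have hε : 0 < ε := hε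
  have hε1 : ε < 1 := hε1
  have l0 : ∀ᶠ X : ℝ in 𝓝[>] 0, X < 1 := eventually_lt_of_continuous continuous_id one_pos
  have l2 : ∀ᶠ X : ℝ in 𝓝[>] 0, K * X < ε / 32 :=
    eventually_lt_of_continuous (by fun_prop) (by rw [mul_zero]; positivity)
  have l3 : ∀ᶠ X : ℝ in 𝓝[>] 0, X < ε₀ := eventually_lt_of_continuous continuous_id hε₀
  -- at the amplitude `1 + β` the total angle falls short of `2π`
  have l4 : ∀ᶠ X : ℝ in 𝓝[>] 0, (1 + X ^ 3 / (2 * Real.pi)) + (1 + X ^ 3 / (2 * Real.pi)) ^ 2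
      * (1 + 4 * (2 * (K * X))) * ((1 + β) * Q) < (1 + β) ^ 2 * P := by
    refine eventually_lt_of_continuous (by fun_prop) ?_
    simp only [zero_pow three_ne_zero, zero_div, mul_zero, add_zero, one_pow, one_mul]
    have e : (1 + β) ^ 2 * P - (1 + (1 + β) * Q) = β * (2 + β) + β * (1 + β) * Q := by
      rw [hPQ]; ring
    have : 0 < β * (2 + β) + β * (1 + β) * Q := by positivity
    linarith
  -- the final energy estimate, after division by `X`
  have l5 : ∀ᶠ X : ℝ in 𝓝[>] 0, X ^ 2 + (1 + β) ^ 2 * E + α * ((1 + X ^ 3 / (2 * Real.pi)) * S)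
      + (3 * K + 9 / 4 * K ^ 2) * X * (2 * Real.pi + (E + α * S + η) * X) < E + α * S + η := by
    refine eventually_lt_of_continuous (by fun_prop) ?_
    simpa using hβE
  have l6 : ∀ᶠ X : ℝ in 𝓝[>] 0, (3 * K + 9 / 4 * K ^ 2) * X ^ 2 < 1 :=
    eventually_lt_of_continuous (by fun_prop) (by rw [zero_pow two_ne_zero, mul_zero]; norm_num)
  filter_upwards [l0, l2, l3, l4, l5, l6, self_mem_nhdsWithin] with X h1 h2 h3 h4 h5 h6 hX
  have hX : 0 < X := hX
  obtain ⟨U, hUs, hUp, hU0, hUK, hUK', hUI, hUI', hUI'', hUS⟩ := hbump X hX h3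
  have hX3 : 0 < X ^ 3 := by positivity
  have hUKX : ∀ θ, U θ ≤ K * X := fun θ => (hUK θ).trans
    (mul_le_mul_of_nonneg_left (pow_le_of_le_one hX.le h1.le two_ne_zero) hK)
  set c := 1 + X ^ 3 / (2 * Real.pi) with hc
  have hc1 : 1 ≤ c := by rw [hc]; linarith [div_pos hX3 Real.two_pi_pos]
  have h2c : 2 * Real.pi * c = 2 * Real.pi + X ^ 3 := by rw [hc]; field_simp
  have hshape : IsBumpShape U := ⟨hUs, hUp, hU0, fun θ => by linarith [hUKX θ],
    fun θ => by linarith [hUK' θ]⟩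
  obtain ⟨a, ha, hcl, hmem⟩ := hshape.exists_polarCurve_mem_closure (a₁ := 1 - β) (a₂ := 1 + β)
    (by linarith) (by linarith) (by linarith) hc1
    (hshape.two_pi_lt_polarAngle hX3 hβ0 hβ2 hε hε1.le hc1 h2c hQ hPQ hεP h2.le hUKX hUK' hUI hUI')
    (hshape.polarAngle_lt_two_pi hX3 hβ0 hβ2 hc1 h2c hUKX h4 hUI hUI')
  rw [h2c] at hmem
  refine ⟨_, hmem, ?_⟩
  have hκ : ∀ θ, 3 * U θ + 9 / 4 * deriv U θ ^ 2 ≤ (3 * K + 9 / 4 * K ^ 2) * X ^ 2 := fun θ => by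
    have e := sq_le_sq' (abs_le.1 (hUK' θ)).1 (abs_le.1 (hUK' θ)).2
    rw [mul_pow] at e
    linarith [hUK θ]
  refine (hshape.penalisedEnergy_polarCurve_le hα ⟨by linarith [ha.1], by linarith [ha.2]⟩ ha.2 hc1
    hcl h6 hκ hUI'' hUS).trans ?_
  rw [h2c, div_le_iff₀ (by linarith)]
  have h7 := mul_lt_mul_of_pos_right h5 hX
  linarith

/-- The upper bound of the expansion. -/
lemma eventually_exists_penalisedEnergy_le {α η : ℝ} {φ : ℝ → ℝ} (hα : 0 ≤ α) (hη : 0 < η)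
    (hφ : φ ∈ profileClass) :
    ∀ᶠ δ : ℝ in 𝓝[>] 0, ∃ γ ∈ curveClassClosure (2 * Real.pi + δ),
      penalisedEnergy α γ ≤ 2 * Real.pi + (profileEnergy α φ + η) * δ ^ (1 / 3 : ℝ) := by
  have hX : Tendsto (fun δ : ℝ => δ ^ (1 / 3 : ℝ)) (𝓝[>] 0) (𝓝[>] 0) :=
    tendsto_nhdsWithin_iff.2 ⟨tendsto_rpow_third,
      eventually_mem_nhdsWithin.mono fun δ hδ => Real.rpow_pos_of_pos hδ _⟩
  filter_upwards [hX.eventually (eventually_exists_penalisedEnergy_le_cube hα hη hφ),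
    self_mem_nhdsWithin] with δ h hδ
  have hX3 : (δ ^ (1 / 3 : ℝ)) ^ 3 = δ := by
    rw [← Real.rpow_natCast, ← Real.rpow_mul (le_of_lt hδ)]; norm_num
  rwa [hX3] at h

end Delamination

end

theorem mainTheorem5 (α : ℝ) (hα : 0 ≤ α) :
    IsGLB (Delamination.profileEnergy α '' Delamination.profileClass)
      (Delamination.delaminationConstant α) ∧
    (∀ᶠ δ : ℝ in 𝓝[>] 0,
      IsGLB (Delamination.penalisedEnergy α '' Delamination.curveClassClosure (2 * Real.pi + δ))
        (Delamination.minimalEnergy α (2 * Real.pi + δ))) ∧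
    (fun δ : ℝ => Delamination.minimalEnergy α (2 * Real.pi + δ)
        - (2 * Real.pi + Delamination.delaminationConstant α * δ ^ (1 / 3 : ℝ)))
      =o[𝓝[>] 0] (fun δ : ℝ => δ ^ (1 / 3 : ℝ)) := by
  obtain ⟨φ₀, hφ₀⟩ := Delamination.profileClass_nonempty
  have hne : (Delamination.profileEnergy α '' Delamination.profileClass).Nonempty :=
    ⟨_, mem_image_of_mem _ hφ₀⟩
  have hglb : ∀ᶠ δ : ℝ in 𝓝[>] 0,
      IsGLB (Delamination.penalisedEnergy α '' Delamination.curveClassClosure (2 * Real.pi + δ))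
        (Delamination.minimalEnergy α (2 * Real.pi + δ)) := by
    filter_upwards [Delamination.eventually_le_penalisedEnergy hα one_pos,
      Delamination.eventually_exists_penalisedEnergy_le hα one_pos hφ₀] with δ h1 h2
    obtain ⟨γ, hγ, -⟩ := h2
    exact isGLB_csInf ⟨_, mem_image_of_mem _ hγ⟩ ⟨_, forall_mem_image.2 h1⟩
  refine ⟨isGLB_csInf hne (Delamination.bddBelow_profileEnergy hα), hglb, ?_⟩
  refine Asymptotics.isLittleO_iff.2 fun η hη => ?_
  obtain ⟨_, ⟨φ, hφ, rfl⟩, hφη⟩ := exists_lt_of_csInf_lt hne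
    (lt_add_of_pos_right (Delamination.delaminationConstant α) (half_pos hη))
  filter_upwards [hglb, Delamination.eventually_le_penalisedEnergy hα hη,
    Delamination.eventually_exists_penalisedEnergy_le hα (half_pos hη) hφ,
    self_mem_nhdsWithin] with δ h1 h2 h3 hδ
  obtain ⟨γ, hγ, hle⟩ := h3
  have hX : 0 ≤ δ ^ (1 / 3 : ℝ) := Real.rpow_nonneg (le_of_lt hδ) _
  have lower := h1.2 (forall_mem_image.2 h2)
  have upper := (h1.1 (mem_image_of_mem _ hγ)).trans hle
  have hφX := mul_le_mul_of_nonneg_right hφη.le hX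
  rw [Real.norm_eq_abs, Real.norm_eq_abs, abs_of_nonneg hX, abs_le]
  constructor <;> linarith
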